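/- **Setting.** Let $G$ be a Lie group with Lie algebra $\mathfrak g$, and let $\Gamma\rightrightarrows\Gamma_0$ be a Lie groupoid with source $\beta$ and target $\alpha$ (all manifolds are smooth and finite-dimensional). Let $\Gamma_p$ be the manifold of composable $p$-tuples of arrows, with face maps $\varepsilon_i:\Gamma_{p+1}\to\Gamma_p$, $0\le i\le p+1$. Let $\Omega^\bullet(\Gamma_\bullet)$ be the total complex of the double complex $\Omega^q(\Gamma_p)$ with differential $\delta=(-1)^pd+\partial$, where $\partial=\sum_i(-1)^i\varepsilon_i^*$. Write $Z^m(\Gamma_\bullet)$ for its cocycles and $H^m_{dR}(\Gamma_\bullet)$ for its cohomology in total degree $m$. On $\Omega^\bullet(\Gamma_0)$ one has $\partial=\beta^*-\alpha^*$. Put $\Omega^\bullet(\Gamma_0)^\Gamma=\{\eta:\partial\eta=0\}$, and let $Z^m(\Gamma_0)^\Gamma$ and $H^m_{dR}(\Gamma_0)^\Gamma$ be the cocycles and the cohomology of the complex $(\Omega^\bullet(\Gamma_0)^\Gamma,d)$. The inclusion $i:\Omega^\bullet(\Gamma_0)^\Gamma\to\Omega^\bullet(\Gamma_\bullet)$ as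 the part $p=0$ is a chain map, and it induces $i:H^m_{dR}(\Gamma_0)^\Gamma\to H^m_{dR}(\Gamma_\bullet)$. Let $\pi:P\to\Gamma_0$ be a principal $G$-bundle over $\Gamma\rightrightarrows\Gamma_0$, that is, a (right) principal $G$-bundle with a smooth left action of $\Gamma$ commuting with the action of $G$. Let $Q=\Gamma\times_{\beta,\Gamma_0,\pi}P\rightrightarrows P$ be the transformation groupoid, with source $(\gamma,x)\mapsto x$ and target $(\gamma,x)\mapsto\gamma\cdot x$. Write $Q_p$ for the manifold of its composable $p$-tuples and $p_0,\dots,p_p:Q_p\to P$ for the vertex maps. The projections $Q_p\to\Gamma_p$ are principal $G$-bundles, so that pull-back identifies $\Omega^\bullet(\Gamma_p)$ with the basic forms on $Q_p$. A *pseudo-connection* is a connection $1$-form $\theta'\in\Omega^1(P)\otimes\mathfrak g$ of the $G$-bundle $P\to\Gamma_0$. Its curvature is $\Omega=d\theta'+\frac12[\theta',\theta']$. For $f\in S^k(\mathfrak g^*)^G$, let $z_{\theta'}(f)\in Z^{2k}(\Gamma_\bullet)$ be the cocycle whose component in $\Omega^{2k-p}(\Gamma_p)$, for $0\le p\le 2k$,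 has pull-back to $Q_p$ equal to $$\int_{\Delta_p}f(\widetilde\Omega_p),\qquad \widetilde\Omega_p=d\widetilde\theta_p+\tfrac12[\widetilde\theta_p,\widetilde\theta_p],\qquad \widetilde\theta_p=\sum_{j=0}^pt_j\,p_j^*\theta'\in\Omega^1(\Delta_p\times Q_p)\otimes\mathfrak g,$$ where $\Delta_p$ is the standard simplex with barycentric coordinates $t_0,\dots,t_p$. The Chern–Weil map is $w_P:S^k(\mathfrak g^*)^G\to H^{2k}_{dR}(\Gamma_\bullet)$, $w_P(f)=[z_{\theta'}(f)]$. The maps $z_{\theta'}$ and $w_P$ are well-defined and linear, and $w_P$ does not depend on the pseudo-connection $\theta'$. A *connection* is a pseudo-connection $\theta$ with $\partial\theta=0$ in $\Omega^1(Q)\otimes\mathfrak g$, where $\partial$ is the difference of the pull-backs along the source and the target of $Q$. It is *flat* if its curvature vanishes. **Theorem F.** Suppose that $P$ admits a connection $\theta$, with curvature $\Omega\in\Omega^2(P)\otimes\mathfrak g$. Then for every $k\ge0$ and every $f\in S^k(\mathfrak g^*)^G$ the form $f(\Omega)$ is the pull-back to $P$ of a unique form $z(f)\in Z^{2k}(\Gamma_0)^\Gamma$,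 and $$z_\theta(f)=i(z(f))\in Z^{2k}(\Gamma_\bullet),\qquad w_P(f)=i(w(f))\in H^{2k}_{dR}(\Gamma_\bullet),\quad\text{where } w(f)=[z(f)]\in H^{2k}_{dR}(\Gamma_0)^\Gamma .$$ That is, $z_\theta=i\circ z$ on $S(\mathfrak g^*)^G$ at the level of cocycles, and $w_P=i\circ w$ in cohomology. Consequently, if $\theta$ is flat, then $z_\theta(f)=0$ and $w_P(f)=0$ for every $f\in S^k(\mathfrak g^*)^G$ with $k>0$. -/

import Mathlib

open scoped ContDiff Manifold Topology
open Diffeology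

noncomputable section

namespace GroupoidCW

/-! ### Smooth spaces: manifolds and their smooth families -/

/-- The Euclidean space `ℝⁿ`. -/
abbrev Euc (n : ℕ) : Type := EuclideanSpace ℝ (Fin n)

/-- The diffeology of a smooth manifold: its plots are the smooth maps `ℝⁿ → M`. -/
@[reducible]
def manifoldDiffeology (E : Type*) [NormedAddCommGroup E] [NormedSpace ℝ E]
    (M : Type*) [TopologicalSpace M] [ChartedSpace E M] : DiffeologicalSpace M :=
  .ofCorePlotsOn {
    isPlotOn := fun {n u} _ p ↦ ContMDiffOn 𝓘(ℝ, Euc n) 𝓘(ℝ, E) ∞ p u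
    isPlotOn_congr := fun _ _ _ h ↦ contMDiffOn_congr h
    isPlot := fun {n} p ↦ ContMDiff 𝓘(ℝ, Euc n) 𝓘(ℝ, E) ∞ p
    isPlotOn_univ := contMDiffOn_univ
    isPlot_const := fun _ ↦ contMDiff_const
    isPlotOn_reparam := fun _ _ _ h hp hf ↦ hp.comp hf.contMDiffOn h.subset_preimage
    locality := fun _ _ h ↦ fun x hxu ↦ by
      let ⟨v, hv, hxv, hv'⟩ := h x hxu
      exact ((hv' x hxv).contMDiffAt (hv.mem_nhds hxv)).contMDiffWithinAt }

/-- The diffeology induced by a map: `p` is a plot iff `f ∘ p` is one.  For the inclusion of an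
embedded submanifold into a manifold this is the diffeology of the submanifold. -/
@[reducible]
def inducedDiffeology {X Y : Type*} (f : X → Y) (D : DiffeologicalSpace Y) :
    DiffeologicalSpace X where
  plots n := {p | f ∘ p ∈ D.plots n}
  constant_plots x := D.constant_plots (f x)
  plot_reparam hp hf := D.plot_reparam hp hf
  locality hp := D.locality fun x ↦ by
    obtain ⟨u, hu, hxu, h⟩ := hp x
    exact ⟨u, hu, hxu, fun hf hf' ↦ h hf hf'⟩

/-! ### Differential forms -/

section Forms

variable {X Y : Type*} {V : Type*} [NormedAddCommGroup V] [NormedSpace ℝ V]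

/-- The forms on a smooth space, as a subspace of all families of (rough) forms on the `ℝⁿ`. -/
def formSubmodule (D : DiffeologicalSpace X) (V : Type*) [NormedAddCommGroup V] [NormedSpace ℝ V]
    (k : ℕ) :
    Submodule ℝ (∀ (n : ℕ), {φ : Euc n → X // IsPlot φ} → Euc n → Euc n [⋀^Fin k]→L[ℝ] V) where
  carrier := {η | (∀ n φ, ContDiff ℝ ∞ (η n φ)) ∧
    ∀ (m n : ℕ) (φ : {φ : Euc n → X // IsPlot φ}) (h : Euc m → Euc n) (hh : ContDiff ℝ ∞ h)
      (x : Euc m), η m ⟨φ.1 ∘ h, isPlot_reparam φ.2 hh⟩ x =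
        (η n φ (h x)).compContinuousLinearMap (fderiv ℝ h x)}
  zero_mem' := ⟨fun _ _ ↦ contDiff_const, fun _ _ _ _ _ _ ↦ by ext; simp⟩
  add_mem' := fun {a b} ha hb ↦ ⟨fun n φ ↦ (ha.1 n φ).add (hb.1 n φ),
    fun m n φ h hh x ↦ by
      ext v
      simp [ha.2 m n φ h hh x, hb.2 m n φ h hh x]⟩
  smul_mem' := fun c a ha ↦ ⟨fun n φ ↦ (ha.1 n φ).const_smul c,
    fun m n φ h hh x ↦ by
      ext v
      simp [ha.2 m n φ h hh x]⟩

/-- Differential `k`-forms with values in `V` on a smooth space: a form `η` assigns to each smooth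
family `φ : ℝⁿ → X` a smooth `k`-form `φ^*η` on `ℝⁿ`, compatibly with smooth changes of parameters.
On a smooth manifold these are the usual differential forms: the `φ^*η` for `φ` inverse to charts
are the local expressions of `η`, and they determine `η`. -/
def Form (D : DiffeologicalSpace X) (V : Type*) [NormedAddCommGroup V] [NormedSpace ℝ V]
    (k : ℕ) : Type _ := formSubmodule D V k

instance (D : DiffeologicalSpace X) (k : ℕ) : AddCommGroup (Form D V k) :=
  inferInstanceAs (AddCommGroup (formSubmodule D V k))

instance (D : DiffeologicalSpace X) (k : ℕ) : Module ℝ (Form D V k) :=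
  inferInstanceAs (Module ℝ (formSubmodule D V k))

/-- The pull-back `φ^*η` of a form along a smooth family `φ : ℝⁿ → X`. -/
def Form.on {D : DiffeologicalSpace X} {k : ℕ} (η : Form D V k) {n : ℕ} (φ : Euc n → X)
    (hφ : IsPlot φ) : Euc n → Euc n [⋀^Fin k]→L[ℝ] V :=
  η.1 n ⟨φ, hφ⟩

/-- Pull-back of forms along a smooth map. -/
def pullback {DX : DiffeologicalSpace X} {DY : DiffeologicalSpace Y} (f : X → Y) (hf : DSmooth f)
    (k : ℕ) : Form DY V k →ₗ[ℝ] Form DX V k where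
  toFun η := ⟨fun n φ ↦ η.1 n ⟨f ∘ φ.1, hf n φ.1 φ.2⟩,
    fun n φ ↦ η.2.1 n ⟨f ∘ φ.1, hf n φ.1 φ.2⟩,
    fun m n φ h hh x ↦ η.2.2 m n ⟨f ∘ φ.1, hf n φ.1 φ.2⟩ h hh x⟩
  map_add' _ _ := rfl
  map_smul' _ _ := rfl

/-- The exterior differential `d`. -/
def extD {D : DiffeologicalSpace X} (k : ℕ) : Form D V k →ₗ[ℝ] Form D V (k + 1) where
  toFun η := ⟨fun n φ ↦ extDeriv (η.1 n φ),
    fun n φ ↦ by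
      have h := (η.2.1 n φ).fderiv_right (m := ∞) (by simp)
      exact (ContinuousAlternatingMap.alternatizeUncurryFinCLM ℝ (Euc n) V).contDiff.comp h,
    fun m n φ h hh x ↦ by
      have e : η.1 m ⟨φ.1 ∘ h, isPlot_reparam φ.2 hh⟩ = fun x ↦
          (η.1 n φ (h x)).compContinuousLinearMap (fderiv ℝ h x) :=
        funext (η.2.2 m n φ h hh)
      show extDeriv (η.1 m ⟨φ.1 ∘ h, isPlot_reparam φ.2 hh⟩) x = _
      rw [e]
      exact extDeriv_pullback ((η.2.1 n φ).differentiable (by simp) _) hh.contDiffAt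
        (by simp only [minSmoothness_of_isRCLikeNormedField]; exact ENat.LEInfty.out)⟩
  map_add' a b := by
    refine Subtype.ext (funext fun n ↦ funext fun φ ↦ funext fun x ↦ ?_)
    exact extDeriv_add ((a.2.1 n φ).differentiable (by simp) _)
      ((b.2.1 n φ).differentiable (by simp) _)
  map_smul' c a := by
    refine Subtype.ext (funext fun n ↦ funext fun φ ↦ funext fun x ↦ ?_)
    exact extDeriv_smul c _

theorem extD_pullback {DX : DiffeologicalSpace X} {DY : DiffeologicalSpace Y} (f : X → Y)
    (hf : DSmooth f) (k : ℕ) (η : Form DY V k) :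
    extD k (pullback f hf k η) = pullback f hf (k + 1) (extD k η) := rfl

theorem pullback_pullback_congr {Z W : Type*} {DX : DiffeologicalSpace X} {DY : DiffeologicalSpace Y}
    {DZ : DiffeologicalSpace Z} {DW : DiffeologicalSpace W} (f : X → Y) (hf : DSmooth f)
    (g : Y → Z) (hg : DSmooth g) (f' : X → W) (hf' : DSmooth f') (g' : W → Z) (hg' : DSmooth g')
    (h : ∀ x, g (f x) = g' (f' x)) {k : ℕ} (η : Form DZ V k) :
    pullback f hf k (pullback g hg k η) = pullback f' hf' k (pullback g' hg' k η) := by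
  refine Subtype.ext (funext fun n ↦ funext fun φ ↦ ?_)
  exact congrArg (η.1 n) (Subtype.ext (funext fun x ↦ h _))

end Forms

/-! ### Groupoids, nerves and the de Rham double complex -/

/-- A groupoid (small, without smoothness) with arrows `A` and objects `O`.  The product `mul a b`
is defined when the source of `a` is the target of `b`. -/
structure GroupoidOn (A O : Type*) where
  src : A → O
  tgt : A → O
  one : O → A
  inv : A → A
  mul : ∀ a b : A, src a = tgt b → A
  src_one : ∀ x, src (one x) = x
  tgt_one : ∀ x, tgt (one x) = x
  src_inv : ∀ a, src (inv a) = tgt a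
  tgt_inv : ∀ a, tgt (inv a) = src a
  src_mul : ∀ a b h, src (mul a b h) = src b
  tgt_mul : ∀ a b h, tgt (mul a b h) = tgt a
  mul_assoc : ∀ a b c (h₁ : src a = tgt b) (h₂ : src b = tgt c),
    mul (mul a b h₁) c ((src_mul a b h₁).trans h₂) = mul a (mul b c h₂) (h₁.trans (tgt_mul b c h₂).symm)
  one_mul : ∀ a, mul (one (tgt a)) a (src_one (tgt a)) = a
  mul_one : ∀ a, mul a (one (src a)) (tgt_one (src a)).symm = a
  inv_mul : ∀ a, mul (inv a) a (src_inv a) = one (src a)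
  mul_inv : ∀ a, mul a (inv a) (tgt_inv a).symm = one (tgt a)

/-- A groupoid whose arrows and objects form smooth spaces, with smooth source and target. -/
structure DiffGroupoid (A O : Type*) extends GroupoidOn A O where
  dA : DiffeologicalSpace A
  dO : DiffeologicalSpace O
  dSmooth_src : DSmooth src
  dSmooth_tgt : DSmooth tgt

namespace DiffGroupoid

variable {A O : Type*} (𝓖 : DiffGroupoid A O)

/-- The `p`-th stage `Γ_p` of the nerve.  A composable `p`-tuple `(γ₁, …, γ_p)` is recorded together
with all the arrows obtained from it by composition and inversion, that is, as a family of arrows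
`g i j`, `0 ≤ i, j ≤ p`, with `g i j * g j k = g i k`; the tuple is `γ_i = g (i - 1) i`, and `g i i`
is the identity of the `i`-th vertex. -/
def Nerve (p : ℕ) : Type _ :=
  {g : Fin (p + 1) → Fin (p + 1) → A //
    ∃ h : ∀ i j k, 𝓖.src (g i j) = 𝓖.tgt (g j k),
      ∀ i j k, 𝓖.mul (g i j) (g j k) (h i j k) = g i k}

/-- The smooth structure of `Γ_p` as a subspace of a product of copies of the space of arrows. -/
@[reducible]
def nerveDiffeology (p : ℕ) : DiffeologicalSpace (𝓖.Nerve p) :=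
  ⨅ i, ⨅ j, inducedDiffeology (fun g : 𝓖.Nerve p ↦ g.1 i j) 𝓖.dA

theorem nerve_isPlot_iff {p n : ℕ} (φ : Euc n → 𝓖.Nerve p) :
    @IsPlot _ (𝓖.nerveDiffeology p) n φ ↔
      ∀ i j, @IsPlot _ 𝓖.dA n (fun x ↦ (φ x).1 i j) := by
  simp only [DiffeologicalSpace.isPlot_iInf_iff]
  rfl

/-- The `i`-th face map `ε_i : Γ_{p+1} → Γ_p`, which omits the `i`-th vertex: for `i = 0` and
`i = p + 1` it drops the first, respectively the last arrow of the tuple, and otherwise it composes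
the two arrows meeting at the `i`-th vertex. -/
def face {p : ℕ} (i : Fin (p + 2)) (g : 𝓖.Nerve (p + 1)) : 𝓖.Nerve p :=
  ⟨fun a b ↦ g.1 (i.succAbove a) (i.succAbove b),
    fun _ _ _ ↦ g.2.1 _ _ _, fun _ _ _ ↦ g.2.2 _ _ _⟩

theorem dSmooth_face {p : ℕ} (i : Fin (p + 2)) :
    @DSmooth _ _ (𝓖.nerveDiffeology (p + 1)) (𝓖.nerveDiffeology p) (𝓖.face i) :=
  fun _ φ hφ ↦ (𝓖.nerve_isPlot_iff _).2 fun _ _ ↦ (𝓖.nerve_isPlot_iff φ).1 hφ _ _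

/-- The `i`-th vertex `Γ_p → Γ_0`. -/
def vertex {p : ℕ} (i : Fin (p + 1)) (g : 𝓖.Nerve p) : O := 𝓖.src (g.1 i i)

theorem dSmooth_vertex {p : ℕ} (i : Fin (p + 1)) :
    @DSmooth _ _ (𝓖.nerveDiffeology p) 𝓖.dO (𝓖.vertex i) :=
  fun n φ hφ ↦ 𝓖.dSmooth_src n _ ((𝓖.nerve_isPlot_iff φ).1 hφ i i)

/-- Real differential `q`-forms on `Γ_p`. -/
abbrev NerveForm (p q : ℕ) : Type _ := Form (𝓖.nerveDiffeology p) ℝ q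

/-- Families of forms `c p q ∈ Ω^q(Γ_p)`. -/
abbrev DoubleComplex : Type _ := ∀ p q : ℕ, 𝓖.NerveForm p q

/-- The component `(-1)^p d` of the total differential, with values in `Ω^q(Γ_p)`. -/
def vertD (p : ℕ) : ∀ q : ℕ, 𝓖.DoubleComplex →ₗ[ℝ] 𝓖.NerveForm p q
  | 0 => 0
  | q + 1 => ((-1 : ℝ) ^ p) • (extD q ∘ₗ LinearMap.proj q ∘ₗ LinearMap.proj p)

/-- The component `∂` of the total differential, with values in `Ω^q(Γ_p)`: the alternating sum of
the pull-backs along the face maps. -/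
def horD : ∀ p q : ℕ, 𝓖.DoubleComplex →ₗ[ℝ] 𝓖.NerveForm p q
  | 0, _ => 0
  | p + 1, q => ∑ i : Fin (p + 2), ((-1 : ℝ) ^ (i : ℕ)) •
      (pullback (𝓖.face i) (𝓖.dSmooth_face i) q ∘ₗ LinearMap.proj q ∘ₗ LinearMap.proj p)

/-- The total differential `δ = (-1)^p d + ∂`. -/
def totalD : 𝓖.DoubleComplex →ₗ[ℝ] 𝓖.DoubleComplex :=
  LinearMap.pi fun p ↦ LinearMap.pi fun q ↦ 𝓖.vertD p q + 𝓖.horD p q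

/-- Cochains of total degree `m`: the families with `c p q = 0` for `p + q ≠ m`, that is, the
elements of the direct sum of the `Ω^q(Γ_p)` with `p + q = m`. -/
def totalDeg (m : ℕ) : Submodule ℝ 𝓖.DoubleComplex where
  carrier := {c | ∀ p q, p + q ≠ m → c p q = 0}
  zero_mem' := fun _ _ _ ↦ rfl
  add_mem' := fun ha hb p q h ↦ by simp [ha p q h, hb p q h]
  smul_mem' := fun r a ha p q h ↦ by simp [ha p q h]

/-- The closed cochains `Z^m(Γ_•)`. -/
def cocycles (m : ℕ) : Submodule ℝ 𝓖.DoubleComplex := 𝓖.totalDeg m ⊓ LinearMap.ker 𝓖.totalD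

/-- The exact cochains of degree `m`. -/
def coboundaries (m : ℕ) : Submodule ℝ 𝓖.DoubleComplex :=
  match m with
  | 0 => ⊥
  | m + 1 => (𝓖.totalDeg m).map 𝓖.totalD

/-- The de Rham cohomology `H^m_dR(Γ_•)`. -/
abbrev deRham (m : ℕ) : Type _ :=
  𝓖.cocycles m ⧸ (𝓖.coboundaries m).comap (𝓖.cocycles m).subtype

/-- `∂η = β^*η - α^*η` for a form `η` on the space of objects (`β` the source, `α` the target). -/
def boundary (V : Type*) [NormedAddCommGroup V] [NormedSpace ℝ V] (k : ℕ) :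
    Form 𝓖.dO V k →ₗ[ℝ] Form 𝓖.dA V k :=
  pullback 𝓖.src 𝓖.dSmooth_src k - pullback 𝓖.tgt 𝓖.dSmooth_tgt k

/-- The invariant forms `Ω^k(Γ_0)^Γ = {η | ∂η = 0}`. -/
def invForms (k : ℕ) : Submodule ℝ (Form 𝓖.dO ℝ k) := LinearMap.ker (𝓖.boundary ℝ k)

/-- The closed invariant forms `Z^k(Γ_0)^Γ`. -/
def invCocycles (k : ℕ) : Submodule ℝ (Form 𝓖.dO ℝ k) := 𝓖.invForms k ⊓ LinearMap.ker (extD k)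

/-- The differentials of invariant `(k - 1)`-forms. -/
def invCoboundaries (k : ℕ) : Submodule ℝ (Form 𝓖.dO ℝ k) :=
  match k with
  | 0 => ⊥
  | k + 1 => (𝓖.invForms k).map (extD k)

/-- The cohomology `H^k(Γ_0)^Γ` of the complex of invariant forms. -/
abbrev invDeRham (k : ℕ) : Type _ :=
  𝓖.invCocycles k ⧸ (𝓖.invCoboundaries k).comap (𝓖.invCocycles k).subtype

/-- The inclusion `i : Ω^k(Γ_0) → Ω(Γ_•)` as the component `(p, q) = (0, k)`. -/
def incl (k : ℕ) : Form 𝓖.dO ℝ k →ₗ[ℝ] 𝓖.DoubleComplex :=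
  LinearMap.single ℝ (fun p ↦ ∀ q, 𝓖.NerveForm p q) 0 ∘ₗ
    LinearMap.single ℝ (fun q ↦ 𝓖.NerveForm 0 q) k ∘ₗ
      pullback (𝓖.vertex 0) (𝓖.dSmooth_vertex 0) k

theorem incl_mem_totalDeg (k : ℕ) (η : Form 𝓖.dO ℝ k) : 𝓖.incl k η ∈ 𝓖.totalDeg k := by
  intro p q h
  rcases p with _ | p
  · have hq : q ≠ k := by omega
    simp [incl, hq]
  · simp [incl]

/-- On invariant forms the inclusion is a chain map. -/
theorem totalD_incl (k : ℕ) (η : Form 𝓖.dO ℝ k) (hη : η ∈ 𝓖.invForms k) :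
    𝓖.totalD (𝓖.incl k η) = 𝓖.incl (k + 1) (extD k η) := by
  funext p q
  have hT : 𝓖.totalD (𝓖.incl k η) p q = 𝓖.vertD p q (𝓖.incl k η) + 𝓖.horD p q (𝓖.incl k η) := rfl
  rw [hT]
  have h0 : ∀ p' q', 𝓖.incl k η (p' + 1) q' = 0 := fun p' q' ↦ by simp [incl]
  rcases p with _ | _ | p
  · rcases q with _ | q
    · simp [vertD, horD, incl]
    · by_cases h : q = k
      · subst h
        simp [vertD, horD, incl, extD_pullback]
      · simp [vertD, horD, incl, h]
  · have h1 : 𝓖.vertD 1 q (𝓖.incl k η) = 0 := by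
      rcases q with _ | q
      · rfl
      · simp [vertD, h0 0 q]
    have h2 : 𝓖.incl (k + 1) (extD k η) 1 q = 0 := by simp [incl]
    have h3 : 𝓖.horD 1 q (𝓖.incl k η) =
        pullback (𝓖.face 0) (𝓖.dSmooth_face 0) q (𝓖.incl k η 0 q) -
          pullback (𝓖.face 1) (𝓖.dSmooth_face 1) q (𝓖.incl k η 0 q) := by
      simp [horD, Fin.sum_univ_two, sub_eq_add_neg]
    refine Eq.trans ?_ h2.symm
    refine (congrArg₂ (· + ·) h1 h3).trans ((zero_add _).trans ?_)
    by_cases h : q = k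
    · subst h
      have hs : @DSmooth _ _ (𝓖.nerveDiffeology 1) 𝓖.dA (fun g : 𝓖.Nerve 1 ↦ g.1 0 1) :=
        fun n φ hφ ↦ (𝓖.nerve_isPlot_iff φ).1 hφ 0 1
      have hi : 𝓖.incl q η 0 q = pullback (𝓖.vertex 0) (𝓖.dSmooth_vertex 0) q η := by
        simp [incl]
      have e0 : pullback (𝓖.face 0) (𝓖.dSmooth_face 0) q (𝓖.incl q η 0 q) =
          pullback _ hs q (pullback 𝓖.src 𝓖.dSmooth_src q η) := by
        have : ∀ g : 𝓖.Nerve 1, 𝓖.vertex 0 (𝓖.face 0 g) = 𝓖.src (g.1 0 1) := by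
          rintro ⟨g, hg, -⟩
          exact (hg 1 1 1).trans (hg 0 1 1).symm
        rw [hi]
        exact pullback_pullback_congr _ _ _ _ _ _ _ _ this η
      have e1 : pullback (𝓖.face 1) (𝓖.dSmooth_face 1) q (𝓖.incl q η 0 q) =
          pullback _ hs q (pullback 𝓖.tgt 𝓖.dSmooth_tgt q η) := by
        have : ∀ g : 𝓖.Nerve 1, 𝓖.vertex 0 (𝓖.face 1 g) = 𝓖.tgt (g.1 0 1) := by
          rintro ⟨g, hg, -⟩
          exact hg 0 0 1
        rw [hi]
        exact pullback_pullback_congr _ _ _ _ _ _ _ _ this η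
      have hb : pullback 𝓖.src 𝓖.dSmooth_src q η - pullback 𝓖.tgt 𝓖.dSmooth_tgt q η = 0 := hη
      rw [e0, e1, ← map_sub, hb, map_zero]
    · have hi : 𝓖.incl k η 0 q = 0 := by simp [incl, h]
      rw [hi, map_zero, map_zero, sub_zero]
  · have h1 : 𝓖.vertD (p + 2) q (𝓖.incl k η) = 0 := by
      rcases q with _ | q
      · rfl
      · simp [vertD, h0 (p + 1) q]
    have h2 : 𝓖.incl (k + 1) (extD k η) (p + 2) q = 0 := by simp [incl]
    have h3 : 𝓖.horD (p + 2) q (𝓖.incl k η) = 0 := by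
      simp [horD, h0 p q]
    refine Eq.trans ?_ h2.symm
    exact (congrArg₂ (· + ·) h1 h3).trans (add_zero 0)

/-- The inclusion `i : Z^k(Γ_0)^Γ → Z^k(Γ_•)`. -/
def inclZ (k : ℕ) : 𝓖.invCocycles k →ₗ[ℝ] 𝓖.cocycles k :=
  (𝓖.incl k).restrict fun η hη ↦ ⟨𝓖.incl_mem_totalDeg k η, by
    have h : extD k η = 0 := hη.2
    show 𝓖.totalD (𝓖.incl k η) = 0
    rw [𝓖.totalD_incl k η hη.1, h, map_zero]⟩

/-- The map `i : H^k(Γ_0)^Γ → H^k_dR(Γ_•)` induced by the inclusion. -/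
def inclH (k : ℕ) : 𝓖.invDeRham k →ₗ[ℝ] 𝓖.deRham k :=
  Submodule.mapQ _ _ (𝓖.inclZ k) (by
    rintro ⟨η, hη⟩ h
    rcases k with _ | k
    · have h0 : η = 0 := h
      subst h0
      exact (map_zero (𝓖.incl 0) : _)
    · obtain ⟨ξ, hξ, rfl⟩ := h
      exact ⟨𝓖.incl k ξ, 𝓖.incl_mem_totalDeg k ξ, 𝓖.totalD_incl k ξ hξ⟩)

end DiffGroupoid

/-! ### Lie groupoids and principal bundles over them -/

section Bundles

variable (EA : Type*) [NormedAddCommGroup EA] [NormedSpace ℝ EA]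
  (A : Type*) [TopologicalSpace A] [ChartedSpace EA A]
  (EO : Type*) [NormedAddCommGroup EO] [NormedSpace ℝ EO]
  (O : Type*) [TopologicalSpace O] [ChartedSpace EO O]

/-- A Lie groupoid with manifold of arrows `A` and manifold of objects `O`.  Smoothness of the
product on the submanifold of composable pairs is expressed along smooth families of composable
pairs. -/
structure LieGroupoid extends GroupoidOn A O where
  isSubmersion_src : Manifold.IsSubmersion 𝓘(ℝ, EA) 𝓘(ℝ, EO) ∞ src
  isSubmersion_tgt : Manifold.IsSubmersion 𝓘(ℝ, EA) 𝓘(ℝ, EO) ∞ tgt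
  contMDiff_one : ContMDiff 𝓘(ℝ, EO) 𝓘(ℝ, EA) ∞ one
  contMDiff_inv : ContMDiff 𝓘(ℝ, EA) 𝓘(ℝ, EA) ∞ inv
  contMDiff_mul : ∀ (n : ℕ) (a b : Euc n → A), ContMDiff 𝓘(ℝ, Euc n) 𝓘(ℝ, EA) ∞ a →
    ContMDiff 𝓘(ℝ, Euc n) 𝓘(ℝ, EA) ∞ b → ∀ h : ∀ x, src (a x) = tgt (b x),
      ContMDiff 𝓘(ℝ, Euc n) 𝓘(ℝ, EA) ∞ fun x ↦ mul (a x) (b x) (h x)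

variable {EA A EO O}

/-- The underlying smooth spaces of a Lie groupoid. -/
def LieGroupoid.toDiff (𝓖 : LieGroupoid EA A EO O) : DiffGroupoid A O where
  toGroupoidOn := 𝓖.toGroupoidOn
  dA := manifoldDiffeology EA A
  dO := manifoldDiffeology EO O
  dSmooth_src := fun _ _ hp ↦ ContMDiff.comp 𝓖.isSubmersion_src.contMDiff hp
  dSmooth_tgt := fun _ _ hp ↦ ContMDiff.comp 𝓖.isSubmersion_tgt.contMDiff hp

variable (EG : Type*) [NormedAddCommGroup EG] [NormedSpace ℝ EG]
  (G : Type*) [TopologicalSpace G] [ChartedSpace EG G] [Group G]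
  (EP : Type*) [NormedAddCommGroup EP] [NormedSpace ℝ EP]
  (P : Type*) [TopologicalSpace P] [ChartedSpace EP P]

/-- A principal (right) `G`-bundle `P → Γ_0` over a Lie groupoid: a locally trivial principal
`G`-bundle over the manifold of objects with a smooth (left) action of the groupoid on
`P → Γ_0` that commutes with the action of `G`. -/
structure PrincipalBundle (𝓖 : LieGroupoid EA A EO O) where
  /-- the projection -/
  proj : P → O
  /-- the right action of `G` -/
  act : P → G → P
  contMDiff_proj : ContMDiff 𝓘(ℝ, EP) 𝓘(ℝ, EO) ∞ proj
  contMDiff_act : ContMDiff (𝓘(ℝ, EP).prod 𝓘(ℝ, EG)) 𝓘(ℝ, EP) ∞ fun x : P × G ↦ act x.1 x.2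
  act_one : ∀ p, act p 1 = p
  act_act : ∀ p g h, act (act p g) h = act p (g * h)
  proj_act : ∀ p g, proj (act p g) = proj p
  /-- local triviality: around each point of the base there is a smooth equivariant local
  trivialization -/
  locally_trivial : ∀ x : O, ∃ e : Bundle.Trivialization G proj, x ∈ e.baseSet ∧
    ContMDiffOn 𝓘(ℝ, EP) (𝓘(ℝ, EO).prod 𝓘(ℝ, EG)) ∞ e e.source ∧
    ContMDiffOn (𝓘(ℝ, EO).prod 𝓘(ℝ, EG)) 𝓘(ℝ, EP) ∞ e.toOpenPartialHomeomorph.symm e.target ∧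
    ∀ p ∈ e.source, ∀ g, e (act p g) = ((e p).1, (e p).2 * g)
  /-- the action of the groupoid: `γ · p` is defined when the source of `γ` is `proj p` -/
  smul : ∀ (γ : A) (p : P), 𝓖.src γ = proj p → P
  proj_smul : ∀ γ p h, proj (smul γ p h) = 𝓖.tgt γ
  one_smul : ∀ p, smul (𝓖.one (proj p)) p (𝓖.src_one _) = p
  smul_smul : ∀ γ₁ γ₂ p (h₁ : 𝓖.src γ₁ = 𝓖.tgt γ₂) (h₂ : 𝓖.src γ₂ = proj p),
    smul γ₁ (smul γ₂ p h₂) (h₁.trans (proj_smul γ₂ p h₂).symm) =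
      smul (𝓖.mul γ₁ γ₂ h₁) p ((𝓖.src_mul γ₁ γ₂ h₁).trans h₂)
  smul_act : ∀ γ p g (h : 𝓖.src γ = proj p),
    act (smul γ p h) g = smul γ (act p g) (h.trans (proj_act p g).symm)
  /-- smoothness of the action on the submanifold `Γ ×_{Γ_0} P` -/
  contMDiff_smul : ∀ (n : ℕ) (a : Euc n → A) (b : Euc n → P),
    ContMDiff 𝓘(ℝ, Euc n) 𝓘(ℝ, EA) ∞ a → ContMDiff 𝓘(ℝ, Euc n) 𝓘(ℝ, EP) ∞ b →
      ∀ h : ∀ x, 𝓖.src (a x) = proj (b x),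
        ContMDiff 𝓘(ℝ, Euc n) 𝓘(ℝ, EP) ∞ fun x ↦ smul (a x) (b x) (h x)

variable {EG G EP P} {𝓖 : LieGroupoid EA A EO O}

namespace PrincipalBundle

variable (𝓟 : PrincipalBundle EG G EP P 𝓖)

/-- The space `Q = Γ ×_{Γ_0} P` of arrows of the transformation groupoid. -/
def Arrow : Type _ := {q : A × P // 𝓖.src q.1 = 𝓟.proj q.2}

/-- The transformation groupoid `Q ⇉ P`, with source `(γ, p) ↦ p`, target `(γ, p) ↦ γ · p` and
product `(γ₁, γ₂ · p) (γ₂, p) = (γ₁ γ₂, p)`; the smooth structure of `Q` is that of a subspace of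
`Γ × P`. -/
def transformation : DiffGroupoid 𝓟.Arrow P where
  src q := q.1.2
  tgt q := 𝓟.smul q.1.1 q.1.2 q.2
  one p := ⟨(𝓖.one (𝓟.proj p), p), 𝓖.src_one _⟩
  inv q := ⟨(𝓖.inv q.1.1, 𝓟.smul q.1.1 q.1.2 q.2),
    (𝓖.src_inv _).trans (𝓟.proj_smul _ _ _).symm⟩
  mul a b h := ⟨(𝓖.mul a.1.1 b.1.1 (a.2.trans ((congrArg 𝓟.proj h).trans (𝓟.proj_smul _ _ _))),
    b.1.2), (𝓖.src_mul _ _ _).trans b.2⟩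
  src_one _ := rfl
  tgt_one p := 𝓟.one_smul p
  src_inv _ := rfl
  tgt_inv q := by
    have h := 𝓟.smul_smul (𝓖.inv q.1.1) q.1.1 q.1.2 (𝓖.src_inv _) q.2
    refine h.trans ?_
    have h' : ∀ γ (e : γ = 𝓖.one (𝓟.proj q.1.2)) (hγ : 𝓖.src γ = 𝓟.proj q.1.2),
        𝓟.smul γ q.1.2 hγ = q.1.2 := by
      rintro _ rfl _
      exact 𝓟.one_smul _
    exact h' _ ((𝓖.inv_mul _).trans (congrArg 𝓖.one q.2)) _
  src_mul _ _ _ := rfl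
  tgt_mul := by
    rintro ⟨⟨γ₁, p₁⟩, h₁⟩ ⟨⟨γ₂, p₂⟩, h₂⟩ (rfl : p₁ = _)
    exact (𝓟.smul_smul γ₁ γ₂ p₂ _ h₂).symm
  mul_assoc a b c h₁ h₂ := Subtype.ext (Prod.ext (𝓖.mul_assoc _ _ _ _ _) rfl)
  one_mul := by
    rintro ⟨⟨γ, p⟩, h⟩
    refine Subtype.ext (Prod.ext ?_ rfl)
    have h' : ∀ x (e : x = 𝓖.tgt γ) (hx : 𝓖.src (𝓖.one x) = 𝓖.tgt γ),
        𝓖.mul (𝓖.one x) γ hx = γ := by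
      rintro _ rfl _
      exact 𝓖.one_mul γ
    exact h' _ (𝓟.proj_smul γ p h) _
  mul_one := by
    rintro ⟨⟨γ, p⟩, h⟩
    refine Subtype.ext (Prod.ext ?_ rfl)
    have h' : ∀ x (e : x = 𝓖.src γ) (hx : 𝓖.src γ = 𝓖.tgt (𝓖.one x)),
        𝓖.mul γ (𝓖.one x) hx = γ := by
      rintro _ rfl _
      exact 𝓖.mul_one γ
    exact h' _ h.symm _
  inv_mul q := Subtype.ext (Prod.ext ((𝓖.inv_mul _).trans (congrArg 𝓖.one q.2)) rfl)
  mul_inv q := Subtype.ext (Prod.ext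
    ((𝓖.mul_inv _).trans (congrArg 𝓖.one (𝓟.proj_smul _ _ _).symm)) rfl)
  dA := inducedDiffeology (fun q : 𝓟.Arrow ↦ q.1.1) (manifoldDiffeology EA A) ⊓
    inducedDiffeology (fun q : 𝓟.Arrow ↦ q.1.2) (manifoldDiffeology EP P)
  dO := manifoldDiffeology EP P
  dSmooth_src := fun _ _ hp ↦ (DiffeologicalSpace.isPlot_inf_iff.1 hp).2
  dSmooth_tgt := fun n φ hp ↦ 𝓟.contMDiff_smul n (fun x ↦ (φ x).1.1) (fun x ↦ (φ x).1.2)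
    (DiffeologicalSpace.isPlot_inf_iff.1 hp).1 (DiffeologicalSpace.isPlot_inf_iff.1 hp).2
    fun x ↦ (φ x).2

/-- The projection `Q_p → Γ_p` of the nerves, induced by `Q → Γ`, `(γ, p) ↦ γ`. -/
def nerveProj (p : ℕ) (g : 𝓟.transformation.Nerve p) : 𝓖.toDiff.Nerve p :=
  ⟨fun i j ↦ (g.1 i j).1.1,
    fun i j k ↦ (g.1 i j).2.trans ((congrArg 𝓟.proj (g.2.1 i j k)).trans (𝓟.proj_smul _ _ _)),
    fun i j k ↦ congrArg (fun q : 𝓟.Arrow ↦ q.1.1) (g.2.2 i j k)⟩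

theorem dSmooth_nerveProj (p : ℕ) :
    @DSmooth _ _ (𝓟.transformation.nerveDiffeology p) (𝓖.toDiff.nerveDiffeology p)
      (𝓟.nerveProj p) :=
  fun _ φ hφ ↦ (𝓖.toDiff.nerve_isPlot_iff _).2 fun i j ↦
    (DiffeologicalSpace.isPlot_inf_iff.1
      ((𝓟.transformation.nerve_isPlot_iff φ).1 hφ i j)).1

theorem dSmooth_proj :
    @DSmooth _ _ (manifoldDiffeology EP P) (manifoldDiffeology EO O) 𝓟.proj :=
  fun _ _ hp ↦ ContMDiff.comp 𝓟.contMDiff_proj hp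

theorem dSmooth_act (g : G) :
    @DSmooth _ _ (manifoldDiffeology EP P) (manifoldDiffeology EP P) fun p ↦ 𝓟.act p g :=
  fun _ _ hp ↦ 𝓟.contMDiff_act.comp (ContMDiff.prodMk hp contMDiff_const)

theorem isPlot_orbit (p : P) {n : ℕ} {φ : Euc n → G} (hφ : ContMDiff 𝓘(ℝ, Euc n) 𝓘(ℝ, EG) ∞ φ) :
    @IsPlot _ (manifoldDiffeology EP P) n fun y ↦ 𝓟.act p (φ y) :=
  𝓟.contMDiff_act.comp (ContMDiff.prodMk contMDiff_const hφ)

end PrincipalBundle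

end Bundles

/-! ### Lie algebra, invariant polynomials, curvature -/

section LieAlgebra

variable {EG : Type*} [NormedAddCommGroup EG] [NormedSpace ℝ EG]
  (G : Type*) [TopologicalSpace G] [ChartedSpace EG G] [Group G]

/-- The bracket of the Lie algebra `𝔤 = T_1 G` of `G`, whose underlying vector space is the model
space of `G`. -/
def lieBr (X Y : EG) : EG :=
  @Bracket.bracket (GroupLieAlgebra 𝓘(ℝ, EG) G) (GroupLieAlgebra 𝓘(ℝ, EG) G) _ X Y

/-- The adjoint action of `g` on `𝔤`: the derivative at `1` of `x ↦ g x g⁻¹`. -/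
def Ad {G : Type*} [TopologicalSpace G] [ChartedSpace EG G] [Group G] (g : G) : EG →L[ℝ] EG :=
  mfderiv 𝓘(ℝ, EG) 𝓘(ℝ, EG) (fun x : G ↦ g * x * g⁻¹) 1

/-- The degree `k` part of `S(𝔤^*)^G`: the symmetric `k`-linear forms on `𝔤` that are invariant
under the adjoint action. -/
def InvPoly (EG : Type*) [NormedAddCommGroup EG] [NormedSpace ℝ EG]
    (G : Type*) [TopologicalSpace G] [ChartedSpace EG G] [Group G] (k : ℕ) :
    Submodule ℝ (ContinuousMultilinearMap ℝ (fun _ : Fin k ↦ EG) ℝ) where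
  carrier := {f | (∀ (s : Equiv.Perm (Fin k)) (X : Fin k → EG), f (X ∘ s) = f X) ∧
    ∀ (g : G) (X : Fin k → EG), f (fun i ↦ Ad g (X i)) = f X}
  zero_mem' := ⟨fun _ _ ↦ rfl, fun _ _ ↦ rfl⟩
  add_mem' := fun ha hb ↦ ⟨fun s X ↦ by simp [ha.1 s X, hb.1 s X],
    fun g X ↦ by simp [ha.2 g X, hb.2 g X]⟩
  smul_mem' := fun c _ ha ↦ ⟨fun s X ↦ by simp [ha.1 s X], fun g X ↦ by simp [ha.2 g X]⟩

variable {W : Type*} [NormedAddCommGroup W] [NormedSpace ℝ W]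

/-- The curvature `dθ + ½[θ, θ]` of a `𝔤`-valued `1`-form on a vector space, as a function of two
tangent vectors; note that `½[θ, θ](u, v) = [θ u, θ v]`. -/
def curvature (θ : W → W [⋀^Fin 1]→L[ℝ] EG) (w u v : W) : EG :=
  extDeriv θ w ![u, v] + lieBr G (θ w ![u]) (θ w ![v])

/-- The value on `v_0, …, v_{2k-1}` of the `2k`-form `f(Ω)` obtained by substituting a `𝔤`-valued
`2`-form `Ω` into the symmetric `k`-linear form `f`: for `f` the symmetrization of
`ξ_1 ⋯ ξ_k` this is the value of `ξ_1(Ω) ∧ ⋯ ∧ ξ_k(Ω)`. -/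
def evalPoly {k : ℕ} (f : ContinuousMultilinearMap ℝ (fun _ : Fin k ↦ EG) ℝ) (Ω : W → W → EG)
    (v : Fin (2 * k) → W) : ℝ :=
  ((2 : ℝ) ^ k)⁻¹ * ∑ s : Equiv.Perm (Fin (2 * k)), ((Equiv.Perm.sign s : ℤ) : ℝ) *
    f fun i ↦ Ω (v (s ⟨2 * i, by omega⟩)) (v (s ⟨2 * i + 1, by omega⟩))

/-- Barycentric coordinates `(t_0, …, t_p)` in terms of `(t_1, …, t_p)`. -/
def bary {p : ℕ} (t : Fin p → ℝ) : Fin (p + 1) → ℝ := Fin.cons (1 - ∑ i, t i) t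

/-- The standard simplex `Δ_p`, in the coordinates `t_1, …, t_p`. -/
def simplex (p : ℕ) : Set (Fin p → ℝ) := {t | ∀ j, 0 ≤ bary t j}

/-- The form `∑ t_j θ_j` on `Δ_p × W`, for `1`-forms `θ_0, …, θ_p` on `W`. -/
def simplicialForm {p : ℕ} (θ : Fin (p + 1) → W → W [⋀^Fin 1]→L[ℝ] EG) :
    (Fin p → ℝ) × W → ((Fin p → ℝ) × W) [⋀^Fin 1]→L[ℝ] EG :=
  fun w ↦ ∑ j, bary w.1 j •
    (θ j w.2).compContinuousLinearMap (ContinuousLinearMap.snd ℝ (Fin p → ℝ) W)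

/-- The integral over `Δ_p` of the `2k`-form `f(Ω)` on `Δ_p × W`, where `Ω` is the curvature of
`∑ t_j θ_j`.  It is a `q`-form on `W`, `p + q = 2k`, here evaluated at `w` on the vectors `v_j`; the
integral is normalized by `∫ (dt_1 ∧ ⋯ ∧ dt_p ∧ a) = (∫ dt_1 ⋯ dt_p) a`. -/
def simplexIntegral {k p q : ℕ} (f : ContinuousMultilinearMap ℝ (fun _ : Fin k ↦ EG) ℝ)
    (θ : Fin (p + 1) → W → W [⋀^Fin 1]→L[ℝ] EG) (h : p + q = 2 * k) (w : W) (v : Fin q → W) : ℝ :=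
  ∫ t in simplex p, evalPoly f (curvature G (simplicialForm θ) (t, w)) fun i ↦
    Fin.append (fun a : Fin p ↦ ((Pi.single a 1, 0) : (Fin p → ℝ) × W))
      (fun b : Fin q ↦ ((0, v b) : (Fin p → ℝ) × W)) (Fin.cast h.symm i)

end LieAlgebra

/-! ### Connections and the Chern-Weil maps -/

namespace PrincipalBundle

variable {EA : Type*} [NormedAddCommGroup EA] [NormedSpace ℝ EA]
  {A : Type*} [TopologicalSpace A] [ChartedSpace EA A]
  {EO : Type*} [NormedAddCommGroup EO] [NormedSpace ℝ EO]
  {O : Type*} [TopologicalSpace O] [ChartedSpace EO O]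
  {EG : Type*} [NormedAddCommGroup EG] [NormedSpace ℝ EG]
  {G : Type*} [TopologicalSpace G] [ChartedSpace EG G] [Group G]
  {EP : Type*} [NormedAddCommGroup EP] [NormedSpace ℝ EP]
  {P : Type*} [TopologicalSpace P] [ChartedSpace EP P]
  {𝓖 : LieGroupoid EA A EO O} (𝓟 : PrincipalBundle EG G EP P 𝓖)

/-- `𝔤`-valued `1`-forms on `P`. -/
abbrev OneForm : Type _ := Form 𝓟.transformation.dO EG 1

/-- A pseudo-connection: a connection `1`-form `θ` of the `G`-bundle `P → Γ_0`, that is,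
`R_g^*θ = Ad_{g⁻¹} θ`, and `θ` is `X` on the fundamental vector field of `X ∈ 𝔤`, i.e. its pull-back
along each orbit map `g ↦ p · g` is the identity of `T_1 G = 𝔤` at `g = 1`. -/
structure IsPseudoConnection (θ : 𝓟.OneForm) : Prop where
  equivariant : ∀ (g : G) (n : ℕ) (φ : Euc n → P)
    (hφ : ContMDiff 𝓘(ℝ, Euc n) 𝓘(ℝ, EP) ∞ φ) (x : Euc n)
    (v : Fin 1 → Euc n),
    (pullback (fun p ↦ 𝓟.act p g) (𝓟.dSmooth_act g) 1 θ).on φ hφ x v = Ad g⁻¹ (θ.on φ hφ x v)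
  vertical : ∀ (p : P) (n : ℕ) (φ : Euc n → G) (hφ : ContMDiff 𝓘(ℝ, Euc n) 𝓘(ℝ, EG) ∞ φ)
    (x : Euc n), φ x = 1 → ∀ v : Euc n,
    θ.on (fun y ↦ 𝓟.act p (φ y)) (𝓟.isPlot_orbit p hφ) x ![v] =
      (mfderiv 𝓘(ℝ, Euc n) 𝓘(ℝ, EG) φ x v : EG)

/-- A connection: a pseudo-connection with `∂θ = 0`, where `∂θ = β^*θ - α^*θ` is a form on `Q`. -/
structure IsConnection (θ : 𝓟.OneForm) : Prop extends 𝓟.IsPseudoConnection θ where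
  boundary_eq_zero : 𝓟.transformation.boundary EG 1 θ = 0

/-- The curvature `Ω = dθ + ½[θ, θ]` vanishes. -/
def IsFlat (θ : 𝓟.OneForm) : Prop :=
  ∀ (n : ℕ) (φ : Euc n → P)
    (hφ : ContMDiff 𝓘(ℝ, Euc n) 𝓘(ℝ, EP) ∞ φ) (x u v : Euc n), curvature G (θ.on φ hφ) x u v = 0

/-- `z` is the usual Chern-Weil map `f ↦ f(Ω)`, where `f(Ω)` is regarded as a form on `Γ_0`: the
pull-back of `z f` to `P` is `f(Ω)`. -/
def IsUsualChernWeilMap (θ : 𝓟.OneForm) (k : ℕ)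
    (z : InvPoly EG G k →ₗ[ℝ] 𝓖.toDiff.invCocycles (2 * k)) : Prop :=
  ∀ (f : InvPoly EG G k) (n : ℕ) (φ : Euc n → P)
    (hφ : ContMDiff 𝓘(ℝ, Euc n) 𝓘(ℝ, EP) ∞ φ) (x : Euc n)
    (v : Fin (2 * k) → Euc n),
    (pullback 𝓟.proj 𝓟.dSmooth_proj (2 * k) (z f).1).on φ hφ x v =
      evalPoly f.1 (curvature G (θ.on φ hφ) x) v

/-- `z` is the Chern-Weil map `z_θ` on the cochain level of a pseudo-connection `θ`: the pull-back
of `z f` to `Q_p` is the integral over the simplex `Δ_p` of `f(Ω)`, where `Ω` is the curvature of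
the form `∑ t_i p_i^*θ` on `Δ_p × Q_p`, and `p_i : Q_p → P` are the vertex maps. -/
def IsChernWeilMap (θ : 𝓟.OneForm) (k : ℕ)
    (z : InvPoly EG G k →ₗ[ℝ] 𝓖.toDiff.cocycles (2 * k)) : Prop :=
  ∀ (f : InvPoly EG G k) (p q : ℕ) (h : p + q = 2 * k) (n : ℕ)
    (φ : Euc n → 𝓟.transformation.Nerve p)
    (hφ : @IsPlot _ (𝓟.transformation.nerveDiffeology p) n φ) (x : Euc n) (v : Fin q → Euc n),
    (pullback (𝓟.nerveProj p) (𝓟.dSmooth_nerveProj p) q ((z f).1 p q)).on φ hφ x v =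
      simplexIntegral G f.1
        (fun i ↦ (pullback (𝓟.transformation.vertex i) (𝓟.transformation.dSmooth_vertex i) 1 θ).on
          φ hφ) h x v

/-- `w` is the Chern-Weil map `w_P` in cohomology: it is induced by the Chern-Weil map on the
cochain level of some pseudo-connection. -/
def IsChernWeilClassMap (k : ℕ) (w : InvPoly EG G k →ₗ[ℝ] 𝓖.toDiff.deRham (2 * k)) : Prop :=
  ∃ θ : 𝓟.OneForm, 𝓟.IsPseudoConnection θ ∧ ∃ z : InvPoly EG G k →ₗ[ℝ] 𝓖.toDiff.cocycles (2 * k),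
    𝓟.IsChernWeilMap θ k z ∧ w = Submodule.mkQ _ ∘ₗ z

end PrincipalBundle

end GroupoidCW

/-! Write B for the mixed second derivative at the identity of the product of G in the chart at 1.

The comparison itself is short. If ∂θ = 0, the pull-backs of θ along all the vertex maps Q_p → P
coincide, because any vertex is joined to the vertex 0 by an arrow of Q
(`IsConnection.vertexForm_eq`). The barycentric coordinates add up to 1, so ∑ t_j p_j^*θ is just
p_0^*θ, and f of its curvature has no component along Δ_p. Its integral over Δ_p vanishes for p > 0
(`transgress_const_succ`) and is f(Ω) for p = 0 (`transgress_const_zero`). Hence z_θ(f) sits in p =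
0 and equals z(f) there (`isChernWeilMap_inclZ`). If θ is flat, every argument of f vanishes, and f
has at least one when k > 0 (`IsFlat.eq_zero`).

Most of the work shows that z, z_θ' and w_P exist and are unique. It has three ingredients.

Gauge invariance. Two lifts to Q_p of a smooth family in Γ_p differ by a smooth G-valued function g,
and the pulled back pseudo-connections then differ by the gauge transformation θ ↦ Ad(g⁻¹)θ + g⁻¹dg
(`IsPseudoConnection.curry_act`). The curvature changes by Ad(g⁻¹) (`curv_gauge`), so the invariant
expressions f(Ω) and their integrals do not change and descend to Γ_p (`exists_pullback_eq`). The
calculation is done in the chart at 1, where the bracket is B(X, Y) - B(Y, X) (`lieBr_eq`).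

Closedness. Near a given point θ is gauge equivalent to a form that vanishes there. At such a point
the quadratic term of the curvature has zero derivative, the Bianchi identity is the symmetry of
second derivatives, and d f(Ω) = 0 follows (`extDeriv_chernForm_curv`).

Stokes. Fibrewise Stokes on the simplex (`setIntegral_simplex_boundary`), applied to the closed form
f(Ω) on Δ_p × W, is the cocycle identity (`totalD_chernWeilCochain`). Joining two pseudo-connections
by a segment and integrating over Δ_1 as well gives a cochain whose total differential is the
difference of the two cocycles (`totalD_homotopyCochain`), so w_P does not depend on the choice.

Identities between forms on Γ_p are tested on Q_p, where pull-back is injective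
(`pullback_nerveProj_injective`). -/

set_option linter.unusedSectionVars false

namespace GroupoidCW

/-! ### The group law and the Lie bracket in the chart at 1. -/

section LieCoordinates

variable (EG : Type*) [NormedAddCommGroup EG] [NormedSpace ℝ EG]
  (G : Type*) [TopologicalSpace G] [ChartedSpace EG G] [Group G]

/-- The chart of `G` at `1`. -/
abbrev chartOne : G → EG := extChartAt 𝓘(ℝ, EG) (1 : G)

/-- The inverse of the chart of `G` at `1`. -/
abbrev chartOneSymm : EG → G := (extChartAt 𝓘(ℝ, EG) (1 : G)).symm

/-- The product of `G` in the chart at `1`. -/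
def chartMul (p : EG × EG) : EG := chartOne EG G (chartOneSymm EG G p.1 * chartOneSymm EG G p.2)

/-- The second derivative at the identity of the product of `G` in the chart at `1`. -/
def chartMulD2 : EG × EG →L[ℝ] EG × EG →L[ℝ] EG :=
  fderiv ℝ (fderiv ℝ (chartMul EG G)) (chartOne EG G 1, chartOne EG G 1)

/-- The bilinear part of the product of `G` in the chart at `1`. -/
def chartBil : EG →L[ℝ] EG →L[ℝ] EG :=
  (chartMulD2 EG G).bilinearComp (.inl ℝ EG EG) (.inr ℝ EG EG)

/-- The bracket of the Lie algebra as a continuous bilinear map. -/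
def lieBrL : EG →L[ℝ] EG →L[ℝ] EG := chartBil EG G - (chartBil EG G).flip

/-- The derivative of left translations in the chart at `1`. -/
def chartL (x : EG) : EG →L[ℝ] EG :=
  (fderiv ℝ (chartMul EG G) (x, chartOne EG G 1)).comp (.inr ℝ EG EG)

/-- The derivative of right translations in the chart at `1`. -/
def chartR (x : EG) : EG →L[ℝ] EG :=
  (fderiv ℝ (chartMul EG G) (chartOne EG G 1, x)).comp (.inl ℝ EG EG)

variable [LieGroup 𝓘(ℝ, EG) ∞ G]

@[simp] theorem chartOneSymm_chartOne : chartOneSymm EG G (chartOne EG G 1) = 1 := by simp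

theorem chartOne_chartOneSymm_eventuallyEq :
    ∀ᶠ x in 𝓝 (chartOne EG G (1 : G)), chartOne EG G (chartOneSymm EG G x) = x := by
  filter_upwards [extChartAt_target_mem_nhds (I := 𝓘(ℝ, EG)) (1 : G)] with x hx
  exact (extChartAt 𝓘(ℝ, EG) (1 : G)).right_inv hx

theorem contMDiffAt_chartOneSymm :
    ContMDiffAt 𝓘(ℝ, EG) 𝓘(ℝ, EG) ∞ (chartOneSymm EG G) (chartOne EG G (1 : G)) :=
  (contMDiffOn_extChartAt_symm (1 : G)).contMDiffAt (extChartAt_target_mem_nhds (1 : G))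

theorem contMDiffAt_chartOne {g : G} (hg : g ∈ (chartAt EG (1 : G)).source) :
    ContMDiffAt 𝓘(ℝ, EG) 𝓘(ℝ, EG) ∞ (chartOne EG G) g :=
  contMDiffAt_extChartAt' hg

theorem contMDiffAt_chartOne_one :
    ContMDiffAt 𝓘(ℝ, EG) 𝓘(ℝ, EG) ∞ (chartOne EG G) 1 := contMDiffAt_extChartAt

/-- Manifold derivatives at 1 are read in the preferred chart at 1, in which this chart becomes the
identity. The point is a variable `g` with a proof of `g = 1` so that the result applies at points
that are equal to 1 only propositionally. -/
theorem hasMFDerivAt_chartOne {g : G} (hg : g = 1) :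
    HasMFDerivAt 𝓘(ℝ, EG) 𝓘(ℝ, EG) (chartOne EG G) g (ContinuousLinearMap.id ℝ EG) := by
  subst hg
  refine ⟨continuousAt_extChartAt _, ?_⟩
  refine (hasFDerivWithinAt_id _ _).congr_of_eventuallyEq ?_ ?_
  · filter_upwards [nhdsWithin_le_nhds (chartOne_chartOneSymm_eventuallyEq EG G)] with x hx
    exact hx
  · exact congrArg (chartOne EG G) (chartOneSymm_chartOne EG G)

theorem hasMFDerivAt_chartOneSymm :
    HasMFDerivAt 𝓘(ℝ, EG) 𝓘(ℝ, EG) (chartOneSymm EG G) (chartOne EG G 1)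
      (ContinuousLinearMap.id ℝ EG) := by
  have h1 := ((contMDiffAt_chartOneSymm EG G).mdifferentiableAt (by simp)).hasMFDerivAt
  have h2 := (hasMFDerivAt_chartOne EG G (chartOneSymm_chartOne EG G)).comp _ h1
  have h3 : HasMFDerivAt 𝓘(ℝ, EG) 𝓘(ℝ, EG) (chartOne EG G ∘ chartOneSymm EG G) (chartOne EG G 1)
      (ContinuousLinearMap.id ℝ EG) :=
    (hasMFDerivAt_id _).congr_of_eventuallyEq (chartOne_chartOneSymm_eventuallyEq EG G)
  have h4 := hasMFDerivAt_unique h2 h3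
  have h5 : mfderiv 𝓘(ℝ, EG) 𝓘(ℝ, EG) (chartOneSymm EG G) (chartOne EG G 1) =
    ContinuousLinearMap.id ℝ EG := h4
  exact h5 ▸ h1

theorem contDiffAt_chartMul : ContDiffAt ℝ ∞ (chartMul EG G) (chartOne EG G 1, chartOne EG G 1) := by
  rw [← contMDiffAt_iff_contDiffAt]
  have h1 : ContMDiffAt 𝓘(ℝ, EG × EG) 𝓘(ℝ, EG) ∞ (fun p : EG × EG ↦ chartOneSymm EG G p.1)
      (chartOne EG G 1, chartOne EG G 1) :=
    ContMDiffAt.comp (f := Prod.fst) _ (contMDiffAt_chartOneSymm EG G) contDiffAt_fst.contMDiffAt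
  have h2 : ContMDiffAt 𝓘(ℝ, EG × EG) 𝓘(ℝ, EG) ∞ (fun p : EG × EG ↦ chartOneSymm EG G p.2)
      (chartOne EG G 1, chartOne EG G 1) :=
    ContMDiffAt.comp (f := Prod.snd) _ (contMDiffAt_chartOneSymm EG G) contDiffAt_snd.contMDiffAt
  refine ContMDiffAt.comp _ ?_ (h1.mul h2)
  simpa using contMDiffAt_chartOne_one EG G

theorem chartMul_eventually_left :
    ∀ᶠ x in 𝓝 (chartOne EG G (1 : G)), chartMul EG G (x, chartOne EG G 1) = x := by
  filter_upwards [chartOne_chartOneSymm_eventuallyEq EG G] with x hx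
  simpa [chartMul] using hx

theorem chartMul_eventually_right :
    ∀ᶠ x in 𝓝 (chartOne EG G (1 : G)), chartMul EG G (chartOne EG G 1, x) = x := by
  filter_upwards [chartOne_chartOneSymm_eventuallyEq EG G] with x hx
  simpa [chartMul] using hx

theorem differentiableAt_chartMul_left :
    ∀ᶠ x in 𝓝 (chartOne EG G (1 : G)), DifferentiableAt ℝ (chartMul EG G) (x, chartOne EG G 1) := by
  have h := ((contDiffAt_chartMul EG G).of_le (m := 1) (by simp)).eventually (by simp)
  have h2 : Filter.Tendsto (fun x : EG ↦ (x, chartOne EG G (1 : G))) (𝓝 (chartOne EG G 1))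
    (𝓝 (chartOne EG G 1, chartOne EG G 1)) := by
    exact (Continuous.prodMk_left _).tendsto _
  exact (h2.eventually h).mono fun x hx ↦ hx.differentiableAt (by simp)

theorem differentiableAt_chartMul_right :
    ∀ᶠ x in 𝓝 (chartOne EG G (1 : G)), DifferentiableAt ℝ (chartMul EG G) (chartOne EG G 1, x) := by
  have h := ((contDiffAt_chartMul EG G).of_le (m := 1) (by simp)).eventually (by simp)
  have h2 : Filter.Tendsto (fun x : EG ↦ (chartOne EG G (1 : G), x)) (𝓝 (chartOne EG G 1))
    (𝓝 (chartOne EG G 1, chartOne EG G 1)) := by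
    exact (Continuous.prodMk_right _).tendsto _
  exact (h2.eventually h).mono fun x hx ↦ hx.differentiableAt (by simp)

theorem hasFDerivAt_chartL {x : EG} (h : DifferentiableAt ℝ (chartMul EG G) (x, chartOne EG G 1)) :
    HasFDerivAt (fun y ↦ chartMul EG G (x, y)) (chartL EG G x) (chartOne EG G 1) :=
  HasFDerivAt.comp (f := fun y ↦ (x, y)) _ h.hasFDerivAt (hasFDerivAt_prodMk_right x _)

theorem hasFDerivAt_chartR {x : EG} (h : DifferentiableAt ℝ (chartMul EG G) (chartOne EG G 1, x)) :
    HasFDerivAt (fun y ↦ chartMul EG G (y, x)) (chartR EG G x) (chartOne EG G 1) :=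
  HasFDerivAt.comp (f := fun y ↦ (y, x)) _ h.hasFDerivAt (hasFDerivAt_prodMk_left _ x)

theorem chartL_one : chartL EG G (chartOne EG G 1) = ContinuousLinearMap.id ℝ EG :=
  (hasFDerivAt_chartL EG G (differentiableAt_chartMul_left EG G).self_of_nhds).unique
    ((hasFDerivAt_id _).congr_of_eventuallyEq (chartMul_eventually_right EG G))

theorem chartR_one : chartR EG G (chartOne EG G 1) = ContinuousLinearMap.id ℝ EG :=
  (hasFDerivAt_chartR EG G (differentiableAt_chartMul_left EG G).self_of_nhds).unique
    ((hasFDerivAt_id _).congr_of_eventuallyEq (chartMul_eventually_left EG G))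

theorem hasFDerivAt_fderiv_chartMul :
    HasFDerivAt (fderiv ℝ (chartMul EG G)) (chartMulD2 EG G) (chartOne EG G 1, chartOne EG G 1) :=
  (((contDiffAt_chartMul EG G).fderiv_right (m := ∞) (by simp)).differentiableAt
    (by simp)).hasFDerivAt

theorem chartMulD2_symm (u v : EG × EG) : chartMulD2 EG G u v = chartMulD2 EG G v u :=
  ((contDiffAt_chartMul EG G).isSymmSndFDerivAt (by
    simp only [minSmoothness_of_isRCLikeNormedField]; exact ENat.LEInfty.out)).eq u v

/-- The derivative at `1` of the derivative of left translations. -/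
theorem hasFDerivAt_chartL_one :
    HasFDerivAt (chartL EG G) (chartBil EG G) (chartOne EG G (1 : G)) := by
  have h := HasFDerivAt.comp (f := fun y : EG ↦ (y, chartOne EG G (1 : G))) _
    (hasFDerivAt_fderiv_chartMul EG G) (hasFDerivAt_prodMk_left (𝕜 := ℝ) (chartOne EG G (1 : G)) _)
  exact ((ContinuousLinearMap.compL ℝ EG (EG × EG) EG).flip (.inr ℝ EG EG)).hasFDerivAt.comp _ h

/-- The derivative at `1` of the derivative of right translations. -/
theorem hasFDerivAt_chartR_one :
    HasFDerivAt (chartR EG G) (chartBil EG G).flip (chartOne EG G (1 : G)) := by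
  have h := HasFDerivAt.comp (f := fun y : EG ↦ (chartOne EG G (1 : G), y)) _
    (hasFDerivAt_fderiv_chartMul EG G) (hasFDerivAt_prodMk_right (𝕜 := ℝ) (chartOne EG G (1 : G)) _)
  refine (((ContinuousLinearMap.compL ℝ EG (EG × EG) EG).flip
    (.inl ℝ EG EG)).hasFDerivAt.comp _ h).congr_fderiv ?_
  ext X Y
  -- Differentiating the right translations yields the two slots of B in the opposite order; the
  -- symmetry of the second derivative produces the flip.
  exact chartMulD2_symm EG G (0, X) (Y, 0)

/-- Write σ for the inverse chart and m for the product in the chart. Differentiating σ(m(x, y)) =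
σ(x)σ(y) in y at the identity shows that dσ maps the chart vector field to the invariant one. The
relation must hold for x near the identity, not only at it, since the bracket differentiates in x.
-/
theorem mpullback_mulInvariantVectorField_chart (X : EG) :
    ∀ᶠ x in 𝓝 (chartOne EG G (1 : G)),
      (VectorField.mpullbackWithin 𝓘(ℝ, EG) 𝓘(ℝ, EG) (chartOneSymm EG G)
        (mulInvariantVectorField (I := 𝓘(ℝ, EG)) (G := G) X) (Set.range 𝓘(ℝ, EG)) x : EG) =
      chartL EG G x X := by
  have hs : ∀ᶠ x in 𝓝 (chartOne EG G (1 : G)), ∀ᶠ y in 𝓝 (chartOne EG G (1 : G)),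
      chartOneSymm EG G (chartMul EG G (x, y)) = chartOneSymm EG G x * chartOneSymm EG G y := by
    have h1 : ContinuousAt (fun p : EG × EG ↦ chartOneSymm EG G p.1 * chartOneSymm EG G p.2)
        (chartOne EG G 1, chartOne EG G 1) := by
      have hc := (contMDiffAt_chartOneSymm EG G).continuousAt
      have := topologicalGroup_of_lieGroup 𝓘(ℝ, EG) ∞ (G := G)
      exact (ContinuousAt.comp (f := Prod.fst) hc continuousAt_fst).mul
        (ContinuousAt.comp (f := Prod.snd) hc continuousAt_snd)
    have h2 : ∀ᶠ p in 𝓝 (chartOne EG G (1 : G), chartOne EG G (1 : G)),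
        chartOneSymm EG G (chartMul EG G p) = chartOneSymm EG G p.1 * chartOneSymm EG G p.2 := by
      have h3 := h1.eventually (p := fun g ↦ g ∈ (extChartAt 𝓘(ℝ, EG) (1 : G)).source)
        (by simpa using extChartAt_source_mem_nhds (I := 𝓘(ℝ, EG)) (1 : G))
      filter_upwards [h3] with p hp
      exact (extChartAt 𝓘(ℝ, EG) (1 : G)).left_inv hp
    rw [nhds_prod_eq] at h2
    exact h2.curry
  filter_upwards [hs, differentiableAt_chartMul_left EG G,
    extChartAt_target_mem_nhds (I := 𝓘(ℝ, EG)) (1 : G), chartMul_eventually_left EG G] with x hx hd ht hl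
  have hinv := isInvertible_mfderivWithin_extChartAt_symm (I := 𝓘(ℝ, EG)) ht
  refine hinv.inverse_apply_eq.2 ?_
  have hr : Set.range 𝓘(ℝ, EG) = Set.univ := ModelWithCorners.range_eq_univ _
  rw [hr, mfderivWithin_univ] at hinv ⊢
  have h1 : HasMFDerivAt 𝓘(ℝ, EG) 𝓘(ℝ, EG) (chartOneSymm EG G) x
      (mfderiv 𝓘(ℝ, EG) 𝓘(ℝ, EG) (chartOneSymm EG G) x) :=
    ((contMDiffOn_extChartAt_symm (n := ∞) (1 : G)).contMDiffAt
      ((isOpen_extChartAt_target (1 : G)).mem_nhds ht)).mdifferentiableAt (by simp) |>.hasMFDerivAt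
  have h1' : HasMFDerivAt 𝓘(ℝ, EG) 𝓘(ℝ, EG) (chartOneSymm EG G) (chartMul EG G (x, chartOne EG G 1))
      (mfderiv 𝓘(ℝ, EG) 𝓘(ℝ, EG) (chartOneSymm EG G) x : EG →L[ℝ] EG) := by
    have h : ∀ z, z = x → HasMFDerivAt 𝓘(ℝ, EG) 𝓘(ℝ, EG) (chartOneSymm EG G) z
        (mfderiv 𝓘(ℝ, EG) 𝓘(ℝ, EG) (chartOneSymm EG G) x : EG →L[ℝ] EG) := by
      rintro _ rfl; exact h1
    exact h _ hl
  have h2 := HasMFDerivAt.comp (f := fun y ↦ chartMul EG G (x, y)) _ h1'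
    (hasFDerivAt_chartL EG G hd).hasMFDerivAt
  have h3 : HasMFDerivAt 𝓘(ℝ, EG) 𝓘(ℝ, EG) (fun h : G ↦ chartOneSymm EG G x * h)
      (chartOneSymm EG G (chartOne EG G 1))
      (mfderiv 𝓘(ℝ, EG) 𝓘(ℝ, EG) (fun h : G ↦ chartOneSymm EG G x * h) 1 : EG →L[ℝ] EG) := by
    rw [chartOneSymm_chartOne]
    exact (contMDiff_mul_left (n := ∞)).mdifferentiable (by simp) _ |>.hasMFDerivAt
  have h4 := h3.comp _ (hasMFDerivAt_chartOneSymm EG G)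
  have h5 := hasMFDerivAt_unique (h2.congr_of_eventuallyEq (hx.mono fun y hy ↦ hy.symm)) h4
  exact (congrArg (fun A : EG →L[ℝ] EG ↦ A X) h5).symm

/-- The bracket of the Lie algebra in the chart at `1`. -/
theorem lieBr_eq [CompleteSpace EG] (X Y : EG) : lieBr G X Y = lieBrL EG G X Y := by
  let A : EG →L[ℝ] EG := mfderiv 𝓘(ℝ, EG) 𝓘(ℝ, EG) (extChartAt 𝓘(ℝ, EG) (1 : G)) 1
  have h0 : A = ContinuousLinearMap.id ℝ EG := (hasMFDerivAt_chartOne EG G rfl).mfderiv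
  have h1 : ∀ Z : EG, HasFDerivAt (fun x ↦ chartL EG G x Z) ((chartBil EG G).flip Z)
      (chartOne EG G 1) := fun Z ↦
    (ContinuousLinearMap.apply ℝ EG Z).hasFDerivAt.comp _ (hasFDerivAt_chartL_one EG G)
  let F : EG → EG → EG := fun Z ↦ VectorField.mpullbackWithin 𝓘(ℝ, EG) 𝓘(ℝ, EG)
    (chartOneSymm EG G) (mulInvariantVectorField (I := 𝓘(ℝ, EG)) (G := G) Z) (Set.range 𝓘(ℝ, EG))
  -- In the chart the invariant field of Z has value Z and derivative X ↦ B(X, Z) at the identity.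
  -- The bracket of vector fields DF_Y(X) - DF_X(Y) is then B(X, Y) - B(Y, X).
  have h2 : ∀ Z : EG, HasFDerivAt (F Z) ((chartBil EG G).flip Z) (chartOne EG G 1) := fun Z ↦
    (h1 Z).congr_of_eventuallyEq (mpullback_mulInvariantVectorField_chart EG G Z)
  have h3 : ∀ Z : EG, F Z (chartOne EG G 1) = Z := fun Z ↦ by
    refine (mpullback_mulInvariantVectorField_chart EG G Z).self_of_nhds.trans ?_
    rw [chartL_one]; rfl
  have h4 : lieBr G X Y = A.inverse (VectorField.lieBracketWithin ℝ (F X) (F Y)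
        ((chartOneSymm EG G) ⁻¹' Set.univ ∩ Set.range 𝓘(ℝ, EG)) (chartOne EG G 1)) := rfl
  have hr : (chartOneSymm EG G) ⁻¹' Set.univ ∩ Set.range 𝓘(ℝ, EG) = Set.univ := by simp
  rw [h4, h0, hr, VectorField.lieBracketWithin_univ, ContinuousLinearMap.inverse_id,
    VectorField.lieBracket_eq]
  simp only [(h2 X).fderiv, (h2 Y).fderiv, h3]
  rfl

end LieCoordinates

/-! ### The adjoint action. -/

section Adjoint

variable {EG : Type*} [NormedAddCommGroup EG] [NormedSpace ℝ EG]
  {G : Type*} [TopologicalSpace G] [ChartedSpace EG G] [Group G] [LieGroup 𝓘(ℝ, EG) ∞ G]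

theorem hasMFDerivAt_conj (g : G) :
    HasMFDerivAt 𝓘(ℝ, EG) 𝓘(ℝ, EG) (fun x : G ↦ g * x * g⁻¹) 1 (Ad g : EG →L[ℝ] EG) := by
  have h : ContMDiff 𝓘(ℝ, EG) 𝓘(ℝ, EG) ∞ (fun x : G ↦ g * x * g⁻¹) :=
    (contMDiff_mul_right (a := g⁻¹)).comp (contMDiff_mul_left (a := g))
  exact (h.mdifferentiableAt (by simp)).hasMFDerivAt

theorem hasMFDerivAt_conj' (g : G) {x : G} (hx : x = 1) :
    HasMFDerivAt 𝓘(ℝ, EG) 𝓘(ℝ, EG) (fun x : G ↦ g * x * g⁻¹) x (Ad g : EG →L[ℝ] EG) := by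
  subst hx; exact hasMFDerivAt_conj g

theorem Ad_mul (a b : G) : (Ad (a * b) : EG →L[ℝ] EG) = (Ad a).comp (Ad b) := by
  have h := HasMFDerivAt.comp (f := fun x : G ↦ b * x * b⁻¹) 1
    (hasMFDerivAt_conj' (EG := EG) a (x := b * 1 * b⁻¹) (by simp)) (hasMFDerivAt_conj (EG := EG) b)
  refine hasMFDerivAt_unique (hasMFDerivAt_conj (a * b)) (h.congr_of_eventuallyEq ?_)
  exact Filter.Eventually.of_forall fun x ↦ by simp [mul_assoc]

/-- The adjoint action preserves the bracket. -/
theorem Ad_lieBrL (g : G) (X Y : EG) :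
    Ad g (lieBrL EG G X Y) = lieBrL EG G (Ad g X) (Ad g Y) := by
  let e : EG := chartOne EG G 1
  let C : EG → EG := fun x ↦ chartOne EG G (g * chartOneSymm EG G x * g⁻¹)
  have hconj : ContMDiff 𝓘(ℝ, EG) 𝓘(ℝ, EG) ∞ (fun x : G ↦ g * x * g⁻¹) :=
    (contMDiff_mul_right (a := g⁻¹)).comp (contMDiff_mul_left (a := g))
  have hCe : C e = e := by simp [C, e]
  have hC : ContDiffAt ℝ ∞ C e := by
    rw [← contMDiffAt_iff_contDiffAt]
    refine ContMDiffAt.comp (f := fun x ↦ g * chartOneSymm EG G x * g⁻¹) _ ?_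
      (hconj.contMDiffAt.comp _ (contMDiffAt_chartOneSymm EG G))
    refine contMDiffAt_chartOne EG G ?_
    simp [e]
  have hCd : HasFDerivAt C (Ad g : EG →L[ℝ] EG) e := by
    have h1 := (hasMFDerivAt_conj' (EG := EG) g (chartOneSymm_chartOne EG G)).comp e
      (hasMFDerivAt_chartOneSymm EG G)
    have h2 := HasMFDerivAt.comp (f := fun x ↦ g * chartOneSymm EG G x * g⁻¹) e
      (hasMFDerivAt_chartOne EG G (by simp [e])) h1
    exact h2.hasFDerivAt
  have hmul : ∀ᶠ p in 𝓝 (e, e), C (chartMul EG G p) = chartMul EG G (C p.1, C p.2) := by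
    have hs := extChartAt_source_mem_nhds (I := 𝓘(ℝ, EG)) (1 : G)
    have hcs := (contMDiffAt_chartOneSymm EG G).continuousAt
    have hcs' : Filter.Tendsto (chartOneSymm EG G) (𝓝 e) (𝓝 1) := by
      simpa [ContinuousAt, e] using hcs
    have hcj : Filter.Tendsto (fun x : G ↦ g * x * g⁻¹) (𝓝 1) (𝓝 1) := by
      simpa using hconj.continuous.tendsto 1
    have hmulc : Filter.Tendsto (fun p : G × G ↦ p.1 * p.2) (𝓝 (1, 1)) (𝓝 1) := by
      have := topologicalGroup_of_lieGroup 𝓘(ℝ, EG) ∞ (G := G)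
      simpa using (continuous_mul (M := G)).tendsto (1, 1)
    have h1 : Filter.Tendsto (fun p : EG × EG ↦ chartOneSymm EG G p.1) (𝓝 (e, e)) (𝓝 1) :=
      hcs'.comp (continuous_fst.tendsto (e, e))
    have h2 : Filter.Tendsto (fun p : EG × EG ↦ chartOneSymm EG G p.2) (𝓝 (e, e)) (𝓝 1) :=
      hcs'.comp (continuous_snd.tendsto (e, e))
    filter_upwards [(hmulc.comp (h1.prodMk_nhds h2)).eventually hs,
      (hcj.comp h1).eventually hs, (hcj.comp h2).eventually hs] with p hp1 hp2 hp3
    have e1 : chartOneSymm EG G (chartMul EG G p) = chartOneSymm EG G p.1 * chartOneSymm EG G p.2 :=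
      (extChartAt 𝓘(ℝ, EG) (1 : G)).left_inv hp1
    have e2 : chartOneSymm EG G (C p.1) = g * chartOneSymm EG G p.1 * g⁻¹ :=
      (extChartAt 𝓘(ℝ, EG) (1 : G)).left_inv hp2
    have e3 : chartOneSymm EG G (C p.2) = g * chartOneSymm EG G p.2 * g⁻¹ :=
      (extChartAt 𝓘(ℝ, EG) (1 : G)).left_inv hp3
    show chartOne EG G (g * chartOneSymm EG G (chartMul EG G p) * g⁻¹) =
      chartOne EG G (chartOneSymm EG G (C p.1) * chartOneSymm EG G (C p.2))
    rw [e1, e2, e3]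
    congr 1
    group
  have hCdiff : ∀ᶠ x in 𝓝 e, DifferentiableAt ℝ C x :=
    ((hC.of_le (m := 1) (by simp)).eventually (by simp)).mono
      fun x hx ↦ hx.differentiableAt (by simp)
  have hCt : Filter.Tendsto C (𝓝 e) (𝓝 e) := by
    simpa [ContinuousAt, hCe] using hC.continuousAt
  -- The derivative in y at the identity of C(m(x, y)) = m(C x, C y), where C is conjugation in the
  -- chart.
  have key : ∀ᶠ x in 𝓝 e, (fderiv ℝ C x).comp (chartL EG G x) =
      (chartL EG G (C x)).comp (Ad g : EG →L[ℝ] EG) := by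
    rw [nhds_prod_eq] at hmul
    filter_upwards [hmul.curry, hCdiff, differentiableAt_chartMul_left EG G,
      hCt.eventually (differentiableAt_chartMul_left EG G), chartMul_eventually_left EG G]
      with x hx hd hm hm' hl
    have hd' : HasFDerivAt C (fderiv ℝ C x) (chartMul EG G (x, e)) := by
      rw [hl]; exact hd.hasFDerivAt
    have h1 := HasFDerivAt.comp (f := fun y ↦ chartMul EG G (x, y)) e hd'
      (hasFDerivAt_chartL EG G hm)
    have hl' : HasFDerivAt (fun y ↦ chartMul EG G (C x, y)) (chartL EG G (C x)) (C e) := by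
      rw [hCe]; exact hasFDerivAt_chartL EG G hm'
    have h2 := HasFDerivAt.comp (f := C) e hl' hCd
    exact (h1.congr_of_eventuallyEq (hx.mono fun y hy ↦ hy.symm)).unique h2
  have hC2 : HasFDerivAt (fderiv ℝ C) (fderiv ℝ (fderiv ℝ C) e) e :=
    ((hC.fderiv_right (m := ∞) (by simp)).differentiableAt (by simp)).hasFDerivAt
  have hsymm : ∀ u v, fderiv ℝ (fderiv ℝ C) e u v = fderiv ℝ (fderiv ℝ C) e v u :=
    (hC.isSymmSndFDerivAt (by
      simp only [minSmoothness_of_isRCLikeNormedField]; exact ENat.LEInfty.out)).eq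
  have hL' : HasFDerivAt (chartL EG G) (chartBil EG G) (C e) := by
    rw [hCe]; exact hasFDerivAt_chartL_one EG G
  have d1 := hC2.clm_comp (hasFDerivAt_chartL_one EG G)
  have d2 := (hL'.comp e hCd).clm_comp (hasFDerivAt_const (Ad g : EG →L[ℝ] EG) e)
  -- Differentiating once more, in x, gives D²C(X, Y) + Ad B(X, Y) = B(Ad X, Ad Y). The term D²C is
  -- symmetric and disappears on antisymmetrizing.
  have d3 := d1.unique (d2.congr_of_eventuallyEq key)
  have d4 : ∀ X Y, fderiv ℝ (fderiv ℝ C) e X Y + Ad g (chartBil EG G X Y) =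
      chartBil EG G (Ad g X) (Ad g Y) := by
    intro X Y
    have := congrArg (fun A : EG →L[ℝ] EG →L[ℝ] EG ↦ A X Y) d3
    simpa [hCd.fderiv, e, chartL_one, add_comm] using this
  simp only [lieBrL, sub_apply, ContinuousLinearMap.flip_apply, map_sub,
    ← d4, hsymm X Y]
  abel

end Adjoint

/-! ### Gauge transformations and the curvature. -/

section Gauge

variable {EG : Type*} [NormedAddCommGroup EG] [NormedSpace ℝ EG]
  {G : Type*} [TopologicalSpace G] [ChartedSpace EG G] [Group G]
  {W : Type*} [NormedAddCommGroup W] [NormedSpace ℝ W]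

variable (G) in
/-- The curvature of a `𝔤`-valued `1`-form on a vector space, as a bilinear map. -/
def curv (θ : W → W →L[ℝ] EG) (w : W) : W →L[ℝ] W →L[ℝ] EG :=
  fderiv ℝ θ w - (fderiv ℝ θ w).flip + (lieBrL EG G).bilinearComp (θ w) (θ w)

/-- The pull-back `g⁻¹ dg` of the Maurer-Cartan form. -/
def mcForm (g : W → G) (w : W) : W →L[ℝ] EG :=
  mfderiv 𝓘(ℝ, W) 𝓘(ℝ, EG) (fun y ↦ (g w)⁻¹ * g y) w

theorem mcForm_const_mul (a : G) (g : W → G) (w : W) :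
    (mcForm (fun y ↦ a * g y) w : W →L[ℝ] EG) = mcForm g w := by
  have h : ∀ f₁ f₂ : W → G, f₁ = f₂ → (mfderiv 𝓘(ℝ, W) 𝓘(ℝ, EG) f₁ w : W →L[ℝ] EG) =
      mfderiv 𝓘(ℝ, W) 𝓘(ℝ, EG) f₂ w := by rintro f _ rfl; rfl
  exact h _ _ (funext fun y ↦ by group)

/-- The gauge transform `Ad(g⁻¹) θ + g⁻¹ dg`. -/
def gauge (θ : W → W →L[ℝ] EG) (g : W → G) (w : W) : W →L[ℝ] EG :=
  (Ad (g w)⁻¹ : EG →L[ℝ] EG).comp (θ w) + mcForm g w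

theorem curv_apply (θ : W → W →L[ℝ] EG) (w u v : W) :
    curv G θ w u v = fderiv ℝ θ w u v - fderiv ℝ θ w v u + lieBrL EG G (θ w u) (θ w v) := rfl

variable [LieGroup 𝓘(ℝ, EG) ∞ G]

/-- The gauge transform in the chart at `1`. -/
theorem chartL_comp_gauge {θ : W → W →L[ℝ] EG} {g : W → G} {w : W}
    (hg : MDifferentiableAt 𝓘(ℝ, W) 𝓘(ℝ, EG) g w) (hs : g w ∈ (chartAt EG (1 : G)).source)
    (hl : DifferentiableAt ℝ (chartMul EG G) (chartOne EG G (g w), chartOne EG G 1))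
    (hr : DifferentiableAt ℝ (chartMul EG G) (chartOne EG G 1, chartOne EG G (g w))) :
    (chartL EG G (chartOne EG G (g w))).comp (gauge θ g w) =
      (chartR EG G (chartOne EG G (g w))).comp (θ w) + fderiv ℝ (chartOne EG G ∘ g) w := by
  have hinv : chartOneSymm EG G (chartOne EG G (g w)) = g w :=
    (extChartAt 𝓘(ℝ, EG) (1 : G)).left_inv (by simpa using hs)
  have hcc : ∀ᶠ h in 𝓝 (1 : G), chartOneSymm EG G (chartOne EG G h) = h := by
    filter_upwards [extChartAt_source_mem_nhds (I := 𝓘(ℝ, EG)) (1 : G)] with h hh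
    exact (extChartAt 𝓘(ℝ, EG) (1 : G)).left_inv hh
  have hL : ∀ h : G, h = 1 → HasMFDerivAt 𝓘(ℝ, EG) 𝓘(ℝ, EG) (fun h : G ↦ chartOne EG G (g w * h)) h
      (chartL EG G (chartOne EG G (g w))) := by
    rintro _ rfl
    refine (HasMFDerivAt.comp (f := chartOne EG G) 1 (hasFDerivAt_chartL EG G hl).hasMFDerivAt
      (hasMFDerivAt_chartOne EG G rfl)).congr_of_eventuallyEq (hcc.mono fun h hh ↦ ?_)
    simp only [chartMul, Function.comp, hinv, hh]
  have hR : HasMFDerivAt 𝓘(ℝ, EG) 𝓘(ℝ, EG) (fun h : G ↦ chartOne EG G (h * g w)) 1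
      (chartR EG G (chartOne EG G (g w))) := by
    refine (HasMFDerivAt.comp (f := chartOne EG G) 1 (hasFDerivAt_chartR EG G hr).hasMFDerivAt
      (hasMFDerivAt_chartOne EG G rfl)).congr_of_eventuallyEq (hcc.mono fun h hh ↦ ?_)
    simp only [chartMul, Function.comp, hinv, hh]
  -- With a = g(w): a(a⁻¹ha) = ha, so left translation after conjugation is right translation.
  -- Likewise a(a⁻¹g(y)) = g(y) gives `h2`.
  have h1 : (chartL EG G (chartOne EG G (g w))).comp (Ad (g w)⁻¹) =
      chartR EG G (chartOne EG G (g w)) := by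
    refine hasMFDerivAt_unique ((hL ((g w)⁻¹ * 1 * (g w)⁻¹⁻¹) (by simp)).comp 1
      (hasMFDerivAt_conj (EG := EG) (g w)⁻¹)) (hR.congr_of_eventuallyEq ?_)
    exact Filter.Eventually.of_forall fun h ↦ by simp [mul_assoc]
  have h2 : (chartL EG G (chartOne EG G (g w))).comp
      (mcForm g w) = fderiv ℝ (chartOne EG G ∘ g) w := by
    have hg' : MDifferentiableAt 𝓘(ℝ, W) 𝓘(ℝ, EG) (fun y ↦ (g w)⁻¹ * g y) w :=
      ((contMDiff_mul_left (n := ∞) (a := (g w)⁻¹)).mdifferentiable (by simp) _).comp w hg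
    have hγ : MDifferentiableAt 𝓘(ℝ, W) 𝓘(ℝ, EG) (chartOne EG G ∘ g) w :=
      ((contMDiffAt_chartOne EG G hs).mdifferentiableAt (by simp)).comp w hg
    refine hasMFDerivAt_unique (HasMFDerivAt.comp (f := fun y ↦ (g w)⁻¹ * g y) w
      (hL ((g w)⁻¹ * g w) (by simp)) hg'.hasMFDerivAt)
      (hγ.differentiableAt.hasFDerivAt.hasMFDerivAt.congr_of_eventuallyEq ?_)
    exact Filter.Eventually.of_forall fun h ↦ by simp
  rw [gauge, ContinuousLinearMap.comp_add, ← ContinuousLinearMap.comp_assoc, h1, h2]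

/-- In the chart, with γ the coordinates of g, the gauge relation reads L(γ)τ = R(γ)θ + dγ. At w
both L and R are the identity, and their derivatives are B and its flip. Differentiating there and
antisymmetrizing kills D²γ, and the terms in B cancel against those of [τ, τ] with τ = θ + dγ. -/
theorem curv_gauge_of_eq_one {θ τ : W → W →L[ℝ] EG} {g : W → G} {w : W}
    (hθ : DifferentiableAt ℝ θ w) (hτ : DifferentiableAt ℝ τ w)
    (hg : ContMDiffAt 𝓘(ℝ, W) 𝓘(ℝ, EG) 2 g w) (h : ∀ᶠ y in 𝓝 w, τ y = gauge θ g y)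
    (h1 : g w = 1) : curv G τ w = curv G θ w := by
  let γ : W → EG := chartOne EG G ∘ g
  have hγw : γ w = chartOne EG G 1 := congrArg _ h1
  have hγ : ContDiffAt ℝ 2 γ w := by
    rw [← contMDiffAt_iff_contDiffAt]
    refine ContMDiffAt.comp w ?_ hg
    rw [h1]; exact (contMDiffAt_chartOne_one EG G).of_le (by exact ENat.LEInfty.out)
  have hγt : Filter.Tendsto γ (𝓝 w) (𝓝 (chartOne EG G 1)) := hγw ▸ hγ.continuousAt
  have hgt : Filter.Tendsto g (𝓝 w) (𝓝 1) := h1 ▸ hg.continuousAt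
  have key : ∀ᶠ y in 𝓝 w, (chartL EG G (γ y)).comp (τ y) =
      (chartR EG G (γ y)).comp (θ y) + fderiv ℝ γ y := by
    filter_upwards [h, (contMDiffAt_iff_contMDiffAt_nhds (by simp)).1 hg, hgt.eventually (chart_source_mem_nhds EG (1 : G)),
      hγt.eventually (differentiableAt_chartMul_left EG G),
      hγt.eventually (differentiableAt_chartMul_right EG G)] with y h1 h2 h3 h4 h5
    rw [h1]
    exact chartL_comp_gauge (h2.mdifferentiableAt (by simp)) h3 h4 h5
  have hγd : HasFDerivAt γ (fderiv ℝ γ w) w := (hγ.differentiableAt (by simp)).hasFDerivAt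
  have hγ2 : HasFDerivAt (fderiv ℝ γ) (fderiv ℝ (fderiv ℝ γ) w) w :=
    ((hγ.fderiv_right (m := 1) (by norm_num)).differentiableAt (by simp)).hasFDerivAt
  have hsymm : ∀ u v, fderiv ℝ (fderiv ℝ γ) w u v = fderiv ℝ (fderiv ℝ γ) w v u :=
    (hγ.isSymmSndFDerivAt (by simp)).eq
  have hL' : HasFDerivAt (chartL EG G) (chartBil EG G) (γ w) := by
    rw [hγw]; exact hasFDerivAt_chartL_one EG G
  have hR' : HasFDerivAt (chartR EG G) (chartBil EG G).flip (γ w) := by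
    rw [hγw]; exact hasFDerivAt_chartR_one EG G
  have d1 := (hL'.comp w hγd).clm_comp hτ.hasFDerivAt
  have d2 := ((hR'.comp w hγd).clm_comp hθ.hasFDerivAt).add hγ2
  have d3 := d1.unique (d2.congr_of_eventuallyEq key)
  have d0 : τ w = θ w + fderiv ℝ γ w := by
    have := key.self_of_nhds
    simpa only [hγw, chartL_one, chartR_one, ContinuousLinearMap.id_comp] using this
  have d4 : ∀ u v, fderiv ℝ τ w u v = chartBil EG G (θ w v) (fderiv ℝ γ w u) + fderiv ℝ θ w u v +
      fderiv ℝ (fderiv ℝ γ) w u v - chartBil EG G (fderiv ℝ γ w u) (τ w v) := by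
    intro u v
    have := congrArg (fun A : W →L[ℝ] W →L[ℝ] EG ↦ A u v) d3
    rw [eq_sub_iff_add_eq]
    simpa [hγw, chartL_one, chartR_one, add_comm, add_assoc, add_left_comm] using this
  ext u v
  simp only [curv_apply, d4, d0, lieBrL, add_apply,
    sub_apply, ContinuousLinearMap.flip_apply, map_add, hsymm u v]
  abel

theorem curv_Ad_comp {θ : W → W →L[ℝ] EG} {w : W} (hθ : DifferentiableAt ℝ θ w) (a : G) (u v : W) :
    curv G (fun y ↦ (Ad a : EG →L[ℝ] EG).comp (θ y)) w u v = Ad a (curv G θ w u v) := by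
  have h := ((ContinuousLinearMap.compL ℝ W EG EG) (Ad a)).hasFDerivAt.comp w hθ.hasFDerivAt
  have h' : fderiv ℝ (fun y ↦ (Ad a : EG →L[ℝ] EG).comp (θ y)) w = _ := h.fderiv
  simp [curv_apply, h', Ad_lieBrL]

/-- The curvature of a gauge transform. -/
theorem curv_gauge {θ τ : W → W →L[ℝ] EG} {g : W → G} {w : W}
    (hθ : DifferentiableAt ℝ θ w) (hτ : DifferentiableAt ℝ τ w)
    (hg : ContMDiffAt 𝓘(ℝ, W) 𝓘(ℝ, EG) 2 g w) (h : ∀ᶠ y in 𝓝 w, τ y = gauge θ g y) (u v : W) :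
    curv G τ w u v = Ad (g w)⁻¹ (curv G θ w u v) := by
  rw [← curv_Ad_comp hθ]
  have h0 : DifferentiableAt ℝ (fun y ↦ (Ad (g w)⁻¹ : EG →L[ℝ] EG).comp (θ y)) w :=
    (((ContinuousLinearMap.compL ℝ W EG EG) (Ad (g w)⁻¹)).hasFDerivAt.comp w
      hθ.hasFDerivAt).differentiableAt
  -- Factor g as the constant g(w) times a function equal to 1 at w. The constant acts through Ad,
  -- which preserves the bracket; the other factor leaves the curvature at w unchanged.
  rw [curv_gauge_of_eq_one (g := fun y ↦ (g w)⁻¹ * g y) h0 hτ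
    (((contMDiff_mul_left (a := (g w)⁻¹)).of_le (by exact ENat.LEInfty.out)).contMDiffAt.comp w hg)
    ?_ (by simp)]
  filter_upwards [h] with y hy
  rw [hy, gauge, gauge, ← ContinuousLinearMap.comp_assoc, ← Ad_mul, mcForm_const_mul]
  simp

end Gauge

/-! ### Alternating forms on finite-dimensional spaces. -/

section AlternatingForms

variable {W : Type*} [NormedAddCommGroup W] [NormedSpace ℝ W] [FiniteDimensional ℝ W] {m : ℕ}

theorem multilinearMap_continuous (f : MultilinearMap ℝ (fun _ : Fin m ↦ W) ℝ) : Continuous f := by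
  let b := Module.finBasis ℝ W
  have h : ∀ v, f v = ∑ r : Fin m → Fin (Module.finrank ℝ W),
      (∏ i, b.coord (r i) (v i)) • f (fun i ↦ b (r i)) := by
    intro v
    conv_lhs => rw [show v = fun i ↦ ∑ j, b.coord j (v i) • b j from
      funext fun i ↦ (b.sum_repr (v i)).symm]
    rw [MultilinearMap.map_sum]
    exact Finset.sum_congr rfl fun r _ ↦ f.map_smul_univ _ _
  have h' : ⇑f = fun v ↦ ∑ r : Fin m → Fin (Module.finrank ℝ W),
      (∏ i, b.coord (r i) (v i)) • f (fun i ↦ b (r i)) := funext h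
  rw [h']
  refine continuous_finsetSum _ fun r _ ↦ Continuous.fun_smul
    (continuous_finsetProd _ fun i _ ↦ ?_) continuous_const
  exact (LinearMap.continuous_of_finiteDimensional (b.coord (r i))).comp (continuous_apply i)

/-- An alternating form on a finite-dimensional space is continuous. -/
def altForm (f : W [⋀^Fin m]→ₗ[ℝ] ℝ) : W [⋀^Fin m]→L[ℝ] ℝ :=
  { f with cont := multilinearMap_continuous f.toMultilinearMap }

@[simp] theorem altForm_apply (f : W [⋀^Fin m]→ₗ[ℝ] ℝ) (v : Fin m → W) : altForm f v = f v := rfl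

/-- A family of alternating forms on a finite-dimensional space is smooth if its values are. -/
theorem contDiff_alternating {E : Type*} [NormedAddCommGroup E] [NormedSpace ℝ E] {n : WithTop ℕ∞}
    {F : E → W [⋀^Fin m]→L[ℝ] ℝ} (h : ∀ v, ContDiff ℝ n fun x ↦ F x v) : ContDiff ℝ n F := by
  let b := Module.finBasis ℝ W
  -- An alternating form is determined by its values on tuples of basis vectors. A linear left
  -- inverse of this embedding is continuous, and it recovers `F` from finitely many smooth
  -- functions.
  let L : (W [⋀^Fin m]→L[ℝ] ℝ) →ₗ[ℝ] (Fin m → Fin (Module.finrank ℝ W)) → ℝ :=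
    { toFun := fun f r ↦ f (fun i ↦ b (r i))
      map_add' := fun _ _ ↦ rfl
      map_smul' := fun _ _ ↦ rfl }
  have hL : LinearMap.ker L = ⊥ := by
    rw [LinearMap.ker_eq_bot]
    intro f g hfg
    have : f.toAlternatingMap = g.toAlternatingMap :=
      Module.Basis.ext_alternating b fun r _ ↦ congrFun hfg r
    ext v
    exact congrArg (fun F : W [⋀^Fin m]→ₗ[ℝ] ℝ ↦ F v) this
  obtain ⟨R, hR⟩ := LinearMap.exists_leftInverse_of_injective L hL
  have e : F = fun x ↦ LinearMap.toContinuousLinearMap R (L (F x)) :=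
    funext fun x ↦ (congrArg (fun A : _ →ₗ[ℝ] _ ↦ A (F x)) hR).symm
  rw [e]
  exact (LinearMap.toContinuousLinearMap R).contDiff.comp (contDiff_pi.2 fun r ↦ h _)

end AlternatingForms

/-! ### The form f(Ω) and its exterior derivative. -/

section ChernForms

variable {EG : Type*} [NormedAddCommGroup EG] [NormedSpace ℝ EG]
  {W : Type*} [NormedAddCommGroup W] [NormedSpace ℝ W] {k : ℕ}

/-- The values of `Ω` on the pairs `(v_0, v_1), (v_2, v_3), …`. -/
def pairs (Ω : W → W → EG) (v : Fin (2 * k) → W) (i : Fin k) : EG :=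
  Ω (v ⟨2 * i, by omega⟩) (v ⟨2 * i + 1, by omega⟩)

/-- Each vector occurs in exactly one pair, so changing it changes one argument of f only. With the
odd case this gives the multilinearity of `polyMultilinear`. -/
theorem pairs_update_even (Ω : W → W → EG) (v : Fin (2 * k) → W) (i : Fin k) (x : W) :
    pairs Ω (Function.update v ⟨2 * i, by omega⟩ x) =
      Function.update (pairs Ω v) i (Ω x (v ⟨2 * i + 1, by omega⟩)) := by
  funext j
  by_cases h : j = i
  · subst h
    simp [pairs]
  · have h' : (j : ℕ) ≠ i := fun e ↦ h (Fin.ext e)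
    rw [Function.update_of_ne h]
    simp only [pairs]
    rw [Function.update_of_ne, Function.update_of_ne] <;> simp only [ne_eq, Fin.mk.injEq] <;> omega

theorem pairs_update_odd (Ω : W → W → EG) (v : Fin (2 * k) → W) (i : Fin k) (x : W) :
    pairs Ω (Function.update v ⟨2 * i + 1, by omega⟩ x) =
      Function.update (pairs Ω v) i (Ω (v ⟨2 * i, by omega⟩) x) := by
  funext j
  by_cases h : j = i
  · subst h
    simp [pairs]
  · have h' : (j : ℕ) ≠ i := fun e ↦ h (Fin.ext e)
    rw [Function.update_of_ne h]
    simp only [pairs]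
    rw [Function.update_of_ne, Function.update_of_ne] <;> simp only [ne_eq, Fin.mk.injEq] <;> omega

theorem exists_eq_two_mul (j : Fin (2 * k)) :
    ∃ i : Fin k, j = ⟨2 * i, by omega⟩ ∨ j = ⟨2 * i + 1, by omega⟩ := by
  refine ⟨⟨j / 2, by omega⟩, ?_⟩
  rcases Nat.mod_two_eq_zero_or_one j with h | h
  · left; ext; simp only; omega
  · right; ext; simp only; omega

/-- The multilinear form `v ↦ f(Ω(v_0, v_1), …, Ω(v_{2k-2}, v_{2k-1}))`. -/
def polyMultilinear (f : ContinuousMultilinearMap ℝ (fun _ : Fin k ↦ EG) ℝ)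
    (Ω : W →L[ℝ] W →L[ℝ] EG) : MultilinearMap ℝ (fun _ : Fin (2 * k) ↦ W) ℝ :=
  MultilinearMap.mk' (fun v ↦ f (pairs (fun x y ↦ Ω x y) v))
    (fun v j x y ↦ by
      obtain ⟨i, rfl | rfl⟩ := exists_eq_two_mul j
      · simp only [pairs_update_even, map_add, add_apply, f.map_update_add]
      · simp only [pairs_update_odd, map_add, f.map_update_add])
    (fun v j c x ↦ by
      obtain ⟨i, rfl | rfl⟩ := exists_eq_two_mul j
      · simp only [pairs_update_even, map_smul, smul_apply, f.map_update_smul]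
      · simp only [pairs_update_odd, map_smul, f.map_update_smul])

variable [FiniteDimensional ℝ W]

/-- The form `f(Ω)`. -/
def chernForm (f : ContinuousMultilinearMap ℝ (fun _ : Fin k ↦ EG) ℝ)
    (Ω : W →L[ℝ] W →L[ℝ] EG) : W [⋀^Fin (2 * k)]→L[ℝ] ℝ :=
  altForm (((2 : ℝ) ^ k)⁻¹ • MultilinearMap.alternatization (polyMultilinear f Ω))

theorem chernForm_apply (f : ContinuousMultilinearMap ℝ (fun _ : Fin k ↦ EG) ℝ)
    (Ω : W →L[ℝ] W →L[ℝ] EG) (v : Fin (2 * k) → W) :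
    chernForm f Ω v = evalPoly f (fun x y ↦ Ω x y) v := by
  simp only [chernForm, altForm_apply, AlternatingMap.smul_apply, smul_eq_mul,
    MultilinearMap.alternatization_apply, evalPoly]
  congr 1
  refine Finset.sum_congr rfl fun s _ ↦ ?_
  rw [Units.smul_def, zsmul_eq_mul]
  rfl

theorem contDiff_chernForm {E : Type*} [NormedAddCommGroup E] [NormedSpace ℝ E]
    {n : WithTop ℕ∞} (f : ContinuousMultilinearMap ℝ (fun _ : Fin k ↦ EG) ℝ)
    {Ω : E → W →L[ℝ] W →L[ℝ] EG} (hΩ : ContDiff ℝ n Ω) :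
    ContDiff ℝ n fun x ↦ chernForm f (Ω x) := by
  refine contDiff_alternating fun v ↦ ?_
  simp only [chernForm_apply, evalPoly]
  refine contDiff_const.mul (ContDiff.sum fun s _ ↦ contDiff_const.mul ?_)
  refine f.contDiff.comp (contDiff_pi.2 fun i ↦ ?_)
  exact (hΩ.clm_apply contDiff_const).clm_apply contDiff_const

/-- The derivative of `f(Ω)`. -/
theorem hasFDerivAt_evalPoly {E : Type*} [NormedAddCommGroup E] [NormedSpace ℝ E]
    (f : ContinuousMultilinearMap ℝ (fun _ : Fin k ↦ EG) ℝ)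
    {Ω : E → W →L[ℝ] W →L[ℝ] EG} {Ω' : E →L[ℝ] W →L[ℝ] W →L[ℝ] EG} {x : E}
    (hΩ : HasFDerivAt Ω Ω' x) (v : Fin (2 * k) → W) (u : E) :
    fderiv ℝ (fun y ↦ chernForm f (Ω y) v) x u = ((2 : ℝ) ^ k)⁻¹ *
      ∑ s : Equiv.Perm (Fin (2 * k)), ((Equiv.Perm.sign s : ℤ) : ℝ) * ∑ i : Fin k,
        f (Function.update (pairs (fun a b ↦ Ω x a b) (v ∘ s)) i
          (pairs (fun a b ↦ Ω' u a b) (v ∘ s) i)) := by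
  have h1 : ∀ s : Equiv.Perm (Fin (2 * k)), HasFDerivAt (fun y ↦ pairs (fun a b ↦ Ω y a b) (v ∘ s))
      (ContinuousLinearMap.pi fun i : Fin k ↦
        (ContinuousLinearMap.apply ℝ EG (v (s ⟨2 * i + 1, by omega⟩))).comp
          ((ContinuousLinearMap.apply ℝ (W →L[ℝ] EG) (v (s ⟨2 * i, by omega⟩))).comp Ω')) x :=
    fun s ↦ hasFDerivAt_pi.2 fun i ↦ ((hΩ.clm_apply (hasFDerivAt_const _ _)).clm_apply
      (hasFDerivAt_const _ _)).congr_fderiv (by ext; simp)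
  have h2 := fun s : Equiv.Perm (Fin (2 * k)) ↦ ((f.hasFDerivAt (x := pairs (fun a b ↦ Ω x a b) (v ∘ s))).comp x
    (h1 s)).const_mul ((Equiv.Perm.sign s : ℤ) : ℝ)
  have h3 := (HasFDerivAt.fun_sum (u := Finset.univ) fun s _ ↦ h2 s).const_mul (((2 : ℝ) ^ k)⁻¹)
  have h4 : (fun y ↦ chernForm f (Ω y) v) = fun y ↦ ((2 : ℝ) ^ k)⁻¹ *
      ∑ s : Equiv.Perm (Fin (2 * k)), ((Equiv.Perm.sign s : ℤ) : ℝ) *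
        (f ∘ fun y ↦ pairs (fun a b ↦ Ω y a b) (v ∘ s)) y := funext fun y ↦ chernForm_apply f (Ω y) v
  rw [h4, h3.fderiv]
  simp only [smul_apply, sum_apply, smul_eq_mul, ContinuousLinearMap.comp_apply,
    ContinuousMultilinearMap.linearDeriv_apply]
  rfl

/-- Permutations of `n + 1` elements from the image of `0` and a permutation of `n` elements. -/
theorem sum_perm_succ {n : ℕ} {M : Type*} (v : Fin (n + 1) → M) (Ψ : M → (Fin n → M) → ℝ) :
    ∑ j : Fin (n + 1), (-1 : ℝ) ^ (j : ℕ) * ∑ s : Equiv.Perm (Fin n),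
        ((Equiv.Perm.sign s : ℤ) : ℝ) * Ψ (v j) (j.removeNth v ∘ s) =
      ∑ σ : Equiv.Perm (Fin (n + 1)), ((Equiv.Perm.sign σ : ℤ) : ℝ) *
        Ψ (v (σ 0)) (fun i ↦ v (σ i.succ)) := by
  -- The permutation s acts on the successors and fixes 0; the inverse cycle then sends 0 to j and
  -- `i.succ` to `j.succAbove i`. The cycle has sign (-1)^j.
  let φ : Fin (n + 1) × Equiv.Perm (Fin n) → Equiv.Perm (Fin (n + 1)) := fun p ↦
    (p.1.cycleRange).symm * Equiv.Perm.decomposeFin.symm (0, p.2)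
  have h0 : ∀ p, φ p 0 = p.1 := fun p ↦ by simp [φ]
  have hs : ∀ p i, φ p (Fin.succ i) = p.1.succAbove (p.2 i) := fun p i ↦ by simp [φ]
  have hφ : Function.Bijective φ := by
    rw [Fintype.bijective_iff_injective_and_card]
    constructor
    · rintro ⟨j, s⟩ ⟨j', s'⟩ h
      have hj : j = j' := (h0 (j, s)).symm.trans ((congrArg (fun σ ↦ σ 0) h).trans (h0 (j', s')))
      subst hj
      refine Prod.ext rfl (Equiv.ext fun i ↦ ?_)
      have := congrArg (fun σ : Equiv.Perm (Fin (n + 1)) ↦ σ i.succ) h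
      simp only [hs] at this
      exact Fin.succAbove_right_injective this
    · simp [Fintype.card_perm, Nat.factorial_succ]
  have hsign : ∀ p, ((Equiv.Perm.sign (φ p) : ℤ) : ℝ) =
      (-1 : ℝ) ^ (p.1 : ℕ) * ((Equiv.Perm.sign p.2 : ℤ) : ℝ) := fun p ↦ by
    simp [φ, Equiv.Perm.decomposeFin.symm_sign, Fin.sign_cycleRange, Equiv.Perm.sign_symm]
  rw [← hφ.sum_comp, Fintype.sum_prod_type]
  refine Finset.sum_congr rfl fun j _ ↦ ?_
  rw [Finset.mul_sum]
  refine Finset.sum_congr rfl fun s _ ↦ ?_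
  rw [hsign, h0, mul_assoc]
  simp only [hs]
  rfl

/-- If the exterior derivative of `Ω` vanishes at a point, then so does that of `f(Ω)`. -/
theorem extDeriv_chernForm_eq_zero (f : ContinuousMultilinearMap ℝ (fun _ : Fin k ↦ EG) ℝ)
    {Ω : W → W →L[ℝ] W →L[ℝ] EG} {Ω' : W →L[ℝ] W →L[ℝ] W →L[ℝ] EG} {x : W}
    (hΩ : HasFDerivAt Ω Ω' x) (hcyc : ∀ a b c, Ω' a b c + Ω' b c a + Ω' c a b = 0) :
    extDeriv (fun y ↦ chernForm f (Ω y)) x = 0 := by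
  have hd : DifferentiableAt ℝ (fun y ↦ chernForm f (Ω y)) x :=
    ((contDiff_chernForm f (contDiff_id (n := 1))).differentiable (by simp) _).comp x
      hΩ.differentiableAt
  ext v
  rw [extDeriv_apply hd]
  have hz : ∀ (n : ℕ) (r : ℝ), (-1 : ℤ) ^ n • r = (-1 : ℝ) ^ n * r := fun n r ↦ by
    rw [zsmul_eq_mul]; push_cast; rfl
  simp only [hz, hasFDerivAt_evalPoly f hΩ, mul_left_comm ((-1 : ℝ) ^ _) (((2 : ℝ) ^ k)⁻¹)]
  rw [← Finset.mul_sum, sum_perm_succ v fun u w ↦ ∑ i : Fin k,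
        f (Function.update (pairs (fun a b ↦ Ω x a b) w) i (pairs (fun a b ↦ Ω' u a b) w i))]
  simp only [Finset.mul_sum (Finset.univ : Finset (Fin k))]
  rw [Finset.sum_comm, Finset.sum_eq_zero, mul_zero]
  · rfl
  intro i _
  -- The three vectors entering the differentiated factor sit at the positions 0, a, b. The 3-cycle
  -- `c` on these positions is even and leaves the other pairs alone, so the sum of `A` over the
  -- permutations σ equals that over σc and over σc². The three summands add up to the cyclic sum of
  -- `Ω'`, which is zero.
  let a : Fin (2 * k + 1) := Fin.succ ⟨2 * i, by omega⟩
  let b : Fin (2 * k + 1) := Fin.succ ⟨2 * i + 1, by omega⟩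
  have ha0 : (0 : Fin (2 * k + 1)) ≠ a := (Fin.succ_ne_zero _).symm
  have hb0 : (0 : Fin (2 * k + 1)) ≠ b := (Fin.succ_ne_zero _).symm
  have hab : a ≠ b := by simp [a, b]
  let c : Equiv.Perm (Fin (2 * k + 1)) := Equiv.swap 0 a * Equiv.swap a b
  have hc0 : c 0 = a := by simp [c, Equiv.swap_apply_of_ne_of_ne ha0 hb0]
  have hca : c a = b := by simp [c, Equiv.swap_apply_of_ne_of_ne hb0.symm hab.symm]
  have hcb : c b = 0 := by simp [c]
  have hc : ∀ l, l ≠ 0 → l ≠ a → l ≠ b → c l = l := fun l h1 h2 h3 ↦ by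
    simp [c, Equiv.swap_apply_of_ne_of_ne h2 h3, Equiv.swap_apply_of_ne_of_ne h1 h2]
  have hcs : Equiv.Perm.sign c = 1 := by
    simp [c, Equiv.Perm.sign_swap ha0, Equiv.Perm.sign_swap hab]
  let A : Equiv.Perm (Fin (2 * k + 1)) → ℝ := fun σ ↦ ((Equiv.Perm.sign σ : ℤ) : ℝ) *
    f (Function.update (pairs (fun a b ↦ Ω x a b) fun i ↦ v (σ i.succ)) i
      (Ω' (v (σ 0)) (v (σ a)) (v (σ b))))
  show ∑ σ, A σ = 0
  have e1 : ∑ σ, A (σ * c) = ∑ σ, A σ := Equiv.sum_comp (Equiv.mulRight c) A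
  have e2 : ∑ σ, A (σ * c * c) = ∑ σ, A σ := (Equiv.sum_comp (Equiv.mulRight c) _).trans e1
  have hP : ∀ (σ : Equiv.Perm (Fin (2 * k + 1))) (y : EG),
      Function.update (pairs (fun a b ↦ Ω x a b) fun i ↦ v ((σ * c) i.succ)) i y =
      Function.update (pairs (fun a b ↦ Ω x a b) fun i ↦ v (σ i.succ)) i y := by
    intro σ y
    funext j
    by_cases h : j = i
    · subst h; simp
    · have h' : (j : ℕ) ≠ i := fun e ↦ h (Fin.ext e)
      rw [Function.update_of_ne h, Function.update_of_ne h]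
      simp only [pairs, Equiv.Perm.mul_apply]
      rw [hc, hc] <;> simp only [a, b, ne_eq, Fin.succ_ne_zero, not_false_eq_true, Fin.succ_inj,
        Fin.mk.injEq] <;> omega
  have key : ∀ σ, A σ + A (σ * c) + A (σ * c * c) = 0 := by
    intro σ
    simp only [A, Equiv.Perm.sign_mul, hcs, mul_one, hP]
    simp only [Equiv.Perm.mul_apply, hc0, hca, hcb]
    rw [← mul_add, ← mul_add, ← f.map_update_add, ← f.map_update_add, hcyc, f.map_coord_zero i (by simp),
      mul_zero]
  have e3 : ∑ σ, (A σ + A (σ * c) + A (σ * c * c)) = 0 := Finset.sum_eq_zero fun σ _ ↦ key σ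
  rw [Finset.sum_add_distrib, Finset.sum_add_distrib, e1, e2] at e3
  linarith

end ChernForms

/-! ### Closedness of f(Ω). -/

section Closed

variable {EG : Type*} [NormedAddCommGroup EG] [NormedSpace ℝ EG]
  {G : Type*} [TopologicalSpace G] [ChartedSpace EG G] [Group G]
  {W : Type*} [NormedAddCommGroup W] [NormedSpace ℝ W] {k : ℕ}

theorem contDiff_flip (A B C : Type*) [NormedAddCommGroup A] [NormedSpace ℝ A]
    [NormedAddCommGroup B] [NormedSpace ℝ B] [NormedAddCommGroup C] [NormedSpace ℝ C] :
    ContDiff ℝ ∞ (fun F : A →L[ℝ] B →L[ℝ] C ↦ F.flip) :=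
  IsBoundedLinearMap.contDiff ⟨⟨fun _ _ ↦ rfl, fun _ _ ↦ rfl⟩, 1, one_pos, fun F ↦ by
    rw [one_mul]; exact F.opNorm_flip.le⟩

theorem contDiffAt_curv {θ : W → W →L[ℝ] EG} {w : W} (hθ : ContDiffAt ℝ ∞ θ w) :
    ContDiffAt ℝ ∞ (curv G θ) w := by
  have hd : ContDiffAt ℝ ∞ (fderiv ℝ θ) w := hθ.fderiv_right (by simp)
  refine (hd.sub ?_).add ?_
  · exact (contDiff_flip W W EG).contDiffAt.comp w hd
  · have h1 : ContDiffAt ℝ ∞ (fun y ↦ (lieBrL EG G).comp (θ y)) w := contDiffAt_const.clm_comp hθ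
    have h2 : ContDiffAt ℝ ∞ (fun y ↦ ((lieBrL EG G).comp (θ y)).flip) w :=
      (contDiff_flip W EG EG).contDiffAt.comp w h1
    have h3 : ContDiffAt ℝ ∞ (fun y ↦ (((lieBrL EG G).comp (θ y)).flip).comp (θ y)) w :=
      h2.clm_comp hθ
    exact (contDiff_flip W W EG).contDiffAt.comp w h3

theorem contDiff_curv {θ : W → W →L[ℝ] EG} (hθ : ContDiff ℝ ∞ θ) : ContDiff ℝ ∞ (curv G θ) :=
  contDiff_iff_contDiffAt.2 fun _ ↦ contDiffAt_curv hθ.contDiffAt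

/-- The only place where the invariance of f enters; combined with `curv_gauge` it makes f(Ω) gauge
invariant. -/
theorem evalPoly_Ad (f : InvPoly EG G k) (g : G) {Ω Ω' : W → W → EG}
    (h : ∀ u v, Ω u v = Ad g (Ω' u v)) (v : Fin (2 * k) → W) :
    evalPoly f.1 Ω v = evalPoly f.1 Ω' v := by
  simp only [evalPoly, h]
  congr 1
  refine Finset.sum_congr rfl fun s _ ↦ ?_
  congr 1
  exact f.2.2 g _

variable [FiniteDimensional ℝ W]

/-- At a zero of τ the derivative of [τ, τ] vanishes, so only the derivative of dτ is left. Its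
cyclic sum is zero by the symmetry of second derivatives. -/
theorem extDeriv_chernForm_curv_of_eq_zero (f : ContinuousMultilinearMap ℝ (fun _ : Fin k ↦ EG) ℝ)
    {τ : W → W →L[ℝ] EG} {w : W} (hτ : ContDiffAt ℝ ∞ τ w) (h0 : τ w = 0) :
    extDeriv (fun y ↦ chernForm f (curv G τ y)) w = 0 := by
  have hΩ := ((contDiffAt_curv (G := G) hτ).differentiableAt (by simp)).hasFDerivAt
  have h1 : HasFDerivAt τ (fderiv ℝ τ w) w := (hτ.differentiableAt (by simp)).hasFDerivAt
  have h2 : HasFDerivAt (fderiv ℝ τ) (fderiv ℝ (fderiv ℝ τ) w) w :=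
    ((hτ.fderiv_right (m := ∞) (by simp)).differentiableAt (by simp)).hasFDerivAt
  have hsymm : ∀ u v, fderiv ℝ (fderiv ℝ τ) w u v = fderiv ℝ (fderiv ℝ τ) w v u :=
    (hτ.isSymmSndFDerivAt (by
      simp only [minSmoothness_of_isRCLikeNormedField]; exact ENat.LEInfty.out)).eq
  have key : ∀ a b c, fderiv ℝ (curv G τ) w a b c =
      fderiv ℝ (fderiv ℝ τ) w a b c - fderiv ℝ (fderiv ℝ τ) w a c b := by
    intro a b c
    have e1 := (hΩ.clm_apply (hasFDerivAt_const b w)).clm_apply (hasFDerivAt_const c w)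
    have e2 := (h2.clm_apply (hasFDerivAt_const b w)).clm_apply (hasFDerivAt_const c w)
    have e3 := (h2.clm_apply (hasFDerivAt_const c w)).clm_apply (hasFDerivAt_const b w)
    have e4 := ((hasFDerivAt_const (lieBrL EG G) w).clm_apply
      (h1.clm_apply (hasFDerivAt_const b w))).clm_apply (h1.clm_apply (hasFDerivAt_const c w))
    have e5 := e1.unique ((e2.sub e3).add e4)
    have e6 := congrArg (fun A : W →L[ℝ] EG ↦ A a) e5
    simpa [h0] using e6
  refine extDeriv_chernForm_eq_zero f hΩ fun a b c ↦ ?_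
  rw [key, key, key, hsymm b a, hsymm c a, hsymm c b]
  abel

variable [LieGroup 𝓘(ℝ, EG) ∞ G] [CompleteSpace EG]

theorem contDiffAt_chartL : ContDiffAt ℝ ∞ (chartL EG G) (chartOne EG G 1) := by
  have h : ContDiffAt ℝ ∞ (fderiv ℝ (chartMul EG G)) (chartOne EG G 1, chartOne EG G 1) :=
    (contDiffAt_chartMul EG G).fderiv_right (by simp)
  exact ((h.comp (chartOne EG G 1) (f := fun x ↦ (x, chartOne EG G 1))
    (contDiffAt_id.prodMk contDiffAt_const))).clm_comp contDiffAt_const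

theorem contDiffAt_chartR : ContDiffAt ℝ ∞ (chartR EG G) (chartOne EG G 1) := by
  have h : ContDiffAt ℝ ∞ (fderiv ℝ (chartMul EG G)) (chartOne EG G 1, chartOne EG G 1) :=
    (contDiffAt_chartMul EG G).fderiv_right (by simp)
  exact ((h.comp (chartOne EG G 1) (f := fun x ↦ (chartOne EG G 1, x))
    (contDiffAt_const.prodMk contDiffAt_id))).clm_comp contDiffAt_const

/-- Every `𝔤`-valued `1`-form is gauge equivalent, near a given point, to one that vanishes at that
point. -/
theorem exists_gauge_eq_zero {θ : W → W →L[ℝ] EG} (hθ : ContDiff ℝ ∞ θ) (w : W) :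
    ∃ (g : W → G) (τ : W → W →L[ℝ] EG), ContMDiffAt 𝓘(ℝ, W) 𝓘(ℝ, EG) ∞ g w ∧
      ContDiffAt ℝ ∞ τ w ∧ τ w = 0 ∧ ∀ᶠ y in 𝓝 w, τ y = gauge θ g y := by
  -- The affine function with value the identity and derivative -θ(w) at w makes R(γ)θ + dγ vanish
  -- at w. Then τ = L(γ)⁻¹(R(γ)θ + dγ), which is smooth near w because L is the identity there.
  let γ : W → EG := fun y ↦ chartOne EG G 1 - θ w (y - w)
  have hγw : γ w = chartOne EG G 1 := by simp [γ]
  have hγ : ContDiff ℝ ∞ γ :=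
    contDiff_const.sub ((θ w).contDiff.comp (contDiff_id.sub contDiff_const))
  have hγd : fderiv ℝ γ w = - θ w := by
    have : HasFDerivAt γ (0 - (θ w).comp (ContinuousLinearMap.id ℝ W)) w :=
      (hasFDerivAt_const _ w).sub ((θ w).hasFDerivAt.comp w ((hasFDerivAt_id w).sub_const w))
    rw [this.fderiv]; simp
  have hγt : Filter.Tendsto γ (𝓝 w) (𝓝 (chartOne EG G 1)) := hγw ▸ hγ.continuous.tendsto w
  have hg : ContMDiffAt 𝓘(ℝ, W) 𝓘(ℝ, EG) ∞ (chartOneSymm EG G ∘ γ) w := by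
    refine ContMDiffAt.comp w ?_ hγ.contMDiff.contMDiffAt
    rw [hγw]; exact contMDiffAt_chartOneSymm EG G
  have hgw : (chartOneSymm EG G ∘ γ) w = 1 := by simp [hγw]
  have hgt : Filter.Tendsto (chartOneSymm EG G ∘ γ) (𝓝 w) (𝓝 1) := hgw ▸ hg.continuousAt
  have hLw : chartL EG G (γ w) = (ContinuousLinearEquiv.refl ℝ EG : EG →L[ℝ] EG) := by
    rw [hγw, chartL_one]; rfl
  have hLc : ContDiffAt ℝ ∞ (fun y ↦ chartL EG G (γ y)) w := by
    refine ContDiffAt.comp (g := chartL EG G) w ?_ hγ.contDiffAt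
    rw [hγw]; exact contDiffAt_chartL
  have hRc : ContDiffAt ℝ ∞ (fun y ↦ chartR EG G (γ y)) w := by
    refine ContDiffAt.comp (g := chartR EG G) w ?_ hγ.contDiffAt
    rw [hγw]; exact contDiffAt_chartR
  have hLi : ContDiffAt ℝ ∞ (fun y ↦ (chartL EG G (γ y)).inverse) w := by
    refine ContDiffAt.comp (g := ContinuousLinearMap.inverse) w ?_ hLc
    rw [hLw]; exact contDiffAt_map_inverse _
  refine ⟨chartOneSymm EG G ∘ γ, fun y ↦ (chartL EG G (γ y)).inverse.comp
    ((chartR EG G (γ y)).comp (θ y) + fderiv ℝ γ y), hg, ?_, ?_, ?_⟩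
  · exact hLi.clm_comp ((hRc.clm_comp hθ.contDiffAt).add
      (hγ.contDiffAt.fderiv_right (by simp)))
  · simp only [hγw, chartR_one, hγd]; simp
  · have hinv : ∀ᶠ y in 𝓝 w, (chartL EG G (γ y)).IsInvertible := by
      have := hLc.continuousAt.eventually (p := fun A ↦ A ∈ Set.range ((↑) : (EG ≃L[ℝ] EG) → _))
        (by
          show _ ∈ 𝓝 (chartL EG G (γ w))
          rw [hLw]; exact ContinuousLinearEquiv.nhds _)
      exact this
    filter_upwards [hinv, (contMDiffAt_iff_contMDiffAt_nhds (n := 1) (by simp)).1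
        (hg.of_le (by simp)),
      hgt.eventually (chart_source_mem_nhds EG (1 : G)),
      hγt.eventually (differentiableAt_chartMul_left EG G),
      hγt.eventually (differentiableAt_chartMul_right EG G),
      hγt.eventually (chartOne_chartOneSymm_eventuallyEq EG G),
      (hγt.eventually (chartOne_chartOneSymm_eventuallyEq EG G).eventually_nhds)]
      with y h1 h2 h3 h4 h5 h6 h7
    have e : chartOne EG G ((chartOneSymm EG G ∘ γ) y) = γ y := h6
    have e' : fderiv ℝ (chartOne EG G ∘ chartOneSymm EG G ∘ γ) y = fderiv ℝ γ y :=
      Filter.EventuallyEq.fderiv_eq (hγ.continuous.continuousAt.eventually h7)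
    have := chartL_comp_gauge (θ := θ) (h2.mdifferentiableAt (by simp)) h3 (by rwa [e]) (by rwa [e])
    rw [e, e'] at this
    rw [← this]
    obtain ⟨A, hA⟩ := h1
    rw [← hA, ContinuousLinearMap.inverse_equiv]
    ext v
    simp

/-- The forms `f(Ω)` are closed. -/
theorem extDeriv_chernForm_curv {θ : W → W →L[ℝ] EG} (hθ : ContDiff ℝ ∞ θ) (f : InvPoly EG G k)
    (w : W) : extDeriv (fun y ↦ chernForm f.1 (curv G θ y)) w = 0 := by
  -- Near w the forms f(Ω) of θ and of its gauge transform τ agree, so the derivative at w may be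
  -- computed with τ, which vanishes there.
  obtain ⟨g, τ, hg, hτ, h0, h⟩ := exists_gauge_eq_zero (G := G) hθ w
  rw [← extDeriv_chernForm_curv_of_eq_zero (G := G) f.1 hτ h0]
  refine Filter.EventuallyEq.extDeriv_eq ?_
  filter_upwards [h.eventually_nhds, (contMDiffAt_iff_contMDiffAt_nhds (n := 2) (by simp)).1
    (hg.of_le (by exact ENat.LEInfty.out)),
    (hτ.of_le (m := 1) (by simp)).eventually (by simp)] with y h1 h2 h3
  ext v
  rw [chernForm_apply, chernForm_apply]
  exact (evalPoly_Ad f (g y)⁻¹ (fun u v ↦ curv_gauge (hθ.differentiable (by simp) y)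
    (h3.differentiableAt (by simp)) h2 h1 u v) v).symm

end Closed

open MeasureTheory

/-! ### Integration over the standard simplex. -/

section Simplex

theorem mem_simplex {p : ℕ} {t : Fin p → ℝ} : t ∈ simplex p ↔ (∀ i, 0 ≤ t i) ∧ ∑ i, t i ≤ 1 := by
  simp only [simplex, Set.mem_ofPred_eq, Fin.forall_fin_succ, bary, Fin.cons_zero, Fin.cons_succ,
    sub_nonneg]
  exact and_comm

theorem isCompact_simplex (p : ℕ) : IsCompact (simplex p) := by
  have hc : IsClosed (simplex p) := by
    have : simplex p = {t | (∀ i, 0 ≤ t i) ∧ ∑ i, t i ≤ 1} := Set.ext fun _ ↦ mem_simplex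
    rw [this, Set.ofPred_and, Set.ofPred_forall]
    exact (isClosed_iInter fun i ↦ isClosed_le continuous_const (continuous_apply i)).inter
      (isClosed_le (continuous_finsetSum _ fun i _ ↦ continuous_apply i) continuous_const)
  refine isCompact_Icc.of_isClosed_subset hc (s := Set.Icc (0 : Fin p → ℝ) 1) fun t ht ↦ ?_
  obtain ⟨h0, h1⟩ := mem_simplex.1 ht
  exact ⟨h0, fun i ↦ (Finset.single_le_sum (fun j _ ↦ h0 j) (Finset.mem_univ i)).trans h1⟩

theorem measurableSet_simplex (p : ℕ) : MeasurableSet (simplex p) :=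
  (isCompact_simplex p).isClosed.measurableSet

/-- The lines parallel to a coordinate axis meet the simplex in intervals with explicit ends. This
is the form in which Fubini and the fundamental theorem of calculus use it. -/
theorem insertNth_mem_simplex {p : ℕ} {a : Fin (p + 1)} {x : ℝ} {s : Fin p → ℝ} :
    (Fin.insertNth (α := fun _ ↦ ℝ) a x s : Fin (p + 1) → ℝ) ∈ simplex (p + 1) ↔
      s ∈ simplex p ∧ x ∈ Set.Icc 0 (1 - ∑ i, s i) := by
  rw [mem_simplex, mem_simplex, Fin.forall_iff_succAbove a, Fin.sum_univ_succAbove _ a]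
  simp only [Fin.insertNth_apply_same, Fin.insertNth_apply_succAbove, Set.mem_Icc]
  constructor
  · rintro ⟨⟨h1, h2⟩, h3⟩
    exact ⟨⟨h2, by linarith⟩, h1, by linarith⟩
  · rintro ⟨⟨h1, h2⟩, h3, h4⟩
    exact ⟨⟨h3, h1⟩, by linarith⟩

theorem hasDerivAt_insertNth {p : ℕ} (a : Fin (p + 1)) (s : Fin p → ℝ) (x : ℝ) :
    HasDerivAt (fun x ↦ (Fin.insertNth (α := fun _ ↦ ℝ) a x s : Fin (p + 1) → ℝ))
      (Pi.single a 1) x := by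
  refine hasDerivAt_pi.2 fun i ↦ ?_
  refine Fin.succAboveCases a ?_ (fun j ↦ ?_) i
  · simpa using! hasDerivAt_id x
  · simpa using hasDerivAt_const x (s j)

theorem measurePreserving_insertNth {p : ℕ} (a : Fin (p + 1)) :
    MeasurePreserving (fun z : ℝ × (Fin p → ℝ) ↦
      (Fin.insertNth (α := fun _ ↦ ℝ) a z.1 z.2 : Fin (p + 1) → ℝ)) :=
  (volume_preserving_piFinSuccAbove (fun _ : Fin (p + 1) ↦ ℝ) a).symm

/-- The integral over the simplex of a partial derivative. -/
theorem setIntegral_simplex_fderiv {p : ℕ} (a : Fin (p + 1)) {b : (Fin (p + 1) → ℝ) → ℝ}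
    (hb : ContDiff ℝ 1 b) :
    ∫ t in simplex (p + 1), fderiv ℝ b t (Pi.single a 1) =
      ∫ s in simplex p, (b (Fin.insertNth (α := fun _ ↦ ℝ) a (1 - ∑ i, s i) s) -
        b (Fin.insertNth (α := fun _ ↦ ℝ) a 0 s)) := by
  have hF : Continuous fun t ↦ fderiv ℝ b t (Pi.single a 1) :=
    (hb.continuous_fderiv (by simp)).clm_apply continuous_const
  have hint : Integrable ((simplex (p + 1)).indicator fun t ↦ fderiv ℝ b t (Pi.single a 1)) :=
    (hF.continuousOn.integrableOn_compact (isCompact_simplex _)).integrable_indicator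
      (measurableSet_simplex _)
  have hmp := measurePreserving_insertNth a
  have hemb : MeasurableEmbedding (fun z : ℝ × (Fin p → ℝ) ↦
      (Fin.insertNth (α := fun _ ↦ ℝ) a z.1 z.2 : Fin (p + 1) → ℝ)) :=
    (MeasurableEquiv.piFinSuccAbove (fun _ : Fin (p + 1) ↦ ℝ) a).symm.measurableEmbedding
  rw [← integral_indicator (measurableSet_simplex _), ← hmp.integral_comp hemb,
    Measure.volume_eq_prod, integral_prod_symm (fun z : ℝ × (Fin p → ℝ) ↦
      (simplex (p + 1)).indicator (fun t ↦ fderiv ℝ b t (Pi.single a 1))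
        (Fin.insertNth (α := fun _ ↦ ℝ) a z.1 z.2)) ((hmp.integrable_comp_emb hemb).2 hint),
    ← integral_indicator (measurableSet_simplex _)]
  refine integral_congr_ae (Filter.Eventually.of_forall fun s ↦ ?_)
  by_cases hs : s ∈ simplex p
  · have hle : 0 ≤ 1 - ∑ i, s i := by linarith [(mem_simplex.1 hs).2]
    have e : (fun x : ℝ ↦ (simplex (p + 1)).indicator (fun t ↦ fderiv ℝ b t (Pi.single a 1))
        (Fin.insertNth (α := fun _ ↦ ℝ) a x s)) = (Set.Icc 0 (1 - ∑ i, s i)).indicator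
          fun x ↦ fderiv ℝ b (Fin.insertNth (α := fun _ ↦ ℝ) a x s) (Pi.single a 1) := by
      funext x
      simp only [Set.indicator, insertNth_mem_simplex, hs, true_and]
    simp only [Set.indicator_of_mem hs]
    rw [e, integral_indicator measurableSet_Icc, integral_Icc_eq_integral_Ioc,
      ← intervalIntegral.integral_of_le hle]
    refine intervalIntegral.integral_eq_sub_of_hasDerivAt
      (f := fun x : ℝ ↦ b (Fin.insertNth (α := fun _ ↦ ℝ) a x s)) (fun x _ ↦ ?_) ?_
    · exact (hb.differentiable (by simp) _).hasFDerivAt.comp_hasDerivAt x (hasDerivAt_insertNth a s x)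
    · refine Continuous.intervalIntegrable (hF.comp ?_) _ _
      exact continuous_iff_continuousAt.2 fun x ↦ (hasDerivAt_insertNth a s x).continuousAt
  · simp only [Set.indicator_of_notMem hs]
    refine integral_eq_zero_of_ae (Filter.Eventually.of_forall fun x ↦ ?_)
    exact Set.indicator_of_notMem (fun h ↦ hs (insertNth_mem_simplex.1 h).1) _

theorem removeNth_bary_mem_simplex {p : ℕ} (a : Fin (p + 1)) {s : Fin p → ℝ} :
    (a.removeNth (bary s) : Fin p → ℝ) ∈ simplex p ↔ s ∈ simplex p := by
  have hsum : ∑ i, bary s i = 1 := by simp [bary, Fin.sum_univ_succ]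
  have h1 := Fin.sum_univ_succAbove (bary s) a
  have h2 : s ∈ simplex p ↔ ∀ j, 0 ≤ bary s j := Iff.rfl
  rw [mem_simplex, h2, Fin.forall_iff_succAbove a]
  simp only [Fin.removeNth_apply]
  constructor
  · rintro ⟨h3, h4⟩; exact ⟨by linarith, h3⟩
  · rintro ⟨h3, h4⟩; exact ⟨h4, by linarith⟩

theorem insertNth_removeNth_bary {p : ℕ} (a : Fin (p + 1)) (s : Fin p → ℝ) :
    (Fin.insertNth (α := fun _ ↦ ℝ) a (1 - ∑ i, (a.removeNth (bary s) : Fin p → ℝ) i)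
      (a.removeNth (bary s)) : Fin (p + 1) → ℝ) = bary s := by
  have hsum : ∑ i, bary s i = 1 := by simp [bary, Fin.sum_univ_succ]
  have h1 := Fin.sum_univ_succAbove (bary s) a
  have h2 : 1 - ∑ i, (a.removeNth (bary s) : Fin p → ℝ) i = bary s a := by
    simp only [Fin.removeNth_apply]; linarith
  rw [h2]
  exact Fin.insertNth_self_removeNth a (bary s)

/-- The permutations of the barycentric coordinates preserve the volume. -/
theorem measurePreserving_removeNth_bary {p : ℕ} (a : Fin (p + 1)) :
    MeasurePreserving fun s : Fin p → ℝ ↦ (a.removeNth (bary s) : Fin p → ℝ) := by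
  refine Fin.cases ?_ (fun a' ↦ ?_) a
  · simpa [bary] using! MeasurePreserving.id (volume : Measure (Fin p → ℝ))
  · obtain _ | p := p
    · exact a'.elim0
    -- Omitting t_a for a > 0 replaces that coordinate by t_0: on each line where the other
    -- coordinates are fixed this is a reflection, followed by a reordering of coordinates.
    have hshear : MeasurePreserving (fun z : (Fin p → ℝ) × ℝ ↦ (z.1, (1 - ∑ i, z.1 i) - z.2)) := by
      refine MeasurePreserving.skew_product (f := id)
        (g := fun (r : Fin p → ℝ) (x : ℝ) ↦ (1 - ∑ i, r i) - x)
        (MeasurePreserving.id _) ?_ (Filter.Eventually.of_forall fun r ↦ ?_)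
      · exact Continuous.measurable (by unfold Function.uncurry; fun_prop)
      · exact (Measure.measurePreserving_sub_left volume _).map_eq
    have h := ((measurePreserving_insertNth (0 : Fin (p + 1))).comp
      ((Measure.measurePreserving_swap.comp hshear).comp Measure.measurePreserving_swap)).comp
      (volume_preserving_piFinSuccAbove (fun _ : Fin (p + 1) ↦ ℝ) a')
    convert h using 1
    funext s
    have hsum := Fin.sum_univ_succAbove s a'
    funext i
    refine Fin.cases ?_ (fun j ↦ ?_) i
    · show 1 - ∑ i, s i = 1 - ∑ i, s (a'.succAbove i) - s a'
      rw [hsum]; ring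
    · simp only [Fin.removeNth_apply, bary, Fin.succ_succAbove_succ, Fin.cons_succ]
      rfl

/-- The face opposite to the vertex 0 can be parametrized by dropping any one of its barycentric
coordinates; all these parametrizations have the same integral, because changing from one to another
preserves volume and the simplex. -/
theorem setIntegral_simplex_insertNth {p : ℕ} (a : Fin (p + 1)) {b : (Fin (p + 1) → ℝ) → ℝ}
    (hb : Continuous b) :
    ∫ s in simplex p, b (Fin.insertNth (α := fun _ ↦ ℝ) a (1 - ∑ i, s i) s) =
      ∫ s in simplex p, b (bary s) := by
  have hT := measurePreserving_removeNth_bary a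
  have hc : Continuous fun s : Fin p → ℝ ↦
      b (Fin.insertNth (α := fun _ ↦ ℝ) a (1 - ∑ i, s i) s) := by
    refine hb.comp (continuous_pi fun i ↦ ?_)
    refine Fin.succAboveCases a ?_ (fun j ↦ ?_) i
    · simp only [Fin.insertNth_apply_same]; fun_prop
    · simp only [Fin.insertNth_apply_succAbove]; fun_prop
  rw [← integral_indicator (measurableSet_simplex _), ← integral_indicator (measurableSet_simplex _)]
  conv_lhs => rw [← hT.map_eq]
  rw [integral_map hT.measurable.aemeasurable
    (hc.measurable.indicator (measurableSet_simplex p)).aestronglyMeasurable]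
  refine integral_congr_ae (Filter.Eventually.of_forall fun s ↦ ?_)
  dsimp only
  by_cases hs : s ∈ simplex p
  · rw [Set.indicator_of_mem hs, Set.indicator_of_mem ((removeNth_bary_mem_simplex a).2 hs),
      insertNth_removeNth_bary]
  · rw [Set.indicator_of_notMem hs,
      Set.indicator_of_notMem fun h ↦ hs ((removeNth_bary_mem_simplex a).1 h)]

end Simplex

/-! ### Integrals over a compact set depending on parameters. -/

section Parametric

variable {U W : Type*} [NormedAddCommGroup U] [NormedSpace ℝ U] [MeasurableSpace U] [BorelSpace U]
  [SecondCountableTopology U]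
  [NormedAddCommGroup W] [NormedSpace ℝ W] [FiniteDimensional ℝ W]
  (μ : Measure U) [IsFiniteMeasureOnCompacts μ] {K : Set U}

/-- Differentiation under the integral; the dominating constant is the bound of the partial
derivative on the product of `K` with a closed unit ball, compact because W is finite-dimensional.
-/
theorem hasFDerivAt_setIntegral_compact (hK : IsCompact K) {F : U × W → ℝ} (hF : ContDiff ℝ ∞ F)
    (w : W) : HasFDerivAt (fun w ↦ ∫ t in K, F (t, w) ∂μ)
      (∫ t in K, (fderiv ℝ F (t, w)).comp (.inr ℝ U W) ∂μ) w := by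
  have hcF : Continuous fun z : U × W ↦ (fderiv ℝ F z).comp (.inr ℝ U W) :=
    (hF.continuous_fderiv (by simp)).clm_comp continuous_const
  obtain ⟨C, hC⟩ := (hK.prod (isCompact_closedBall w 1)).exists_bound_of_continuousOn hcF.continuousOn
  have hK' : MeasurableSet K := hK.isClosed.measurableSet
  refine hasFDerivAt_integral_of_dominated_of_fderiv_le (s := Metric.ball w 1)
    (F' := fun w t ↦ (fderiv ℝ F (t, w)).comp (.inr ℝ U W)) (bound := fun _ ↦ C)
    (Metric.ball_mem_nhds w one_pos) ?_ ?_ ?_ ?_ ?_ ?_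
  · exact Filter.Eventually.of_forall fun y ↦
      (hF.continuous.comp (Continuous.prodMk_left y)).aestronglyMeasurable
  · exact (hF.continuous.comp (Continuous.prodMk_left w)).continuousOn.integrableOn_compact hK
  · exact (hcF.comp (Continuous.prodMk_left w)).aestronglyMeasurable
  · refine (ae_restrict_iff' hK').2 (Filter.Eventually.of_forall fun t ht y hy ↦ ?_)
    exact hC (t, y) ⟨ht, Metric.ball_subset_closedBall hy⟩
  · have : IsFiniteMeasure (μ.restrict K) := ⟨by simpa using hK.measure_lt_top⟩
    exact integrable_const C
  · refine Filter.Eventually.of_forall fun t y _ ↦ ?_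
    exact (hF.differentiable (by simp) (t, y)).hasFDerivAt.comp y (hasFDerivAt_prodMk_right t y)

theorem fderiv_setIntegral_compact (hK : IsCompact K) {F : U × W → ℝ} (hF : ContDiff ℝ ∞ F)
    (w v : W) : fderiv ℝ (fun w ↦ ∫ t in K, F (t, w) ∂μ) w v =
      ∫ t in K, fderiv ℝ F (t, w) (0, v) ∂μ := by
  rw [(hasFDerivAt_setIntegral_compact μ hK hF w).fderiv, ContinuousLinearMap.integral_apply]
  · rfl
  · have hcF : Continuous fun t : U ↦ (fderiv ℝ F (t, w)).comp (.inr ℝ U W) :=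
      ((hF.continuous_fderiv (by simp)).comp (Continuous.prodMk_left w)).clm_comp continuous_const
    exact hcF.continuousOn.integrableOn_compact hK

/-- Each directional derivative is again such an integral, of another smooth integrand; hence the
induction must generalize over `F`. -/
theorem contDiff_setIntegral_compact (hK : IsCompact K) {F : U × W → ℝ} (hF : ContDiff ℝ ∞ F) :
    ContDiff ℝ ∞ fun w ↦ ∫ t in K, F (t, w) ∂μ := by
  rw [contDiff_infty]
  intro n
  induction n generalizing F with
  | zero =>
    exact contDiff_zero.2 (continuous_iff_continuousAt.2 fun w ↦
      (hasFDerivAt_setIntegral_compact μ hK hF w).continuousAt)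
  | succ n ih =>
    push_cast
    refine contDiff_succ_iff_fderiv_apply.2 ⟨fun w ↦
      (hasFDerivAt_setIntegral_compact μ hK hF w).differentiableAt, by simp, fun v ↦ ?_⟩
    simp only [fderiv_setIntegral_compact μ hK hF]
    exact ih ((hF.fderiv_right (m := ∞) (by simp)).clm_apply contDiff_const)

end Parametric

/-! ### Multilinear algebra on a product U × W. -/

section FiberVec

variable {U W : Type*} [AddCommGroup U] [AddCommGroup W] {p q m : ℕ}

/-- The family of vectors `(e_0, 0), …, (e_{p-1}, 0), (0, v_0), …, (0, v_{q-1})`. -/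
def fiberVec (e : Fin p → U) (h : p + q = m) (v : Fin q → W) (i : Fin m) : U × W :=
  Fin.append (fun a ↦ (e a, 0)) (fun b ↦ (0, v b)) (Fin.cast h.symm i)

theorem fiberVec_eq (e : Fin p → U) (h : p + q = m) (v : Fin q → W) (i : Fin m) :
    fiberVec e h v i = if hi : (i : ℕ) < p then (e ⟨i, hi⟩, 0) else (0, v ⟨i - p, by omega⟩) := by
  subst h
  refine Fin.addCases (fun a ↦ ?_) (fun b ↦ ?_) i
  · simp [fiberVec]
  · simp [fiberVec]

@[simp] theorem fiberVec_left (e : Fin p → U) (h : p + q = m) (v : Fin q → W) (a : Fin p) :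
    fiberVec e h v (Fin.cast h (Fin.castAdd q a)) = (e a, 0) := by
  simp [fiberVec]

@[simp] theorem fiberVec_right (e : Fin p → U) (h : p + q = m) (v : Fin q → W) (b : Fin q) :
    fiberVec e h v (Fin.cast h (Fin.natAdd p b)) = (0, v b) := by
  simp [fiberVec]

theorem removeNth_fiberVec_left (e : Fin (p + 1) → U) (h : p + q = m) (h' : p + 1 + q = m + 1)
    (v : Fin q → W) (a : Fin (p + 1)) :
    (Fin.cast h' (Fin.castAdd q a)).removeNth (fiberVec e h' v) = fiberVec (a.removeNth e) h v := by
  funext i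
  rw [Fin.removeNth_apply, fiberVec_eq, fiberVec_eq]
  have hv : ((Fin.cast h' (Fin.castAdd q a)).succAbove i : ℕ) = if (i : ℕ) < a then (i : ℕ) else i + 1 := by
    rw [Fin.succAbove]; simp only [Fin.lt_def]; split_ifs <;> simp_all
  by_cases hi : (i : ℕ) < p
  · have h1 : ((Fin.cast h' (Fin.castAdd q a)).succAbove i : ℕ) < p + 1 := by
      rw [hv]; split_ifs <;> omega
    rw [dif_pos h1, dif_pos hi, Fin.removeNth_apply]
    congr 2
    ext
    simp only [hv]
    rw [Fin.succAbove]; simp only [Fin.lt_def]; split_ifs <;> simp_all <;> omega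
  · have h1 : ¬ ((Fin.cast h' (Fin.castAdd q a)).succAbove i : ℕ) < p + 1 := by
      rw [hv]; split_ifs <;> omega
    rw [dif_neg h1, dif_neg hi]
    congr 2
    ext
    simp only [hv]
    split_ifs <;> omega

theorem removeNth_fiberVec_right (e : Fin p → U) (h : p + q = m) (h' : p + (q + 1) = m + 1)
    (v : Fin (q + 1) → W) (b : Fin (q + 1)) :
    (Fin.cast h' (Fin.natAdd p b)).removeNth (fiberVec e h' v) = fiberVec e h (b.removeNth v) := by
  funext i
  rw [Fin.removeNth_apply, fiberVec_eq, fiberVec_eq]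
  have hv : ((Fin.cast h' (Fin.natAdd p b)).succAbove i : ℕ) =
      if (i : ℕ) < p + b then (i : ℕ) else i + 1 := by
    rw [Fin.succAbove]; simp only [Fin.lt_def]; split_ifs <;> simp_all
  by_cases hi : (i : ℕ) < p
  · have h1 : ((Fin.cast h' (Fin.natAdd p b)).succAbove i : ℕ) < p := by
      rw [hv]; split_ifs <;> omega
    rw [dif_pos h1, dif_pos hi]
    congr 2
    ext
    simp only [hv]
    split_ifs <;> omega
  · have h1 : ¬ ((Fin.cast h' (Fin.natAdd p b)).succAbove i : ℕ) < p := by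
      rw [hv]; split_ifs <;> omega
    rw [dif_neg h1, dif_neg hi, Fin.removeNth_apply]
    congr 2
    ext
    simp only [hv]
    rw [Fin.succAbove]; simp only [Fin.lt_def]; split_ifs <;> simp_all <;> omega

theorem sum_fin_split {M : Type*} [AddCommMonoid M] (h : p + q = m) (φ : Fin m → M) :
    ∑ i, φ i = ∑ a : Fin p, φ (Fin.cast h (Fin.castAdd q a)) +
      ∑ b : Fin q, φ (Fin.cast h (Fin.natAdd p b)) := by
  subst h
  exact Fin.sum_univ_add φ

theorem fiberVec_update_right (e : Fin p → U) (h : p + q = m) (v : Fin q → W) (b : Fin q) (x : W) :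
    fiberVec e h (Function.update v b x) =
      Function.update (fiberVec e h v) (Fin.cast h (Fin.natAdd p b)) (0, x) := by
  subst h
  funext i
  refine Fin.addCases (fun a ↦ ?_) (fun c ↦ ?_) i
  · rw [Function.update_of_ne]
    · simp [fiberVec]
    · simp [Fin.ext_iff]; omega
  · by_cases hc : c = b
    · subst hc; simp [fiberVec]
    · rw [Function.update_of_ne]
      · simp [fiberVec, Function.update_of_ne hc]
      · simpa [Fin.ext_iff] using hc

theorem fiberVec_update_left (e : Fin p → U) (h : p + q = m) (v : Fin q → W) (a : Fin p) (x : U) :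
    fiberVec (Function.update e a x) h v =
      Function.update (fiberVec e h v) (Fin.cast h (Fin.castAdd q a)) (x, 0) := by
  subst h
  funext i
  refine Fin.addCases (fun c ↦ ?_) (fun b ↦ ?_) i
  · by_cases hc : c = a
    · subst hc; simp [fiberVec]
    · rw [Function.update_of_ne]
      · simp [fiberVec, Function.update_of_ne hc]
      · simpa [Fin.ext_iff] using hc
  · rw [Function.update_of_ne]
    · simp [fiberVec]
    · simp [Fin.ext_iff]; omega

variable [Module ℝ U] [Module ℝ W]

theorem map_fiberVec {U' W' : Type*} [AddCommGroup U'] [AddCommGroup W'] (L : U → U') (L' : W → W')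
    (hL : L 0 = 0) (hL' : L' 0 = 0) (e : Fin p → U) (h : p + q = m) (v : Fin q → W) (i : Fin m) :
    Prod.map L L' (fiberVec e h v i) = fiberVec (L ∘ e) h (L' ∘ v) i := by
  subst h
  refine Fin.addCases (fun a ↦ ?_) (fun b ↦ ?_) i <;> simp [fiberVec, hL, hL']

/-- The form `v ↦ β(e, v)`. -/
def sliceRight (e : Fin p → U) (h : p + q = m) (β : (U × W) [⋀^Fin m]→ₗ[ℝ] ℝ) :
    W [⋀^Fin q]→ₗ[ℝ] ℝ :=
  { MultilinearMap.mk' (fun v ↦ β (fiberVec e h v))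
      (fun v b x y ↦ by
        simp only [fiberVec_update_right, ← β.map_update_add, Prod.mk_add_mk, add_zero])
      (fun v b c x ↦ by
        simp only [fiberVec_update_right, ← β.map_update_smul, Prod.smul_mk, smul_zero]) with
    map_eq_zero_of_eq' := fun v i j hv hij ↦ β.map_eq_zero_of_eq _
      (i := Fin.cast h (Fin.natAdd p i)) (j := Fin.cast h (Fin.natAdd p j)) (by simp [hv])
      (by simpa [Fin.ext_iff] using hij) }

/-- The form `e ↦ β(e, v)`. -/
def sliceLeft (v : Fin q → W) (h : p + q = m) (β : (U × W) [⋀^Fin m]→ₗ[ℝ] ℝ) :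
    U [⋀^Fin p]→ₗ[ℝ] ℝ :=
  { MultilinearMap.mk' (fun e ↦ β (fiberVec e h v))
      (fun e b x y ↦ by
        simp only [fiberVec_update_left, ← β.map_update_add, Prod.mk_add_mk, add_zero])
      (fun e b c x ↦ by
        simp only [fiberVec_update_left, ← β.map_update_smul, Prod.smul_mk, smul_zero]) with
    map_eq_zero_of_eq' := fun e i j he hij ↦ β.map_eq_zero_of_eq _
      (i := Fin.cast h (Fin.castAdd q i)) (j := Fin.cast h (Fin.castAdd q j)) (by simp [he])
      (by simpa [Fin.ext_iff] using hij) }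

/-- Subtracting the vector of slot 0 from another slot adds a term in which a vector is repeated.
The set `s` of modified slots grows by induction. -/
theorem alternating_sub_const {n : ℕ} (F : U [⋀^Fin (n + 1)]→ₗ[ℝ] ℝ) (y : Fin (n + 1) → U)
    (s : Finset (Fin (n + 1))) (hs : 0 ∉ s) :
    F (fun i ↦ if i ∈ s then y i - y 0 else y i) = F y := by
  induction s using Finset.induction_on with
  | empty => simp
  | insert a s ha ih =>
    have h0 : (0 : Fin (n + 1)) ∉ s := fun h ↦ hs (Finset.mem_insert_of_mem h)
    have ha0 : a ≠ 0 := fun h ↦ hs (h ▸ Finset.mem_insert_self _ _)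
    rw [← ih h0]
    set z : Fin (n + 1) → U := fun i ↦ if i ∈ s then y i - y 0 else y i with hz
    have hza : z a = y a := if_neg ha
    have hz0 : z 0 = y 0 := if_neg h0
    have e : (fun i ↦ if i ∈ insert a s then y i - y 0 else y i) =
        Function.update z a (z a - z 0) := by
      funext i
      by_cases hi : i = a
      · subst hi; simp [hza, hz0]
      · simp [hz, hi]
    rw [e, F.map_update_sub, Function.update_eq_self, F.map_update_self z ha0, sub_zero]

/-- The contraction of a form with a simplex is that with the frame of edges at a vertex. -/
theorem sum_removeNth_eq {n : ℕ} (γ : U [⋀^Fin n]→ₗ[ℝ] ℝ) (x : Fin (n + 1) → U) :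
    ∑ a : Fin (n + 1), (-1 : ℝ) ^ (a : ℕ) * γ (a.removeNth x) = γ fun i ↦ x i.succ - x 0 := by
  -- F is dr ∧ γ on ℝ × U. On the vectors (1, x_i) it is the left-hand sum; after subtracting (1,
  -- x_0) from the others, only the term of slot 0 has a nonzero ℝ-component.
  let F : (ℝ × U) [⋀^Fin (n + 1)]→ₗ[ℝ] ℝ := AlternatingMap.alternatizeUncurryFin
    ((LinearMap.fst ℝ ℝ U).smulRight (γ.compLinearMap (LinearMap.snd ℝ ℝ U)))
  have hF : ∀ y, F y = ∑ a : Fin (n + 1), (-1 : ℝ) ^ (a : ℕ) *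
      ((y a).1 * γ (a.removeNth fun i ↦ (y i).2)) := by
    intro y
    simp only [F, AlternatingMap.alternatizeUncurryFin_apply]
    refine Finset.sum_congr rfl fun a _ ↦ ?_
    rw [zsmul_eq_mul]
    push_cast
    rfl
  have h := alternating_sub_const F (fun i ↦ ((1 : ℝ), x i)) (Finset.univ.erase 0) (by simp)
  rw [hF, hF, Fin.sum_univ_succ] at h
  simp only [Finset.mem_erase, Finset.mem_univ, and_true] at h
  refine Eq.trans ?_ (h.symm.trans ?_)
  · simp
  · rw [Finset.sum_eq_zero fun a _ ↦ by simp [Fin.succ_ne_zero]]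
    simp only [Fin.val_zero, pow_zero, one_mul, add_zero, not_true_eq_false, if_false, ne_eq]
    congr 1

end FiberVec

/-! ### Fibre integration and the exterior derivative. -/

section FiberIntegral

variable {U W : Type*} [NormedAddCommGroup U] [NormedSpace ℝ U] [MeasurableSpace U] [BorelSpace U]
  [SecondCountableTopology U]
  [NormedAddCommGroup W] [NormedSpace ℝ W] [FiniteDimensional ℝ W]
  (μ : Measure U) [IsFiniteMeasureOnCompacts μ] {K : Set U} {p q m : ℕ}

/-- Fibre integration over `K ⊆ U` of a form on `U × W`, after contraction with a frame of `U`. -/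
def fiberInt (K : Set U) (e : Fin p → U) (h : p + q = m) (α : U × W → (U × W) [⋀^Fin m]→L[ℝ] ℝ)
    (w : W) : W [⋀^Fin q]→L[ℝ] ℝ :=
  ∫ t in K, altForm (sliceRight e h (α (t, w)).toAlternatingMap) ∂μ

theorem contDiff_apply_vec {n : WithTop ℕ∞} {α : U × W → (U × W) [⋀^Fin m]→L[ℝ] ℝ}
    (hα : ContDiff ℝ n α) (v : Fin m → U × W) : ContDiff ℝ n fun z ↦ α z v :=
  (ContinuousAlternatingMap.apply ℝ (U × W) ℝ v).contDiff.comp hα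

theorem fiberInt_apply (hK : IsCompact K) (e : Fin p → U) (h : p + q = m)
    {α : U × W → (U × W) [⋀^Fin m]→L[ℝ] ℝ} (hα : ContDiff ℝ ∞ α) (w : W) (v : Fin q → W) :
    fiberInt μ K e h α w v = ∫ t in K, α (t, w) (fiberVec e h v) ∂μ := by
  have hc : ContDiff ℝ ∞ fun t : U ↦ altForm (sliceRight e h (α (t, w)).toAlternatingMap) :=
    contDiff_alternating fun v ↦
      (contDiff_apply_vec hα (fiberVec e h v)).comp (contDiff_prodMk_left w)
  have := (ContinuousAlternatingMap.apply ℝ W ℝ v).integral_comp_comm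
    (hc.continuous.continuousOn.integrableOn_compact (μ := μ) hK)
  exact this.symm

theorem contDiff_fiberInt (hK : IsCompact K) (e : Fin p → U) (h : p + q = m)
    {α : U × W → (U × W) [⋀^Fin m]→L[ℝ] ℝ} (hα : ContDiff ℝ ∞ α) :
    ContDiff ℝ ∞ (fiberInt μ K e h α) := by
  refine contDiff_alternating fun v ↦ ?_
  simp only [fiberInt_apply μ hK e h hα]
  exact contDiff_setIntegral_compact μ hK (contDiff_apply_vec hα _)

theorem neg_one_zpow_smul (n : ℕ) (r : ℝ) : (-1 : ℤ) ^ n • r = (-1 : ℝ) ^ n * r := by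
  rw [zsmul_eq_mul]; push_cast; rfl

theorem extDeriv_fiberInt (hK : IsCompact K) (e : Fin p → U) (h : p + q = m)
    {α : U × W → (U × W) [⋀^Fin m]→L[ℝ] ℝ} (hα : ContDiff ℝ ∞ α) (w : W) (v : Fin (q + 1) → W) :
    extDeriv (fiberInt μ K e h α) w v = ∑ b : Fin (q + 1), (-1 : ℝ) ^ (b : ℕ) *
      ∫ t in K, fderiv ℝ (fun z ↦ α z (fiberVec e h (b.removeNth v))) (t, w) (0, v b) ∂μ := by
  rw [extDeriv_apply ((contDiff_fiberInt μ hK e h hα).differentiable (by simp) w)]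
  refine Finset.sum_congr rfl fun b _ ↦ ?_
  simp only [fiberInt_apply μ hK e h hα, neg_one_zpow_smul]
  rw [fderiv_setIntegral_compact μ hK (contDiff_apply_vec hα _)]

theorem extDeriv_fiberVec (e : Fin p → U) (h : p + q = m + 1)
    {α : U × W → (U × W) [⋀^Fin m]→L[ℝ] ℝ} {z : U × W} (hα : DifferentiableAt ℝ α z)
    (v : Fin q → W) :
    extDeriv α z (fiberVec e h v) =
      ∑ a : Fin p, (-1 : ℝ) ^ (a : ℕ) * fderiv ℝ (fun z ↦ α z
        ((Fin.cast h (Fin.castAdd q a)).removeNth (fiberVec e h v))) z (e a, 0) +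
      ∑ b : Fin q, (-1 : ℝ) ^ (p + b : ℕ) * fderiv ℝ (fun z ↦ α z
        ((Fin.cast h (Fin.natAdd p b)).removeNth (fiberVec e h v))) z (0, v b) := by
  rw [extDeriv_apply hα, sum_fin_split h]
  simp only [neg_one_zpow_smul, fiberVec_left, fiberVec_right]
  rfl

theorem continuous_fderiv_apply {α : U × W → (U × W) [⋀^Fin m]→L[ℝ] ℝ} (hα : ContDiff ℝ ∞ α)
    (u : Fin m → U × W) (w : W) (x : U × W) :
    Continuous fun t : U ↦ fderiv ℝ (fun z ↦ α z u) (t, w) x :=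
  (((contDiff_apply_vec hα u).continuous_fderiv (by simp)).comp
    (Continuous.prodMk_left w)).clm_apply continuous_const

/-- Fibre integration and the exterior derivative. -/
theorem extDeriv_fiberInt_eq (hK : IsCompact K) (e : Fin p → U) (h : p + q = m)
    (h' : p + (q + 1) = m + 1) {α : U × W → (U × W) [⋀^Fin m]→L[ℝ] ℝ} (hα : ContDiff ℝ ∞ α)
    (w : W) (v : Fin (q + 1) → W) :
    ∫ t in K, extDeriv α (t, w) (fiberVec e h' v) ∂μ =
      ∑ a : Fin p, (-1 : ℝ) ^ (a : ℕ) * ∫ t in K, fderiv ℝ (fun z ↦ α z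
        ((Fin.cast h' (Fin.castAdd (q + 1) a)).removeNth (fiberVec e h' v))) (t, w) (e a, 0) ∂μ +
      (-1 : ℝ) ^ p * extDeriv (fiberInt μ K e h α) w v := by
  simp only [extDeriv_fiberVec e h' (hα.differentiable (by simp) _),
    removeNth_fiberVec_right e h h']
  have hi : ∀ (u : Fin m → U × W) (c : ℝ) (x : U × W),
      IntegrableOn (fun t ↦ c * fderiv ℝ (fun z ↦ α z u) (t, w) x) K μ := fun u c x ↦
    (continuous_const.mul (continuous_fderiv_apply hα u w x)).continuousOn.integrableOn_compact hK
  rw [integral_add (integrable_finsetSum _ fun a _ ↦ hi _ _ _)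
    (integrable_finsetSum _ fun a _ ↦ hi _ _ _), integral_finsetSum _ fun a _ ↦ hi _ _ _,
    integral_finsetSum _ fun a _ ↦ hi _ _ _, extDeriv_fiberInt μ hK e h hα, Finset.mul_sum]
  simp only [integral_const_mul, pow_add, mul_assoc]

/-- The bottom case of the preceding formula: the degree of α is smaller than the fibre dimension,
so there is no fibre integral to differentiate and only derivatives along the fibre remain. -/
theorem integral_extDeriv_fiberVec (hK : IsCompact K) (e : Fin p → U) (h' : p + 0 = m + 1)
    {α : U × W → (U × W) [⋀^Fin m]→L[ℝ] ℝ} (hα : ContDiff ℝ ∞ α) (w : W) (v : Fin 0 → W) :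
    ∫ t in K, extDeriv α (t, w) (fiberVec e h' v) ∂μ =
      ∑ a : Fin p, (-1 : ℝ) ^ (a : ℕ) * ∫ t in K, fderiv ℝ (fun z ↦ α z
        ((Fin.cast h' (Fin.castAdd 0 a)).removeNth (fiberVec e h' v))) (t, w) (e a, 0) ∂μ := by
  simp only [extDeriv_fiberVec e h' (hα.differentiable (by simp) _), Finset.univ_eq_empty (α := Fin 0),
    Finset.sum_empty, add_zero]
  have hi : ∀ (u : Fin m → U × W) (c : ℝ) (x : U × W),
      IntegrableOn (fun t ↦ c * fderiv ℝ (fun z ↦ α z u) (t, w) x) K μ := fun u c x ↦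
    (continuous_const.mul (continuous_fderiv_apply hα u w x)).continuousOn.integrableOn_compact hK
  rw [integral_finsetSum _ fun a _ ↦ hi _ _ _]
  simp only [integral_const_mul]

end FiberIntegral

/-! ### Stokes' theorem on the simplex, fibrewise. -/

section Stokes

variable {W : Type*} [NormedAddCommGroup W] [NormedSpace ℝ W] [FiniteDimensional ℝ W] {p q m : ℕ}

/-- The standard frame of `ℝ^p`. -/
def stdE (p : ℕ) (a : Fin p) : Fin p → ℝ := Pi.single a 1

/-- The inclusion of the `j`-th face of the simplex. -/
def faceMap (j : Fin (p + 2)) (s : Fin p → ℝ) : Fin (p + 1) → ℝ :=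
  Fin.cases (bary s) (fun a ↦ Fin.insertNth (α := fun _ ↦ ℝ) a 0 s) j

/-- The image of the standard frame under the inclusion of a face. -/
def faceVec (j : Fin (p + 2)) : Fin p → Fin (p + 1) → ℝ :=
  Fin.cases (fun b ↦ stdE (p + 1) b.succ - stdE (p + 1) 0)
    (fun a ↦ a.removeNth (stdE (p + 1))) j

theorem hasFDerivAt_faceMap (j : Fin (p + 2)) (s : Fin p → ℝ) :
    ∃ L : (Fin p → ℝ) →L[ℝ] (Fin (p + 1) → ℝ), HasFDerivAt (faceMap j) L s ∧
      ∀ b, L (stdE p b) = faceVec j b := by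
  refine Fin.cases ?_ (fun a ↦ ?_) j
  · refine ⟨ContinuousLinearMap.pi (Fin.cons (-∑ i, ContinuousLinearMap.proj i)
      fun i ↦ ContinuousLinearMap.proj i), hasFDerivAt_pi.2 fun i ↦ ?_, fun b ↦ funext fun i ↦ ?_⟩
    · refine Fin.cases ?_ (fun i ↦ ?_) i
      · have := (HasFDerivAt.fun_sum (u := Finset.univ) fun (i : Fin p) _ ↦
          hasFDerivAt_apply (𝕜 := ℝ) (F' := fun _ ↦ ℝ) i s).const_sub 1
        simpa [faceMap, bary] using! this
      · simpa [faceMap, bary] using! hasFDerivAt_apply (𝕜 := ℝ) (F' := fun _ ↦ ℝ) i s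
    · refine Fin.cases ?_ (fun i ↦ ?_) i
      · simp [faceVec, stdE, sum_apply]
      · simp [faceVec, stdE, Pi.single_apply, Fin.succ_ne_zero]
  · refine ⟨ContinuousLinearMap.pi (Fin.insertNth (α := fun _ ↦ (Fin p → ℝ) →L[ℝ] ℝ) a 0
      fun i ↦ ContinuousLinearMap.proj i), hasFDerivAt_pi.2 fun i ↦ ?_, fun b ↦ funext fun i ↦ ?_⟩
    · refine Fin.succAboveCases a ?_ (fun i ↦ ?_) i
      · simpa [faceMap] using! hasFDerivAt_const (0 : ℝ) s
      · simpa [faceMap] using! hasFDerivAt_apply (𝕜 := ℝ) (F' := fun _ ↦ ℝ) i s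
    · refine Fin.succAboveCases a ?_ (fun i ↦ ?_) i
      · simp [faceVec, stdE, Fin.removeNth, (Fin.succAbove_ne _ _).symm]
      · simp [faceVec, stdE, Fin.removeNth, Pi.single_apply]

theorem sum_bary (s : Fin p → ℝ) : ∑ i, bary s i = 1 := by simp [bary, Fin.sum_univ_succ]

/-- In barycentric terms every face inclusion inserts a 0 at position j, including j = 0, which
looks different in the coordinates t_1, …, t_p. -/
theorem bary_faceMap_succAbove (j : Fin (p + 2)) (s : Fin p → ℝ) (i : Fin (p + 1)) :
    bary (faceMap j s) (j.succAbove i) = bary s i := by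
  refine Fin.cases ?_ (fun a ↦ ?_) j
  · simp [faceMap, bary]
  · refine Fin.cases ?_ (fun i ↦ ?_) i
    · simp [faceMap, bary, Fin.sum_univ_succAbove _ a]
    · simp [faceMap, bary]

theorem bary_faceMap_same (j : Fin (p + 2)) (s : Fin p → ℝ) : bary (faceMap j s) j = 0 := by
  have h := Fin.sum_univ_succAbove (bary (faceMap j s)) j
  simp only [bary_faceMap_succAbove, sum_bary] at h
  linarith

/-- Stokes' theorem for the simplex, with parameters. -/
theorem setIntegral_simplex_boundary (h : p + q = m)
    {α : (Fin (p + 1) → ℝ) × W → ((Fin (p + 1) → ℝ) × W) [⋀^Fin m]→L[ℝ] ℝ} (hα : ContDiff ℝ ∞ α)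
    (w : W) (v : Fin q → W) :
    ∑ a : Fin (p + 1), (-1 : ℝ) ^ (a : ℕ) * ∫ t in simplex (p + 1), fderiv ℝ (fun z ↦ α z
        (fiberVec (a.removeNth (stdE (p + 1))) h v)) (t, w) (stdE (p + 1) a, 0) =
      ∑ j : Fin (p + 2), (-1 : ℝ) ^ (j : ℕ) *
        ∫ s in simplex p, α (faceMap j s, w) (fiberVec (faceVec j) h v) := by
  have hb : ∀ u : Fin m → (Fin (p + 1) → ℝ) × W, ContDiff ℝ ∞ fun t ↦ α (t, w) u := fun u ↦
    (contDiff_apply_vec hα u).comp (contDiff_prodMk_left w)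
  have hd : ∀ u t x, fderiv ℝ (fun z ↦ α z u) (t, w) (x, 0) = fderiv ℝ (fun t ↦ α (t, w) u) t x := by
    intro u t x
    have := HasFDerivAt.comp (f := fun t ↦ (t, w)) (g := fun z ↦ α z u) t
      ((contDiff_apply_vec hα u).differentiable (by simp) (t, w)).hasFDerivAt
      (hasFDerivAt_prodMk_left t w)
    exact (congrArg (fun L ↦ L x) this.fderiv).symm
  have hcf : ∀ j : Fin (p + 2), Continuous (faceMap j) := fun j ↦
    continuous_iff_continuousAt.2 fun s ↦ (hasFDerivAt_faceMap j s).choose_spec.1.continuousAt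
  have hi : ∀ (c : ℝ) (u : Fin m → (Fin (p + 1) → ℝ) × W) (j : Fin (p + 2)),
      IntegrableOn (fun s ↦ c * α (faceMap j s, w) u) (simplex p) := fun c u j ↦
    (continuous_const.mul ((hb u).continuous.comp (hcf j))).continuousOn.integrableOn_compact
      (isCompact_simplex p)
  -- Integrating ∂/∂t_a leaves the difference of the slanted face j = 0 and the coordinate face j =
  -- a + 1, and the index shift accounts for the sign of the latter.
  have h1 : ∀ a : Fin (p + 1), ∫ t in simplex (p + 1), fderiv ℝ (fun z ↦ α z
      (fiberVec (a.removeNth (stdE (p + 1))) h v)) (t, w) (stdE (p + 1) a, 0) =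
      (∫ s in simplex p, α (faceMap 0 s, w) (fiberVec (a.removeNth (stdE (p + 1))) h v)) -
      ∫ s in simplex p, α (faceMap a.succ s, w) (fiberVec (faceVec a.succ) h v) := by
    intro a
    simp only [hd]
    refine (setIntegral_simplex_fderiv a ((hb _).of_le (by simp))).trans ?_
    rw [integral_sub]
    · congr 1
      exact setIntegral_simplex_insertNth a (hb _).continuous
    · refine ContinuousOn.integrableOn_compact' (isCompact_simplex p) (measurableSet_simplex p) (Continuous.continuousOn <| (hb _).continuous.comp (continuous_pi fun i ↦ ?_))
      refine Fin.succAboveCases a ?_ (fun j ↦ ?_) i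
      · simp only [Fin.insertNth_apply_same]; fun_prop
      · simp only [Fin.insertNth_apply_succAbove]; fun_prop
    · simpa using! hi 1 _ a.succ
  simp only [h1, mul_sub, Finset.sum_sub_distrib]
  rw [Fin.sum_univ_succ (n := p + 1), sub_eq_add_neg, ← Finset.sum_neg_distrib]
  congr 1
  · simp only [← integral_const_mul]
    rw [← integral_finsetSum _ fun a _ ↦ hi _ _ 0]
    simp only [Fin.val_zero, pow_zero, one_mul]
    refine integral_congr_ae (Filter.Eventually.of_forall fun s ↦ ?_)
    -- The p + 1 contributions on the slanted face combine into one, evaluated on the edge vectors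
    -- e_b - e_0 tangent to that face.
    exact sum_removeNth_eq (sliceLeft v h (α (faceMap 0 s, w)).toAlternatingMap) (stdE (p + 1))
  · refine Finset.sum_congr rfl fun a _ ↦ ?_
    simp only [Fin.val_succ, pow_succ]
    ring

end Stokes

/-! ### Naturality of the curvature and of the form ∑ t_j θ_j. -/

section Pull

variable {EG : Type*} [NormedAddCommGroup EG] [NormedSpace ℝ EG]
  {G : Type*} [TopologicalSpace G] [ChartedSpace EG G] [Group G]
  {W W' : Type*} [NormedAddCommGroup W] [NormedSpace ℝ W] [NormedAddCommGroup W'] [NormedSpace ℝ W']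
  {k p q : ℕ}

/-- Pull-back of a `1`-form along a map of vector spaces. -/
def pull (φ : W' → W) (θ : W → W →L[ℝ] EG) (w : W') : W' →L[ℝ] EG :=
  (θ (φ w)).comp (fderiv ℝ φ w)

theorem contDiff_pull {φ : W' → W} {θ : W → W →L[ℝ] EG} (hφ : ContDiff ℝ ∞ φ)
    (hθ : ContDiff ℝ ∞ θ) : ContDiff ℝ ∞ (pull φ θ) :=
  (hθ.comp hφ).clm_comp (hφ.fderiv_right (by simp))

/-- The second derivative of φ is symmetric, so it drops out of the antisymmetrized derivative. -/
theorem curv_pull {φ : W' → W} {θ : W → W →L[ℝ] EG} (hφ : ContDiff ℝ ∞ φ)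
    (hθ : ContDiff ℝ ∞ θ) (w u v : W') :
    curv G (pull φ θ) w u v = curv G θ (φ w) (fderiv ℝ φ w u) (fderiv ℝ φ w v) := by
  have hd : HasFDerivAt φ (fderiv ℝ φ w) w := (hφ.differentiable (by simp) w).hasFDerivAt
  have h1 := (hθ.differentiable (by simp) (φ w)).hasFDerivAt.comp w hd
  have h2 : HasFDerivAt (fderiv ℝ φ) (fderiv ℝ (fderiv ℝ φ) w) w :=
    ((hφ.fderiv_right (m := ∞) (by simp)).differentiable (by simp) w).hasFDerivAt
  have hsymm : fderiv ℝ (fderiv ℝ φ) w u v = fderiv ℝ (fderiv ℝ φ) w v u :=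
    (hφ.contDiffAt.isSymmSndFDerivAt (by
      simp only [minSmoothness_of_isRCLikeNormedField]; exact ENat.LEInfty.out)).eq u v
  have h3 : fderiv ℝ (pull φ θ) w = _ := (h1.clm_comp h2).fderiv
  simp only [curv_apply, h3]
  simp [pull, hsymm]

/-- The form `∑ t_j θ_j` on `Δ_p × W`. -/
def simpForm (θ : Fin (p + 1) → W → W →L[ℝ] EG) (z : (Fin p → ℝ) × W) :
    (Fin p → ℝ) × W →L[ℝ] EG :=
  ∑ j, bary z.1 j • (θ j z.2).comp (ContinuousLinearMap.snd ℝ (Fin p → ℝ) W)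

theorem contDiff_bary (j : Fin (p + 1)) : ContDiff ℝ ∞ fun t : Fin p → ℝ ↦ bary t j := by
  refine Fin.cases ?_ (fun i ↦ ?_) j
  · simp only [bary, Fin.cons_zero]; fun_prop
  · simp only [bary, Fin.cons_succ]; fun_prop

theorem contDiff_simpForm {θ : Fin (p + 1) → W → W →L[ℝ] EG} (hθ : ∀ j, ContDiff ℝ ∞ (θ j)) :
    ContDiff ℝ ∞ (simpForm θ) :=
  ContDiff.sum fun j _ ↦ ((contDiff_bary j).comp contDiff_fst).smul
    (((hθ j).comp contDiff_snd).clm_comp contDiff_const)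

theorem simpForm_pull {φ : W' → W} (hφ : ContDiff ℝ ∞ φ) (θ : Fin (p + 1) → W → W →L[ℝ] EG) :
    simpForm (fun j ↦ pull φ (θ j)) = pull (Prod.map id φ) (simpForm θ) := by
  funext z
  have h : fderiv ℝ (Prod.map (id : (Fin p → ℝ) → _) φ) z =
      (ContinuousLinearMap.id ℝ _).prodMap (fderiv ℝ φ z.2) :=
    ((hasFDerivAt_id z.1).prodMap z (hφ.differentiable (by simp) z.2).hasFDerivAt).fderiv
  ext x <;> simp [simpForm, pull, h, sum_apply]

/-- On the j-th face the coordinate t_j is zero, so θ_j disappears. This is what makes the boundary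
terms of Stokes match the face maps of the nerve. -/
theorem simpForm_face (j : Fin (p + 2)) (θ : Fin (p + 2) → W → W →L[ℝ] EG) :
    pull (Prod.map (faceMap j) id) (simpForm θ) = simpForm fun i ↦ θ (j.succAbove i) := by
  funext z
  obtain ⟨L, hL, -⟩ := hasFDerivAt_faceMap j z.1
  have h : fderiv ℝ (Prod.map (faceMap j) (id : W → W)) z =
      L.prodMap (ContinuousLinearMap.id ℝ _) := (hL.prodMap z (hasFDerivAt_id z.2)).fderiv
  ext x <;> simp [simpForm, pull, h, sum_apply, Fin.sum_univ_succAbove _ j, bary_faceMap_same,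
    bary_faceMap_succAbove]

theorem contDiff_faceMap (j : Fin (p + 2)) : ContDiff ℝ ∞ (faceMap (p := p) j) := by
  refine contDiff_pi.2 fun i ↦ ?_
  refine Fin.cases ?_ (fun a ↦ ?_) j
  · exact contDiff_bary i
  · refine Fin.succAboveCases a ?_ (fun i ↦ ?_) i
    · simpa [faceMap] using contDiff_const
    · simpa [faceMap] using! contDiff_apply ℝ ℝ i

/-- A gauge transformation is affine in θ and the t_j add up to 1, so the inhomogeneous term g⁻¹dg
is counted exactly once. -/
theorem simpForm_gauge [LieGroup 𝓘(ℝ, EG) ∞ G] (θ : Fin (p + 1) → W → W →L[ℝ] EG) {g : W → G}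
    (hg : ContMDiff 𝓘(ℝ, W) 𝓘(ℝ, EG) ∞ g) :
    simpForm (fun j ↦ gauge (θ j) g) = gauge (simpForm θ) (fun z ↦ g z.2) := by
  funext z
  have hm : (mcForm (fun z : (Fin p → ℝ) × W ↦ g z.2) z : (Fin p → ℝ) × W →L[ℝ] EG) =
      (mcForm g z.2).comp (ContinuousLinearMap.snd ℝ (Fin p → ℝ) W) := by
    have h1 : MDifferentiableAt 𝓘(ℝ, W) 𝓘(ℝ, EG) (fun y ↦ (g z.2)⁻¹ * g y) z.2 :=
      (((contMDiff_mul_left (n := ∞) (a := (g z.2)⁻¹)).comp hg).mdifferentiable (by simp)) z.2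
    exact (HasMFDerivAt.comp (f := fun z : (Fin p → ℝ) × W ↦ z.2) z h1.hasMFDerivAt
      (hasFDerivAt_snd (𝕜 := ℝ)).hasMFDerivAt).mfderiv
  ext x <;> simp only [simpForm, gauge, hm, sum_apply, smul_apply, smul_add, add_apply,
    ContinuousLinearMap.comp_apply, Finset.sum_add_distrib, ← Finset.sum_smul, sum_bary, one_smul,
    map_sum, map_smul]

end Pull

/-! ### Integrals of f(Ω) over the simplex and the cocycle identity. -/

section Transgression

variable {EG : Type*} [NormedAddCommGroup EG] [NormedSpace ℝ EG]
  {G : Type*} [TopologicalSpace G] [ChartedSpace EG G] [Group G]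
  {W W' : Type*} [NormedAddCommGroup W] [NormedSpace ℝ W] [FiniteDimensional ℝ W]
  [NormedAddCommGroup W'] [NormedSpace ℝ W'] [FiniteDimensional ℝ W']
  {k p q : ℕ}

/-- The form `f(Ω)` on `Δ_p × W`, where `Ω` is the curvature of `∑ t_j θ_j`. -/
def simpChern (f : InvPoly EG G k) (θ : Fin (p + 1) → W → W →L[ℝ] EG) (z : (Fin p → ℝ) × W) :
    ((Fin p → ℝ) × W) [⋀^Fin (2 * k)]→L[ℝ] ℝ :=
  chernForm f.1 (curv G (simpForm θ) z)

theorem contDiff_simpChern (f : InvPoly EG G k) {θ : Fin (p + 1) → W → W →L[ℝ] EG}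
    (hθ : ∀ j, ContDiff ℝ ∞ (θ j)) : ContDiff ℝ ∞ (simpChern f θ) :=
  contDiff_chernForm f.1 (contDiff_curv (contDiff_simpForm hθ))

theorem simpChern_pull (f : InvPoly EG G k) {θ : Fin (p + 1) → W → W →L[ℝ] EG}
    (hθ : ∀ j, ContDiff ℝ ∞ (θ j)) {φ : W' → W} (hφ : ContDiff ℝ ∞ φ) (t : Fin p → ℝ) (w : W')
    (v : Fin (2 * k) → (Fin p → ℝ) × W') :
    simpChern f (fun j ↦ pull φ (θ j)) (t, w) v =
      simpChern f θ (t, φ w) fun i ↦ Prod.map id (fderiv ℝ φ w) (v i) := by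
  have h : fderiv ℝ (Prod.map (id : (Fin p → ℝ) → _) φ) (t, w) =
      (ContinuousLinearMap.id ℝ _).prodMap (fderiv ℝ φ w) :=
    ((hasFDerivAt_id t).prodMap (t, w) (hφ.differentiable (by simp) w).hasFDerivAt).fderiv
  simp only [simpChern, chernForm_apply, simpForm_pull hφ,
    curv_pull (contDiff_id.prodMap hφ) (contDiff_simpForm hθ), h]
  rfl

theorem simpChern_face (f : InvPoly EG G k) (j : Fin (p + 2)) {θ : Fin (p + 2) → W → W →L[ℝ] EG}
    (hθ : ∀ j, ContDiff ℝ ∞ (θ j)) (t : Fin p → ℝ) (w : W) (h : p + q = 2 * k) (v : Fin q → W) :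
    simpChern f θ (faceMap j t, w) (fiberVec (faceVec j) h v) =
      simpChern f (fun i ↦ θ (j.succAbove i)) (t, w) (fiberVec (stdE p) h v) := by
  obtain ⟨L, hL, hLe⟩ := hasFDerivAt_faceMap j t
  have hd : fderiv ℝ (Prod.map (faceMap j) (id : W → W)) (t, w) =
      L.prodMap (ContinuousLinearMap.id ℝ _) := (hL.prodMap (t, w) (hasFDerivAt_id w)).fderiv
  have hv : fiberVec (faceVec j) h v =
      fun i ↦ Prod.map L id (fiberVec (stdE p) h v i) := by
    funext i
    rw [map_fiberVec L id (map_zero L) rfl]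
    have : L ∘ stdE p = faceVec j := funext hLe
    rw [this]; rfl
  simp only [simpChern, chernForm_apply, ← simpForm_face,
    curv_pull ((contDiff_faceMap j).prodMap contDiff_id) (contDiff_simpForm hθ), hd, hv]
  rfl

variable [LieGroup 𝓘(ℝ, EG) ∞ G]

theorem simpChern_gauge (f : InvPoly EG G k) {θ : Fin (p + 1) → W → W →L[ℝ] EG}
    (hθ : ∀ j, ContDiff ℝ ∞ (θ j)) {g : W → G} (hg : ContMDiff 𝓘(ℝ, W) 𝓘(ℝ, EG) ∞ g)
    (hτ : ∀ j, ContDiff ℝ ∞ (gauge (θ j) g)) :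
    simpChern f (fun j ↦ gauge (θ j) g) = simpChern f θ := by
  funext z
  ext v
  rw [simpChern, simpChern, chernForm_apply, chernForm_apply]
  refine evalPoly_Ad f (g z.2)⁻¹ (fun x y ↦ ?_) v
  refine curv_gauge (g := fun z ↦ g z.2) ((contDiff_simpForm hθ).differentiable (by simp) z)
    ((contDiff_simpForm hτ).differentiable (by simp) z) ?_ ?_ x y
  · exact ((hg.comp contDiff_snd.contMDiff).of_le (by exact ENat.LEInfty.out)).contMDiffAt
  · rw [simpForm_gauge θ hg]
    exact Filter.Eventually.of_forall fun y ↦ rfl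

variable [CompleteSpace EG]

theorem extDeriv_simpChern (f : InvPoly EG G k) {θ : Fin (p + 1) → W → W →L[ℝ] EG}
    (hθ : ∀ j, ContDiff ℝ ∞ (θ j)) (z : (Fin p → ℝ) × W) : extDeriv (simpChern f θ) z = 0 :=
  extDeriv_chernForm_curv (contDiff_simpForm hθ) f z

/-- The integral of `f(Ω)` over `Δ_p`, where `Ω` is the curvature of `∑ t_j θ_j`. -/
def transgress (f : InvPoly EG G k) (θ : Fin (p + 1) → W → W →L[ℝ] EG) (h : p + q = 2 * k) :
    W → W [⋀^Fin q]→L[ℝ] ℝ :=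
  fiberInt volume (simplex p) (stdE p) h (simpChern f θ)

theorem contDiff_transgress (f : InvPoly EG G k) {θ : Fin (p + 1) → W → W →L[ℝ] EG}
    (hθ : ∀ j, ContDiff ℝ ∞ (θ j)) (h : p + q = 2 * k) : ContDiff ℝ ∞ (transgress f θ h) :=
  contDiff_fiberInt volume (isCompact_simplex p) _ h (contDiff_simpChern f hθ)

theorem transgress_apply (f : InvPoly EG G k) {θ : Fin (p + 1) → W → W →L[ℝ] EG}
    (hθ : ∀ j, ContDiff ℝ ∞ (θ j)) (h : p + q = 2 * k) (w : W) (v : Fin q → W) :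
    transgress f θ h w v = ∫ t in simplex p, simpChern f θ (t, w) (fiberVec (stdE p) h v) :=
  fiberInt_apply volume (isCompact_simplex p) _ h (contDiff_simpChern f hθ) w v

theorem transgress_pull (f : InvPoly EG G k) {θ : Fin (p + 1) → W → W →L[ℝ] EG}
    (hθ : ∀ j, ContDiff ℝ ∞ (θ j)) {φ : W' → W} (hφ : ContDiff ℝ ∞ φ) (h : p + q = 2 * k) (w : W')
    (v : Fin q → W') :
    transgress f (fun j ↦ pull φ (θ j)) h w v =
      transgress f θ h (φ w) fun i ↦ fderiv ℝ φ w (v i) := by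
  rw [transgress_apply f (fun j ↦ contDiff_pull hφ (hθ j)), transgress_apply f hθ]
  simp only [simpChern_pull f hθ hφ, map_fiberVec id (fderiv ℝ φ w) rfl (map_zero (fderiv ℝ φ w))]
  rfl

theorem transgress_gauge (f : InvPoly EG G k) {θ : Fin (p + 1) → W → W →L[ℝ] EG}
    (hθ : ∀ j, ContDiff ℝ ∞ (θ j)) {g : W → G} (hg : ContMDiff 𝓘(ℝ, W) 𝓘(ℝ, EG) ∞ g)
    (hτ : ∀ j, ContDiff ℝ ∞ (gauge (θ j) g)) (h : p + q = 2 * k) :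
    transgress f (fun j ↦ gauge (θ j) g) h = transgress f θ h := by
  rw [transgress, transgress, simpChern_gauge f hθ hg hτ]

theorem setIntegral_simpChern_face (f : InvPoly EG G k) {θ : Fin (p + 2) → W → W →L[ℝ] EG}
    (hθ : ∀ j, ContDiff ℝ ∞ (θ j)) (h : p + q = 2 * k) (w : W) (v : Fin q → W) :
    ∑ a : Fin (p + 1), (-1 : ℝ) ^ (a : ℕ) * ∫ t in simplex (p + 1), fderiv ℝ (fun z ↦
        simpChern f θ z (fiberVec (a.removeNth (stdE (p + 1))) h v)) (t, w) (stdE (p + 1) a, 0) =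
      ∑ j : Fin (p + 2), (-1 : ℝ) ^ (j : ℕ) *
        transgress f (fun i ↦ θ (j.succAbove i)) h w v := by
  rw [setIntegral_simplex_boundary h (contDiff_simpChern f hθ)]
  simp only [simpChern_face f _ hθ, transgress_apply f (fun i ↦ hθ _)]

/-- Integrate d f(Ω) = 0 over Δ_{p+1}: the derivatives along W give the exterior derivative of the
integral, those along the simplex give its faces by Stokes. -/
theorem extDeriv_transgress_succ (f : InvPoly EG G k) {θ : Fin (p + 2) → W → W →L[ℝ] EG}
    (hθ : ∀ j, ContDiff ℝ ∞ (θ j)) (h : p + 1 + q = 2 * k) (h' : p + (q + 1) = 2 * k) (w : W)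
    (v : Fin (q + 1) → W) :
    (-1 : ℝ) ^ (p + 1) * extDeriv (transgress f θ h) w v + ∑ j : Fin (p + 2), (-1 : ℝ) ^ (j : ℕ) *
        transgress f (fun i ↦ θ (j.succAbove i)) h' w v = 0 := by
  have h1 : p + 1 + (q + 1) = 2 * k + 1 := by omega
  have e := extDeriv_fiberInt_eq volume (isCompact_simplex (p + 1)) (stdE (p + 1)) h h1
    (contDiff_simpChern f hθ) w v
  simp only [extDeriv_simpChern f hθ, removeNth_fiberVec_left (stdE (p + 1)) h' h1] at e
  rw [setIntegral_simpChern_face f hθ h'] at e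
  rw [add_comm]
  exact e.symm.trans (by simp)

/-- The end p = 0 of the cocycle identity: a point has no faces. -/
theorem extDeriv_transgress_zero (f : InvPoly EG G k) {θ : Fin 1 → W → W →L[ℝ] EG}
    (hθ : ∀ j, ContDiff ℝ ∞ (θ j)) (h : 0 + q = 2 * k) (w : W) (v : Fin (q + 1) → W) :
    extDeriv (transgress f θ h) w v = 0 := by
  have h1 : 0 + (q + 1) = 2 * k + 1 := by omega
  have e := extDeriv_fiberInt_eq volume (isCompact_simplex 0) (stdE 0) h h1
    (contDiff_simpChern f hθ) w v
  simp only [extDeriv_simpChern f hθ, Finset.univ_eq_empty (α := Fin 0), Finset.sum_empty, pow_zero,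
    one_mul, zero_add] at e
  exact e.symm.trans (by simp)

/-- The end q = 0: d f(Ω) is evaluated on simplex directions only, so no derivative along W occurs.
-/
theorem sum_transgress_eq_zero (f : InvPoly EG G k) {θ : Fin (p + 2) → W → W →L[ℝ] EG}
    (hθ : ∀ j, ContDiff ℝ ∞ (θ j)) (h : p + 0 = 2 * k) (w : W) (v : Fin 0 → W) :
    ∑ j : Fin (p + 2), (-1 : ℝ) ^ (j : ℕ) *
        transgress f (fun i ↦ θ (j.succAbove i)) h w v = 0 := by
  have h1 : p + 1 + 0 = 2 * k + 1 := by omega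
  have e := integral_extDeriv_fiberVec volume (isCompact_simplex (p + 1)) (stdE (p + 1)) h1
    (contDiff_simpChern f hθ) w v
  simp only [extDeriv_simpChern f hθ, removeNth_fiberVec_left (stdE (p + 1)) h h1] at e
  rw [setIntegral_simpChern_face f hθ h] at e
  exact e.symm.trans (by simp)

end Transgression

/-! ### The homotopy between two families of 1-forms. -/

section Homotopy

variable {EG : Type*} [NormedAddCommGroup EG] [NormedSpace ℝ EG] [CompleteSpace EG]
  {G : Type*} [TopologicalSpace G] [ChartedSpace EG G] [Group G] [LieGroup 𝓘(ℝ, EG) ∞ G]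
  {W W' : Type*} [NormedAddCommGroup W] [NormedSpace ℝ W] [FiniteDimensional ℝ W]
  [NormedAddCommGroup W'] [NormedSpace ℝ W'] [FiniteDimensional ℝ W']
  {k p q : ℕ}

/-- The homotopies between two families of `1`-forms, as forms on `Δ_1 × W`. -/
def linHomotopy (θ : Fin 2 → Fin (p + 1) → W → W →L[ℝ] EG) (j : Fin (p + 1)) :
    (Fin 1 → ℝ) × W → (Fin 1 → ℝ) × W →L[ℝ] EG :=
  simpForm fun i ↦ θ i j

/-- The integral over `Δ_1` of the transgression of the homotopy. -/
def transgress₂ (f : InvPoly EG G k) (θ : Fin 2 → Fin (p + 1) → W → W →L[ℝ] EG)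
    (h : p + (q + 1) = 2 * k) : W → W [⋀^Fin q]→L[ℝ] ℝ :=
  fiberInt volume (simplex 1) (stdE 1) (add_comm 1 q) (transgress f (linHomotopy θ) h)

variable {θ : Fin 2 → Fin (p + 1) → W → W →L[ℝ] EG}

theorem contDiff_linHomotopy (hθ : ∀ i j, ContDiff ℝ ∞ (θ i j)) (j : Fin (p + 1)) :
    ContDiff ℝ ∞ (linHomotopy θ j) := contDiff_simpForm fun i ↦ hθ i j

theorem contDiff_transgress₂ (f : InvPoly EG G k) (hθ : ∀ i j, ContDiff ℝ ∞ (θ i j))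
    (h : p + (q + 1) = 2 * k) : ContDiff ℝ ∞ (transgress₂ f θ h) :=
  contDiff_fiberInt volume (isCompact_simplex 1) _ _
    (contDiff_transgress f (contDiff_linHomotopy hθ) h)

theorem transgress₂_apply (f : InvPoly EG G k) (hθ : ∀ i j, ContDiff ℝ ∞ (θ i j))
    (h : p + (q + 1) = 2 * k) (w : W) (v : Fin q → W) :
    transgress₂ f θ h w v = ∫ t in simplex 1,
      transgress f (linHomotopy θ) h (t, w) (fiberVec (stdE 1) (add_comm 1 q) v) :=
  fiberInt_apply volume (isCompact_simplex 1) _ _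
    (contDiff_transgress f (contDiff_linHomotopy hθ) h) w v

theorem transgress₂_pull (f : InvPoly EG G k) (hθ : ∀ i j, ContDiff ℝ ∞ (θ i j)) {φ : W' → W}
    (hφ : ContDiff ℝ ∞ φ) (h : p + (q + 1) = 2 * k) (w : W') (v : Fin q → W') :
    transgress₂ f (fun i j ↦ pull φ (θ i j)) h w v =
      transgress₂ f θ h (φ w) fun i ↦ fderiv ℝ φ w (v i) := by
  have hd : ∀ t, fderiv ℝ (Prod.map (id : (Fin 1 → ℝ) → _) φ) (t, w) =
      (ContinuousLinearMap.id ℝ _).prodMap (fderiv ℝ φ w) := fun t ↦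
    ((hasFDerivAt_id t).prodMap (t, w) (hφ.differentiable (by simp) w).hasFDerivAt).fderiv
  have hl : linHomotopy (fun i j ↦ pull φ (θ i j)) =
      fun j ↦ pull (Prod.map id φ) (linHomotopy θ j) :=
    funext fun j ↦ simpForm_pull hφ fun i ↦ θ i j
  rw [transgress₂_apply f (fun i j ↦ contDiff_pull hφ (hθ i j)), transgress₂_apply f hθ, hl]
  simp only [transgress_pull f (contDiff_linHomotopy hθ) (contDiff_id.prodMap hφ), hd]
  refine integral_congr_ae (Filter.Eventually.of_forall fun t ↦ ?_)
  refine congrArg (transgress f (linHomotopy θ) h (t, φ w)) (funext fun i ↦ ?_)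
  exact map_fiberVec (U := Fin 1 → ℝ) (W := W') id (fderiv ℝ φ w) rfl (map_zero (fderiv ℝ φ w)) (stdE 1)
    (add_comm 1 q) v i

theorem transgress₂_gauge (f : InvPoly EG G k) (hθ : ∀ i j, ContDiff ℝ ∞ (θ i j)) {g : W → G}
    (hg : ContMDiff 𝓘(ℝ, W) 𝓘(ℝ, EG) ∞ g) (hτ : ∀ i j, ContDiff ℝ ∞ (gauge (θ i j) g))
    (h : p + (q + 1) = 2 * k) :
    transgress₂ f (fun i j ↦ gauge (θ i j) g) h = transgress₂ f θ h := by
  have hl : linHomotopy (fun i j ↦ gauge (θ i j) g) =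
      fun j ↦ gauge (linHomotopy θ j) (fun z ↦ g z.2) :=
    funext fun j ↦ simpForm_gauge (fun i ↦ θ i j) hg
  rw [transgress₂, transgress₂, hl, transgress_gauge (g := fun z ↦ g z.2) f
    (contDiff_linHomotopy hθ) (hg.comp contDiff_snd.contMDiff)]
  exact fun j ↦ congrFun hl j ▸ contDiff_linHomotopy hτ j

/-- Restricting the linear homotopy to an end of Δ_1 leaves one of the two families; the face j
omits the vertex j and so keeps the other one. -/
theorem transgress_linHomotopy_face (f : InvPoly EG G k) (hθ : ∀ i j, ContDiff ℝ ∞ (θ i j))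
    (h : p + q = 2 * k) (j : Fin 2) (s : Fin 0 → ℝ) (w : W) (v : Fin q → W) :
    transgress f (linHomotopy θ) h (faceMap j s, w) (fiberVec (faceVec j) (zero_add q) v) =
      transgress f (θ (j.succAbove 0)) h w v := by
  have hφ : ContDiff ℝ ∞ fun w : W ↦ (faceMap j s, w) := contDiff_prodMk_right _
  have hd : ∀ w, fderiv ℝ (fun w : W ↦ (faceMap j s, w)) w = .inr ℝ _ W := fun w ↦
    (hasFDerivAt_prodMk_right (faceMap j s) w).fderiv
  have hp : θ (j.succAbove 0) = fun i ↦ pull (fun w : W ↦ (faceMap j s, w)) (linHomotopy θ i) := by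
    funext i w
    ext x
    have h0 : bary s 0 = 1 := by simp [bary]
    simp [pull, hd, linHomotopy, simpForm, Fin.sum_univ_succAbove _ j, bary_faceMap_same,
      bary_faceMap_succAbove, h0]
  rw [hp, transgress_pull f (contDiff_linHomotopy hθ) hφ]
  congr 1
  funext i
  rw [hd, fiberVec_eq, dif_neg (by omega)]
  rfl

theorem sum_transgress_linHomotopy (f : InvPoly EG G k) (hθ : ∀ i j, ContDiff ℝ ∞ (θ i j))
    (h : p + q = 2 * k) (w : W) (v : Fin q → W) :
    ∑ a : Fin 1, (-1 : ℝ) ^ (a : ℕ) * ∫ t in simplex 1, fderiv ℝ (fun z ↦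
        transgress f (linHomotopy θ) h z (fiberVec (a.removeNth (stdE 1)) (zero_add q) v))
          (t, w) (stdE 1 a, 0) =
      transgress f (θ 1) h w v - transgress f (θ 0) h w v := by
  rw [setIntegral_simplex_boundary (zero_add q)
    (contDiff_transgress f (contDiff_linHomotopy hθ) h)]
  simp only [transgress_linHomotopy_face f hθ]
  have hv : volume.real (simplex 0) = 1 := by
    have : simplex 0 = Set.univ := Set.eq_univ_of_forall fun t ↦ mem_simplex.2 (by simp)
    rw [this]
    simp [Measure.real, volume_pi]
  rw [Fin.sum_univ_two]
  simp [hv]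
  ring

theorem extDeriv_transgress₂_zero (f : InvPoly EG G k) {θ : Fin 2 → Fin 1 → W → W →L[ℝ] EG}
    (hθ : ∀ i j, ContDiff ℝ ∞ (θ i j)) (h : 0 + (q + 1) = 2 * k) (w : W) (v : Fin (q + 1) → W) :
    extDeriv (transgress₂ f θ h) w v = transgress f (θ 1) h w v - transgress f (θ 0) h w v := by
  have h1 : 1 + (q + 1) = q + 1 + 1 := by omega
  have hc := contDiff_linHomotopy hθ
  have e := extDeriv_fiberInt_eq volume (isCompact_simplex 1) (stdE 1) (add_comm 1 q) h1
    (contDiff_transgress f hc h) w v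
  simp only [extDeriv_transgress_zero f hc h, removeNth_fiberVec_left (stdE 1) (zero_add (q + 1)) h1,
    sum_transgress_linHomotopy f hθ h] at e
  rw [integral_zero] at e
  rw [transgress₂]
  linarith

/-- The cocycle identity on the larger parameter space Δ_1 × W, solved for the exterior derivative
and integrated over Δ_1. -/
theorem extDeriv_transgress_linHomotopy (f : InvPoly EG G k)
    {θ : Fin 2 → Fin (p + 2) → W → W →L[ℝ] EG} (hθ : ∀ i j, ContDiff ℝ ∞ (θ i j))
    (h : p + 1 + q = 2 * k) (h' : p + (q + 1) = 2 * k) (w : W) (v : Fin q → W)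
    (h1 : 1 + q = q + 1) :
    ∫ t in simplex 1, extDeriv (transgress f (linHomotopy θ) h) (t, w) (fiberVec (stdE 1) h1 v) =
      ∑ j : Fin (p + 2), (-1 : ℝ) ^ (j : ℕ) *
        ((-1) ^ p * transgress₂ f (fun i l ↦ θ i (j.succAbove l)) h' w v) := by
  have hc := contDiff_linHomotopy hθ
  have hX : ∀ z u, extDeriv (transgress f (linHomotopy θ) h) z u = ∑ j : Fin (p + 2),
      (-1 : ℝ) ^ (j : ℕ) * ((-1) ^ p *
        transgress f (linHomotopy fun i l ↦ θ i (j.succAbove l)) h' z u) := by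
    intro z u
    have e : (-1 : ℝ) ^ (p + 1) * extDeriv (transgress f (linHomotopy θ) h) z u +
        ∑ j : Fin (p + 2), (-1 : ℝ) ^ (j : ℕ) *
          transgress f (linHomotopy fun i l ↦ θ i (j.succAbove l)) h' z u = 0 :=
      extDeriv_transgress_succ f hc h h' z u
    have e2 : extDeriv (transgress f (linHomotopy θ) h) z u = (-1) ^ p * ∑ j : Fin (p + 2),
        (-1 : ℝ) ^ (j : ℕ) * transgress f (linHomotopy fun i l ↦ θ i (j.succAbove l)) h' z u := by
      rw [pow_succ] at e
      rcases neg_one_pow_eq_or ℝ p with hp | hp <;> rw [hp] at e ⊢ <;> linarith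
    rw [e2, Finset.mul_sum]
    exact Finset.sum_congr rfl fun j _ ↦ mul_left_comm _ _ _
  simp only [hX, transgress₂_apply f fun i l ↦ hθ i _]
  rw [integral_finsetSum]
  · simp only [integral_const_mul]
  · intro j _
    refine ContinuousOn.integrableOn_compact (isCompact_simplex 1) (Continuous.continuousOn ?_)
    refine continuous_const.mul (continuous_const.mul ?_)
    exact ((contDiff_apply_vec (contDiff_transgress f (contDiff_linHomotopy fun i l ↦ hθ i _) h')
      _).continuous).comp (Continuous.prodMk_left w)

/-- Compare two values of the integral over Δ_1 of the exterior derivative of the transgression: by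
Stokes on Δ_1 it yields the difference of the two ends, by the cocycle identity it yields the faces
of Δ_{p+1}. -/
theorem extDeriv_transgress₂_succ (f : InvPoly EG G k)
    {θ : Fin 2 → Fin (p + 2) → W → W →L[ℝ] EG}
    (hθ : ∀ i j, ContDiff ℝ ∞ (θ i j)) (h : p + 1 + (q + 1) = 2 * k) (h' : p + (q + 1 + 1) = 2 * k)
    (w : W) (v : Fin (q + 1) → W) :
    extDeriv (transgress₂ f θ h) w v + ∑ j : Fin (p + 2), (-1 : ℝ) ^ (j : ℕ) *
        ((-1) ^ p * transgress₂ f (fun i l ↦ θ i (j.succAbove l)) h' w v) =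
      transgress f (θ 1) h w v - transgress f (θ 0) h w v := by
  have h1 : 1 + (q + 1) = q + 1 + 1 := by omega
  have e := extDeriv_fiberInt_eq volume (isCompact_simplex 1) (stdE 1) (add_comm 1 q) h1
    (contDiff_transgress f (contDiff_linHomotopy hθ) h) w v
  simp only [removeNth_fiberVec_left (stdE 1) (zero_add (q + 1)) h1,
    sum_transgress_linHomotopy f hθ h] at e
  rw [extDeriv_transgress_linHomotopy f hθ h h' w v h1] at e
  rw [e, transgress₂]
  ring

theorem sum_transgress₂ (f : InvPoly EG G k)
    {θ : Fin 2 → Fin (p + 2) → W → W →L[ℝ] EG}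
    (hθ : ∀ i j, ContDiff ℝ ∞ (θ i j)) (h : p + 1 + 0 = 2 * k) (h' : p + (0 + 1) = 2 * k)
    (w : W) (v : Fin 0 → W) :
    ∑ j : Fin (p + 2), (-1 : ℝ) ^ (j : ℕ) *
        ((-1) ^ p * transgress₂ f (fun i l ↦ θ i (j.succAbove l)) h' w v) =
      transgress f (θ 1) h w v - transgress f (θ 0) h w v := by
  have h1 : 1 + 0 = 0 + 1 := rfl
  have e := integral_extDeriv_fiberVec volume (isCompact_simplex 1) (stdE 1) h1
    (contDiff_transgress f (contDiff_linHomotopy hθ) h) w v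
  simp only [removeNth_fiberVec_left (stdE 1) (zero_add 0) h1,
    sum_transgress_linHomotopy f hθ h] at e
  rw [extDeriv_transgress_linHomotopy f hθ h h' w v h1] at e
  exact e

end Homotopy

/-! ### Locality of forms and descent along maps with local lifts. -/

section Descent

variable {V : Type*} [NormedAddCommGroup V] [NormedSpace ℝ V]

/-- Smooth maps into a given neighbourhood of a point that are the identity near the point. -/
theorem exists_localization {n : ℕ} (x : Euc n) {s : Set (Euc n)} (hs : s ∈ 𝓝 x) :
    ∃ κ : Euc n → Euc n, ContDiff ℝ ∞ κ ∧ (∀ y, κ y ∈ s) ∧ ∀ᶠ y in 𝓝 x, κ y = y := by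
  obtain ⟨ε, hε, hs⟩ := Metric.mem_nhds_iff.1 hs
  -- The map y ↦ x + χ(y)(y - x) is the identity where χ = 1, is constant x outside the ball of
  -- radius ε/2, and moves no point farther than ε/2 from x in between. It turns local data into
  -- plots defined on all of ℝⁿ.
  let χ : ContDiffBump x := ⟨ε / 4, ε / 2, by positivity, by linarith⟩
  refine ⟨fun y ↦ x + χ y • (y - x), ?_, fun y ↦ hs ?_, ?_⟩
  · exact contDiff_const.add (χ.contDiff.smul (contDiff_id.sub contDiff_const))
  · rw [Metric.mem_ball, dist_eq_norm, add_sub_cancel_left, norm_smul, Real.norm_of_nonneg χ.nonneg]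
    by_cases h : dist y x < ε / 2
    · rw [dist_eq_norm] at h
      have := mul_le_of_le_one_left (norm_nonneg (y - x)) (χ.le_one (x := y))
      linarith
    · rw [χ.zero_of_le_dist (not_lt.1 h), zero_mul]; exact hε
  · filter_upwards [χ.eventuallyEq_one] with y hy
    rw [hy]; simp

variable {X Y : Type*} {DX : DiffeologicalSpace X} {DY : DiffeologicalSpace Y} {k : ℕ}

theorem Form.ext_on {η η' : Form DX V k}
    (h : ∀ n (φ : Euc n → X) (hφ : IsPlot φ) x, η.on φ hφ x = η'.on φ hφ x) : η = η' :=
  Subtype.ext (funext fun n ↦ funext fun φ ↦ funext fun x ↦ h n φ.1 φ.2 x)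

theorem Form.on_congr (η : Form DX V k) {n : ℕ} {φ φ' : Euc n → X} (hφ : IsPlot φ)
    (h : φ = φ') : η.on φ hφ = η.on φ' (h ▸ hφ) := by
  subst h; rfl

theorem Form.contDiff_on (η : Form DX V k) {n : ℕ} {φ : Euc n → X} (hφ : IsPlot φ) :
    ContDiff ℝ ∞ (η.on φ hφ) := η.2.1 n ⟨φ, hφ⟩

theorem Form.on_comp (η : Form DX V k) {m n : ℕ} {φ : Euc n → X} (hφ : IsPlot φ)
    {h : Euc m → Euc n} (hh : ContDiff ℝ ∞ h) (x : Euc m) :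
    η.on (φ ∘ h) (isPlot_reparam hφ hh) x =
      (η.on φ hφ (h x)).compContinuousLinearMap (fderiv ℝ h x) :=
  η.2.2 m n ⟨φ, hφ⟩ h hh x

theorem Form.on_comp_localization (η : Form DX V k) {n : ℕ} {φ : Euc n → X} (hφ : IsPlot φ)
    {κ : Euc n → Euc n} (hκ : ContDiff ℝ ∞ κ) {x : Euc n} (h : ∀ᶠ y in 𝓝 x, κ y = y) :
    η.on (φ ∘ κ) (isPlot_reparam hφ hκ) x = η.on φ hφ x := by
  have hd : fderiv ℝ κ x = ContinuousLinearMap.id ℝ _ :=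
    (Filter.EventuallyEq.fderiv_eq (f := id) h).trans fderiv_id
  rw [η.on_comp hφ hκ, hd, h.self_of_nhds]
  ext v; rfl

/-- Values of forms are local. -/
theorem Form.on_congr_nhds (η : Form DX V k) {n : ℕ} {φ φ' : Euc n → X} (hφ : IsPlot φ)
    (hφ' : IsPlot φ') {x : Euc n} (h : ∀ᶠ y in 𝓝 x, φ y = φ' y) : η.on φ hφ x = η.on φ' hφ' x := by
  obtain ⟨κ, hκ, hs, he⟩ := exists_localization x h
  rw [← η.on_comp_localization hφ hκ he, ← η.on_comp_localization hφ' hκ he]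
  exact congrFun (η.on_congr _ (funext hs)) x

/-- Every smooth family in the target lifts locally. -/
def HasLocalLifts (DX : DiffeologicalSpace X) (DY : DiffeologicalSpace Y) (f : X → Y) : Prop :=
  ∀ (n : ℕ) (φ : Euc n → Y), IsPlot φ → ∀ x, ∃ ψ : Euc n → X, IsPlot ψ ∧ ∀ᶠ y in 𝓝 x, f (ψ y) = φ y

/-- The value of a form on a plot at a point depends only on the germ of the plot, and every germ
lifts. -/
theorem pullback_injective {f : X → Y} (hf : DSmooth f) (hl : HasLocalLifts DX DY f) :
    Function.Injective (pullback (V := V) f hf k) := by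
  intro ζ ζ' h
  refine Form.ext_on fun n φ hφ x ↦ ?_
  obtain ⟨ψ, hψ, he⟩ := hl n φ hφ x
  rw [← ζ.on_congr_nhds (hf n ψ hψ) hφ he, ← ζ'.on_congr_nhds (hf n ψ hψ) hφ he]
  exact congrArg (fun η : Form DX V k ↦ η.on ψ hψ x) h

/-- A form descends if it takes the same values on smooth families with the same image. -/
theorem exists_pullback_eq {f : X → Y} (hf : DSmooth f) (hl : HasLocalLifts DX DY f)
    (η : Form DX V k) (hη : ∀ n (ψ ψ' : Euc n → X) (hψ : IsPlot ψ) (hψ' : IsPlot ψ'),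
      (∀ y, f (ψ y) = f (ψ' y)) → η.on ψ hψ = η.on ψ' hψ') :
    ∃ ζ : Form DY V k, pullback f hf k ζ = η := by
  -- At each point x the descended form takes the value of η on a local lift chosen for x. `key'`
  -- makes this independent of the lift, so near x one lift serves for all points and smoothness
  -- follows.
  choose L hL hLe using hl
  have key : ∀ n (ψ ψ' : Euc n → X) (hψ : IsPlot ψ) (hψ' : IsPlot ψ') (x : Euc n),
      (∀ᶠ y in 𝓝 x, f (ψ y) = f (ψ' y)) → η.on ψ hψ x = η.on ψ' hψ' x := by
    intro n ψ ψ' hψ hψ' x h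
    obtain ⟨κ, hκ, hs, he⟩ := exists_localization x h
    rw [← η.on_comp_localization hψ hκ he, ← η.on_comp_localization hψ' hκ he]
    exact congrFun (hη n _ _ _ _ hs) x
  have key' : ∀ n φ (hφ : IsPlot φ) (x : Euc n) (ψ : Euc n → X) (hψ : IsPlot ψ),
      (∀ᶠ y in 𝓝 x, f (ψ y) = φ y) → η.on (L n φ hφ x) (hL n φ hφ x) x = η.on ψ hψ x := by
    intro n φ hφ x ψ hψ h
    refine key n _ _ _ _ x ?_
    filter_upwards [h, hLe n φ hφ x] with y h1 h2
    rw [h1, h2]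
  refine ⟨⟨fun n φ x ↦ η.on (L n φ.1 φ.2 x) (hL n φ.1 φ.2 x) x, fun n φ ↦ ?_,
    fun m n φ h hh x ↦ ?_⟩, ?_⟩
  · refine contDiff_iff_contDiffAt.2 fun x ↦ ?_
    refine (η.contDiff_on (hL n φ.1 φ.2 x)).contDiffAt.congr_of_eventuallyEq ?_
    filter_upwards [(hLe n φ.1 φ.2 x).eventually_nhds] with y hy
    exact key' n φ.1 φ.2 y _ _ hy
  · refine (key' m _ _ x _ (isPlot_reparam (hL n φ.1 φ.2 (h x)) hh)
      (hh.continuous.continuousAt.eventually (hLe n φ.1 φ.2 (h x)))).trans ?_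
    exact η.on_comp _ hh x
  · refine Form.ext_on fun n ψ hψ x ↦ ?_
    exact key' n (f ∘ ψ) (hf n ψ hψ) x ψ hψ (Filter.Eventually.of_forall fun _ ↦ rfl)

/-- Descent of linear families of forms. -/
theorem exists_linear_descent {M : Type*} [AddCommMonoid M] [Module ℝ M] {f : X → Y} (hf : DSmooth f)
    (hl : HasLocalLifts DX DY f) (S : M →ₗ[ℝ] Form DX V k)
    (hS : ∀ c n (ψ ψ' : Euc n → X) (hψ : IsPlot ψ) (hψ' : IsPlot ψ'),
      (∀ y, f (ψ y) = f (ψ' y)) → (S c).on ψ hψ = (S c).on ψ' hψ') :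
    ∃ T : M →ₗ[ℝ] Form DY V k, ∀ c, pullback f hf k (T c) = S c := by
  let e := LinearEquiv.ofInjective (pullback (V := V) f hf k) (pullback_injective hf hl)
  let S' : M →ₗ[ℝ] LinearMap.range (pullback (V := V) f hf k) :=
    S.codRestrict _ fun c ↦ exists_pullback_eq hf hl (S c) (hS c)
  refine ⟨e.symm.toLinearMap ∘ₗ S', fun c ↦ ?_⟩
  exact congrArg Subtype.val (e.apply_symm_apply (S' c))

end Descent

/-! ### Transgression forms on smooth spaces. -/

section TransgressionForms

variable {EG : Type*} [NormedAddCommGroup EG] [NormedSpace ℝ EG]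
  {G : Type*} [TopologicalSpace G] [ChartedSpace EG G] [Group G]
  {W W' : Type*} [NormedAddCommGroup W] [NormedSpace ℝ W]
  [NormedAddCommGroup W'] [NormedSpace ℝ W'] {k p q : ℕ}

/-- A `1`-form as a linear map. -/
def curry₁ (α : W [⋀^Fin 1]→L[ℝ] EG) : W →L[ℝ] EG :=
  (ContinuousAlternatingMap.ofSubsingleton ℝ W EG (0 : Fin 1)).symm α

theorem curry₁_apply (α : W [⋀^Fin 1]→L[ℝ] EG) (v : W) : curry₁ α v = α ![v] := by
  refine congrArg α (funext fun i ↦ ?_)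
  fin_cases i
  rfl

theorem contDiff_curry₁ {n : WithTop ℕ∞} :
    ContDiff ℝ n (curry₁ : W [⋀^Fin 1]→L[ℝ] EG → W →L[ℝ] EG) :=
  LinearIsometryEquiv.contDiff
    (ContinuousAlternatingMap.ofSubsingletonLIE (𝕜 := ℝ) (E := W) (F := EG) (0 : Fin 1)).symm

/-- The bridge from the curvature of the statement to the bilinear `curv`: `lieBr_eq` replaces the
bracket of invariant fields by a continuous bilinear map, which can be differentiated. -/
theorem curry₁_curvature {α : W → W [⋀^Fin 1]→L[ℝ] EG} [LieGroup 𝓘(ℝ, EG) ∞ G] [CompleteSpace EG]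
    {w : W} (hα : DifferentiableAt ℝ α w) (u v : W) :
    curvature G α w u v = curv G (fun y ↦ curry₁ (α y)) w u v := by
  have hd : ∀ x y : W, fderiv ℝ (fun y ↦ curry₁ (α y)) w x y = fderiv ℝ (fun z ↦ α z ![y]) w x := by
    intro x y
    have h1 : HasFDerivAt (fun y ↦ curry₁ (α y)) _ w :=
      ((contDiff_curry₁ (n := 1)).differentiable (by simp) (α w)).hasFDerivAt.comp w hα.hasFDerivAt
    have h2 := h1.clm_apply (hasFDerivAt_const y w)
    simp only [curry₁_apply] at h2
    rw [h2.fderiv, h1.fderiv]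
    simp
  rw [curvature, curv_apply, lieBr_eq, extDeriv_apply hα, Fin.sum_univ_two, hd, hd, curry₁_apply,
    curry₁_apply]
  have e0 : (0 : Fin 2).removeNth ![u, v] = ![v] := by ext i; fin_cases i; rfl
  have e1 : (1 : Fin 2).removeNth ![u, v] = ![u] := by ext i; fin_cases i; rfl
  simp [e0, e1, sub_eq_add_neg]

theorem curry₁_simplicialForm (θ : Fin (p + 1) → W → W [⋀^Fin 1]→L[ℝ] EG) :
    (fun z ↦ curry₁ (simplicialForm θ z)) = simpForm fun j w ↦ curry₁ (θ j w) := by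
  funext z
  have e : ∀ y : (Fin p → ℝ) × W, Prod.snd ∘ ![y] = ![y.2] := fun y ↦ by ext i; fin_cases i; rfl
  ext x <;> simp [curry₁_apply, simplicialForm, simpForm, sum_apply, e]

theorem simplexIntegral_eq [LieGroup 𝓘(ℝ, EG) ∞ G] [CompleteSpace EG] [FiniteDimensional ℝ W]
    (f : InvPoly EG G k) {θ : Fin (p + 1) → W → W [⋀^Fin 1]→L[ℝ] EG} (hθ : ∀ j, ContDiff ℝ ∞ (θ j))
    (h : p + q = 2 * k) (w : W) (v : Fin q → W) :
    simplexIntegral G f.1 θ h w v = transgress f (fun j w ↦ curry₁ (θ j w)) h w v := by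
  have hs : ContDiff ℝ ∞ (simplicialForm θ) := by
    refine ContDiff.sum fun j _ ↦ ((contDiff_bary j).comp contDiff_fst).smul ?_
    let C : (W [⋀^Fin 1]→L[ℝ] EG) →L[ℝ] (((Fin p → ℝ) × W) [⋀^Fin 1]→L[ℝ] EG) :=
      ContinuousAlternatingMap.compContinuousLinearMapCLM (ContinuousLinearMap.snd ℝ (Fin p → ℝ) W)
    exact C.contDiff.comp ((hθ j).comp contDiff_snd)
  rw [transgress_apply (θ := fun j w ↦ curry₁ (θ j w)) f fun j ↦ contDiff_curry₁.comp (hθ j),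
    simplexIntegral]
  simp only [simpChern, chernForm_apply, ← curry₁_simplicialForm]
  refine MeasureTheory.integral_congr_ae (Filter.Eventually.of_forall fun t ↦ ?_)
  have : curvature G (simplicialForm θ) (t, w) =
      fun x y ↦ curv G (fun z ↦ curry₁ (simplicialForm θ z)) (t, w) x y :=
    funext fun x ↦ funext fun y ↦ curry₁_curvature (hs.differentiable (by simp) _) x y
  simp only [this]
  rfl

/-- The barycentric coordinates add up to 1. This is the reason why invariant connections have no
higher components. -/
theorem simpForm_const (θ : W → W →L[ℝ] EG) :
    simpForm (p := p) (fun _ ↦ θ) = pull Prod.snd θ := by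
  funext z
  have h : fderiv ℝ (Prod.snd : (Fin p → ℝ) × W → W) z = .snd ℝ _ _ := fderiv_snd
  ext x <;> simp [simpForm, pull, h, ← Finset.sum_smul, sum_bary]

section

variable [LieGroup 𝓘(ℝ, EG) ∞ G] [CompleteSpace EG] [FiniteDimensional ℝ W]

theorem simpChern_const (f : InvPoly EG G k) {θ : W → W →L[ℝ] EG} (hθ : ContDiff ℝ ∞ θ)
    (z : (Fin p → ℝ) × W) (v : Fin (2 * k) → (Fin p → ℝ) × W) :
    simpChern f (fun _ ↦ θ) z v = chernForm f.1 (curv G θ z.2) fun i ↦ (v i).2 := by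
  have h : fderiv ℝ (Prod.snd : (Fin p → ℝ) × W → W) z = .snd ℝ _ _ := fderiv_snd
  simp only [simpChern, simpForm_const, chernForm_apply, curv_pull contDiff_snd hθ, h]
  rfl

/-- The integrand is pulled back from W and is evaluated on at least one vector tangent to the
simplex, whose W-component is 0. -/
theorem transgress_const_succ (f : InvPoly EG G k) {θ : W → W →L[ℝ] EG} (hθ : ContDiff ℝ ∞ θ)
    (h : p + 1 + q = 2 * k) (w : W) (v : Fin q → W) :
    transgress (p := p + 1) f (fun _ ↦ θ) h w v = 0 := by
  rw [transgress_apply f fun _ ↦ hθ]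
  simp only [simpChern_const f hθ]
  refine MeasureTheory.integral_eq_zero_of_ae (Filter.Eventually.of_forall fun t ↦ ?_)
  refine (chernForm f.1 (curv G θ w)).map_coord_zero (Fin.cast h (Fin.castAdd q 0)) ?_
  rw [fiberVec_left]

/-- The simplex Δ_0 is a point of volume 1. -/
theorem transgress_const_zero (f : InvPoly EG G k) {θ : W → W →L[ℝ] EG} (hθ : ContDiff ℝ ∞ θ)
    (w : W) (v : Fin (2 * k) → W) :
    transgress (p := 0) f (fun _ ↦ θ) (zero_add (2 * k)) w v =
      chernForm f.1 (curv G θ w) v := by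
  have hv : MeasureTheory.volume.real (simplex 0) = 1 := by
    have : simplex 0 = Set.univ := Set.eq_univ_of_forall fun t ↦ mem_simplex.2 (by simp)
    rw [this]
    simp [MeasureTheory.Measure.real, MeasureTheory.volume_pi]
  have he : (fun i ↦ (fiberVec (stdE 0) (zero_add (2 * k)) v i).2) = v := by
    funext i
    rw [fiberVec_eq, dif_neg (by omega)]
    rfl
  rw [transgress_apply f fun _ ↦ hθ]
  simp [simpChern_const f hθ, he, hv]

theorem fiberInt_add {U : Type*} [NormedAddCommGroup U] [NormedSpace ℝ U] [MeasurableSpace U]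
    [BorelSpace U] [SecondCountableTopology U] (μ : MeasureTheory.Measure U)
    [MeasureTheory.IsFiniteMeasureOnCompacts μ] {K : Set U} {m : ℕ} (hK : IsCompact K)
    (e : Fin p → U) (h : p + q = m)
    {α β : U × W → (U × W) [⋀^Fin m]→L[ℝ] ℝ} (hα : ContDiff ℝ ∞ α) (hβ : ContDiff ℝ ∞ β) :
    fiberInt μ K e h (fun z ↦ α z + β z) = fun w ↦ fiberInt μ K e h α w + fiberInt μ K e h β w := by
  funext w
  ext v
  rw [ContinuousAlternatingMap.add_apply, fiberInt_apply μ hK e h hα, fiberInt_apply μ hK e h hβ,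
    fiberInt_apply μ hK e h (hα.add hβ)]
  have hi : ∀ {γ : U × W → (U × W) [⋀^Fin m]→L[ℝ] ℝ}, ContDiff ℝ ∞ γ →
      MeasureTheory.IntegrableOn (fun t ↦ γ (t, w) (fiberVec e h v)) K μ := fun hγ ↦
    (((contDiff_apply_vec hγ _).continuous).comp
      (Continuous.prodMk_left w)).continuousOn.integrableOn_compact hK
  exact MeasureTheory.integral_add (hi hα) (hi hβ)

theorem fiberInt_smul {U : Type*} [NormedAddCommGroup U] [NormedSpace ℝ U] [MeasurableSpace U]
    [BorelSpace U] [SecondCountableTopology U] (μ : MeasureTheory.Measure U)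
    [MeasureTheory.IsFiniteMeasureOnCompacts μ] {K : Set U} {m : ℕ} (hK : IsCompact K)
    (e : Fin p → U) (h : p + q = m)
    {α : U × W → (U × W) [⋀^Fin m]→L[ℝ] ℝ} (hα : ContDiff ℝ ∞ α) (c : ℝ) :
    fiberInt μ K e h (fun z ↦ c • α z) = fun w ↦ c • fiberInt μ K e h α w := by
  funext w
  ext v
  rw [ContinuousAlternatingMap.smul_apply, fiberInt_apply μ hK e h hα,
    fiberInt_apply μ hK e h (hα.const_smul c)]
  exact MeasureTheory.integral_const_mul c _

theorem chernForm_add (f f' : ContinuousMultilinearMap ℝ (fun _ : Fin k ↦ EG) ℝ)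
    (Ω : W →L[ℝ] W →L[ℝ] EG) : chernForm (f + f') Ω = chernForm f Ω + chernForm f' Ω := by
  ext v
  rw [ContinuousAlternatingMap.add_apply]
  simp only [chernForm_apply, evalPoly, add_apply, mul_add,
    Finset.sum_add_distrib]

theorem chernForm_smul (c : ℝ) (f : ContinuousMultilinearMap ℝ (fun _ : Fin k ↦ EG) ℝ)
    (Ω : W →L[ℝ] W →L[ℝ] EG) : chernForm (c • f) Ω = c • chernForm f Ω := by
  ext v
  rw [ContinuousAlternatingMap.smul_apply]
  simp only [chernForm_apply, evalPoly, smul_apply, smul_eq_mul,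
    mul_left_comm _ c, ← Finset.mul_sum]

theorem transgress_add (f f' : InvPoly EG G k) {θ : Fin (p + 1) → W → W →L[ℝ] EG}
    (hθ : ∀ j, ContDiff ℝ ∞ (θ j)) (h : p + q = 2 * k) :
    transgress (f + f') θ h = fun w ↦ transgress f θ h w + transgress f' θ h w := by
  refine Eq.trans ?_ (fiberInt_add _ (isCompact_simplex p) _ h (contDiff_simpChern f hθ)
    (contDiff_simpChern f' hθ))
  exact congrArg _ (funext fun z ↦ chernForm_add f.1 f'.1 _)

theorem transgress_smul (c : ℝ) (f : InvPoly EG G k) {θ : Fin (p + 1) → W → W →L[ℝ] EG}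
    (hθ : ∀ j, ContDiff ℝ ∞ (θ j)) (h : p + q = 2 * k) :
    transgress (c • f) θ h = fun w ↦ c • transgress f θ h w := by
  refine Eq.trans ?_ (fiberInt_smul _ (isCompact_simplex p) _ h (contDiff_simpChern f hθ) c)
  exact congrArg _ (funext fun z ↦ chernForm_smul c f.1 _)

theorem transgress₂_add (f f' : InvPoly EG G k) {θ : Fin 2 → Fin (p + 1) → W → W →L[ℝ] EG}
    (hθ : ∀ i j, ContDiff ℝ ∞ (θ i j)) (h : p + (q + 1) = 2 * k) :
    transgress₂ (f + f') θ h = fun w ↦ transgress₂ f θ h w + transgress₂ f' θ h w := by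
  rw [transgress₂, transgress_add f f' (contDiff_linHomotopy hθ)]
  exact fiberInt_add _ (isCompact_simplex 1) _ _ (contDiff_transgress f (contDiff_linHomotopy hθ) h)
    (contDiff_transgress f' (contDiff_linHomotopy hθ) h)

theorem transgress₂_smul (c : ℝ) (f : InvPoly EG G k) {θ : Fin 2 → Fin (p + 1) → W → W →L[ℝ] EG}
    (hθ : ∀ i j, ContDiff ℝ ∞ (θ i j)) (h : p + (q + 1) = 2 * k) :
    transgress₂ (c • f) θ h = fun w ↦ c • transgress₂ f θ h w := by
  rw [transgress₂, transgress_smul c f (contDiff_linHomotopy hθ)]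
  exact fiberInt_smul _ (isCompact_simplex 1) _ _
    (contDiff_transgress f (contDiff_linHomotopy hθ) h) c

end

section

variable {X : Type*} {D : DiffeologicalSpace X}

/-- The pull-back of a `1`-form along a plot, as a family of linear maps. -/
def Form.curry (θ : Form D EG 1) {n : ℕ} (φ : Euc n → X) (hφ : IsPlot φ) (w : Euc n) :
    Euc n →L[ℝ] EG := curry₁ (θ.on φ hφ w)

theorem Form.contDiff_curry (θ : Form D EG 1) {n : ℕ} {φ : Euc n → X} (hφ : IsPlot φ) :
    ContDiff ℝ ∞ (θ.curry φ hφ) := contDiff_curry₁.comp (θ.contDiff_on hφ)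

theorem Form.curry_comp (θ : Form D EG 1) {m n : ℕ} {φ : Euc n → X} (hφ : IsPlot φ)
    {h : Euc m → Euc n} (hh : ContDiff ℝ ∞ h) :
    θ.curry (φ ∘ h) (isPlot_reparam hφ hh) = pull h (θ.curry φ hφ) := by
  funext x
  ext v
  simp only [Form.curry, pull, ContinuousLinearMap.comp_apply, curry₁_apply, θ.on_comp hφ hh]
  refine congrArg (θ.on φ hφ (h x)) (funext fun i ↦ ?_)
  fin_cases i
  rfl

variable [LieGroup 𝓘(ℝ, EG) ∞ G] [CompleteSpace EG]

/-- The transgression of a family of `1`-forms on a smooth space. -/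
def transForm (θ : Fin (p + 1) → Form D EG 1) (h : p + q = 2 * k) :
    InvPoly EG G k →ₗ[ℝ] Form D ℝ q where
  toFun f := ⟨fun n φ ↦ transgress f (fun j ↦ (θ j).curry φ.1 φ.2) h,
    fun n φ ↦ contDiff_transgress f (fun j ↦ (θ j).contDiff_curry φ.2) h,
    fun m n φ g hg x ↦ by
      ext v
      simp only [Form.curry_comp _ φ.2 hg]
      exact transgress_pull f (fun j ↦ (θ j).contDiff_curry φ.2) hg h x v⟩
  map_add' f f' := Subtype.ext (funext fun n ↦ funext fun φ ↦
    transgress_add f f' (fun j ↦ (θ j).contDiff_curry φ.2) h)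
  map_smul' c f := Subtype.ext (funext fun n ↦ funext fun φ ↦
    transgress_smul c f (fun j ↦ (θ j).contDiff_curry φ.2) h)

/-- The transgression of the linear homotopy between two families of `1`-forms on a smooth
space. -/
def transForm₂ (θ : Fin 2 → Fin (p + 1) → Form D EG 1) (h : p + (q + 1) = 2 * k) :
    InvPoly EG G k →ₗ[ℝ] Form D ℝ q where
  toFun f := ⟨fun n φ ↦ transgress₂ f (fun i j ↦ (θ i j).curry φ.1 φ.2) h,
    fun n φ ↦ contDiff_transgress₂ f (fun i j ↦ (θ i j).contDiff_curry φ.2) h,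
    fun m n φ g hg x ↦ by
      ext v
      simp only [Form.curry_comp _ φ.2 hg]
      exact transgress₂_pull f (fun i j ↦ (θ i j).contDiff_curry φ.2) hg h x v⟩
  map_add' f f' := Subtype.ext (funext fun n ↦ funext fun φ ↦
    transgress₂_add f f' (fun i j ↦ (θ i j).contDiff_curry φ.2) h)
  map_smul' c f := Subtype.ext (funext fun n ↦ funext fun φ ↦
    transgress₂_smul c f (fun i j ↦ (θ i j).contDiff_curry φ.2) h)

theorem transForm_on (θ : Fin (p + 1) → Form D EG 1) (h : p + q = 2 * k) (f : InvPoly EG G k)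
    {n : ℕ} (φ : Euc n → X) (hφ : IsPlot φ) :
    (transForm θ h f).on φ hφ = transgress f (fun j ↦ (θ j).curry φ hφ) h := rfl

theorem transForm₂_on (θ : Fin 2 → Fin (p + 1) → Form D EG 1) (h : p + (q + 1) = 2 * k)
    (f : InvPoly EG G k) {n : ℕ} (φ : Euc n → X) (hφ : IsPlot φ) :
    (transForm₂ θ h f).on φ hφ = transgress₂ f (fun i j ↦ (θ i j).curry φ hφ) h := rfl

theorem transForm_on_eq (θ : Fin (p + 1) → Form D EG 1) (h : p + q = 2 * k) (f : InvPoly EG G k)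
    {n : ℕ} {φ φ' : Euc n → X} (hφ : IsPlot φ) (hφ' : IsPlot φ') {g : Euc n → G}
    (hg : ContMDiff 𝓘(ℝ, Euc n) 𝓘(ℝ, EG) ∞ g)
    (hθ : ∀ j, (θ j).curry φ' hφ' = gauge ((θ j).curry φ hφ) g) :
    (transForm θ h f).on φ hφ = (transForm θ h f).on φ' hφ' := by
  rw [transForm_on, transForm_on, funext hθ]
  exact (transgress_gauge f (fun j ↦ (θ j).contDiff_curry hφ) hg
    (fun j ↦ hθ j ▸ (θ j).contDiff_curry hφ') h).symm

theorem transForm₂_on_eq (θ : Fin 2 → Fin (p + 1) → Form D EG 1) (h : p + (q + 1) = 2 * k)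
    (f : InvPoly EG G k) {n : ℕ} {φ φ' : Euc n → X} (hφ : IsPlot φ) (hφ' : IsPlot φ') {g : Euc n → G}
    (hg : ContMDiff 𝓘(ℝ, Euc n) 𝓘(ℝ, EG) ∞ g)
    (hθ : ∀ i j, (θ i j).curry φ' hφ' = gauge ((θ i j).curry φ hφ) g) :
    (transForm₂ θ h f).on φ hφ = (transForm₂ θ h f).on φ' hφ' := by
  rw [transForm₂_on, transForm₂_on, funext fun i ↦ funext (hθ i)]
  exact (transgress₂_gauge f (fun i j ↦ (θ i j).contDiff_curry hφ) hg
    (fun i j ↦ hθ i j ▸ (θ i j).contDiff_curry hφ') h).symm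

theorem pullback_transForm {Y : Type*} {DY : DiffeologicalSpace Y} (F : Y → X) (hF : DSmooth F)
    (θ : Fin (p + 1) → Form D EG 1) (h : p + q = 2 * k) (f : InvPoly EG G k) :
    pullback F hF q (transForm θ h f) = transForm (fun j ↦ pullback F hF 1 (θ j)) h f := rfl

end

end TransgressionForms

/-! ### Local lifts and gauge changes in the principal bundle. -/

namespace PrincipalBundle

variable {EA : Type*} [NormedAddCommGroup EA] [NormedSpace ℝ EA]
  {A : Type*} [TopologicalSpace A] [ChartedSpace EA A]
  {EO : Type*} [NormedAddCommGroup EO] [NormedSpace ℝ EO]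
  {O : Type*} [TopologicalSpace O] [ChartedSpace EO O]
  {EG : Type*} [NormedAddCommGroup EG] [NormedSpace ℝ EG]
  {G : Type*} [TopologicalSpace G] [ChartedSpace EG G] [Group G]
  {EP : Type*} [NormedAddCommGroup EP] [NormedSpace ℝ EP]
  {P : Type*} [TopologicalSpace P] [ChartedSpace EP P]
  {𝓖 : LieGroupoid EA A EO O} (𝓟 : PrincipalBundle EG G EP P 𝓖)

theorem act_left_injective {x : P} {g h : G} (e : 𝓟.act x g = 𝓟.act x h) : g = h := by
  obtain ⟨t, hx, -, -, ht⟩ := 𝓟.locally_trivial (𝓟.proj x)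
  have hs : x ∈ t.source := t.mem_source.2 hx
  have := congrArg (fun y ↦ (t y).2) e
  simpa [ht x hs] using this

theorem act_eq_of_trivialization {t : Bundle.Trivialization G 𝓟.proj}
    (ht : ∀ p ∈ t.source, ∀ g, t (𝓟.act p g) = ((t p).1, (t p).2 * g)) {x y : P}
    (h : 𝓟.proj y = 𝓟.proj x) (hx : x ∈ t.source) : 𝓟.act x ((t x).2⁻¹ * (t y).2) = y := by
  have hy : y ∈ t.source := t.mem_source.2 (h ▸ t.mem_source.1 hx)
  have ha : 𝓟.act x ((t x).2⁻¹ * (t y).2) ∈ t.source :=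
    t.mem_source.2 ((𝓟.proj_act _ _).symm ▸ t.mem_source.1 hx)
  refine t.injOn ha hy (show t _ = t y from ?_)
  rw [ht x hx, mul_inv_cancel_left, t.coe_fst hx, ← h, ← t.coe_fst hy]

theorem exists_act_eq {x y : P} (h : 𝓟.proj y = 𝓟.proj x) : ∃ g, 𝓟.act x g = y := by
  obtain ⟨t, hx, -, -, ht⟩ := 𝓟.locally_trivial (𝓟.proj x)
  exact ⟨_, 𝓟.act_eq_of_trivialization ht h (t.mem_source.2 hx)⟩

/-- Two smooth families in `P` with the same projection differ by a smooth family in `G`. -/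
theorem exists_contMDiff_act_eq [LieGroup 𝓘(ℝ, EG) ∞ G] {n : ℕ} {x y : Euc n → P}
    (hx : ContMDiff 𝓘(ℝ, Euc n) 𝓘(ℝ, EP) ∞ x) (hy : ContMDiff 𝓘(ℝ, Euc n) 𝓘(ℝ, EP) ∞ y)
    (h : ∀ w, 𝓟.proj (y w) = 𝓟.proj (x w)) :
    ∃ g : Euc n → G, ContMDiff 𝓘(ℝ, Euc n) 𝓘(ℝ, EG) ∞ g ∧ ∀ w, 𝓟.act (x w) (g w) = y w := by
  choose g hg using fun w ↦ 𝓟.exists_act_eq (h w)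
  refine ⟨g, fun w ↦ ?_, hg⟩
  -- The action is free, so `g` is unique, and near w it must be the quotient of the fibre
  -- coordinates of x and y in any trivialization. This shows smoothness.
  obtain ⟨t, hw, hts, -, ht⟩ := 𝓟.locally_trivial (𝓟.proj (x w))
  have hsx : x w ∈ t.source := t.mem_source.2 hw
  have hsy : y w ∈ t.source := t.mem_source.2 (h w ▸ hw)
  have htx : ContMDiffAt 𝓘(ℝ, Euc n) 𝓘(ℝ, EG) ∞ (fun w ↦ (t (x w)).2) w :=
    contMDiffAt_snd.comp w ((hts.contMDiffAt (t.open_source.mem_nhds hsx)).comp w (hx w))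
  have hty : ContMDiffAt 𝓘(ℝ, Euc n) 𝓘(ℝ, EG) ∞ (fun w ↦ (t (y w)).2) w :=
    contMDiffAt_snd.comp w ((hts.contMDiffAt (t.open_source.mem_nhds hsy)).comp w (hy w))
  refine (htx.inv.mul hty).congr_of_eventuallyEq ?_
  filter_upwards [(hx w).continuousAt.eventually (t.open_source.mem_nhds hsx)] with z hz
  exact 𝓟.act_left_injective ((hg z).trans (𝓟.act_eq_of_trivialization ht (h z) hz).symm)

/-- Compose with the local section with fibre coordinate 1, after localizing the plot so that it
stays in the base set of the trivialization. -/
theorem hasLocalLifts_proj [IsManifold 𝓘(ℝ, EP) ∞ P] :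
    HasLocalLifts (manifoldDiffeology EP P) (manifoldDiffeology EO O) 𝓟.proj := by
  intro n φ hφ w
  replace hφ : ContMDiff 𝓘(ℝ, Euc n) 𝓘(ℝ, EO) ∞ φ := hφ
  obtain ⟨t, hw, -, hts, -⟩ := 𝓟.locally_trivial (φ w)
  obtain ⟨κ, hκ, hκs, he⟩ := exists_localization w
    (hφ.continuous.continuousAt.preimage_mem_nhds (t.open_baseSet.mem_nhds hw))
  have hκt : ∀ y, (φ (κ y), (1 : G)) ∈ t.target := fun y ↦ t.mem_target.2 (hκs y : φ (κ y) ∈ _)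
  refine ⟨fun y ↦ t.toOpenPartialHomeomorph.symm (φ (κ y), 1), ?_, ?_⟩
  · have h1 : ContMDiff 𝓘(ℝ, Euc n) (𝓘(ℝ, EO).prod 𝓘(ℝ, EG)) ∞ fun y ↦ (φ (κ y), (1 : G)) :=
      (hφ.comp hκ.contMDiff).prodMk contMDiff_const
    exact hts.comp_contMDiff h1 hκt
  · filter_upwards [he] with y hy
    rw [t.proj_symm_apply (hκt y), hy]

theorem dSmooth_arrow : @DSmooth _ _ 𝓟.transformation.dA (manifoldDiffeology EA A)
    (fun q : 𝓟.Arrow ↦ q.1.1) :=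
  fun _ _ hφ ↦ (DiffeologicalSpace.isPlot_inf_iff.1 hφ).1

theorem hasLocalLifts_arrow [IsManifold 𝓘(ℝ, EP) ∞ P] :
    HasLocalLifts 𝓟.transformation.dA (manifoldDiffeology EA A) (fun q : 𝓟.Arrow ↦ q.1.1) := by
  intro n φ hφ w
  obtain ⟨ψ, hψ, h⟩ := 𝓟.hasLocalLifts_proj n (fun y ↦ 𝓖.src (φ y)) (𝓖.toDiff.dSmooth_src n φ hφ) w
  obtain ⟨κ, hκ, hκs, he⟩ := exists_localization w h
  have h1 : ContMDiff 𝓘(ℝ, Euc n) 𝓘(ℝ, EA) ∞ fun y ↦ φ (κ y) := ContMDiff.comp hφ hκ.contMDiff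
  have h2 : ContMDiff 𝓘(ℝ, Euc n) 𝓘(ℝ, EP) ∞ fun y ↦ ψ (κ y) := ContMDiff.comp hψ hκ.contMDiff
  refine ⟨fun y ↦ ⟨(φ (κ y), ψ (κ y)), (hκs y).symm⟩,
    DiffeologicalSpace.isPlot_inf_iff.2 ⟨h1, h2⟩, he.mono fun y hy ↦ congrArg φ hy⟩

theorem smul_congr {γ γ' : A} {x : P} (e : γ = γ') (h : 𝓖.src γ = 𝓟.proj x)
    (h' : 𝓖.src γ' = 𝓟.proj x) : 𝓟.smul γ x h = 𝓟.smul γ' x h' := by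
  subst e; rfl

/-- Only the vertex 0 has to be lifted to P. The arrows γ_{j0} then transport this lift to the other
vertices, x_j = γ_{j0} · x, and γ_{ij} lifts to (γ_{ij}, x_j). -/
theorem hasLocalLifts_nerveProj [IsManifold 𝓘(ℝ, EP) ∞ P] (p : ℕ) :
    HasLocalLifts (𝓟.transformation.nerveDiffeology p) (𝓖.toDiff.nerveDiffeology p)
      (𝓟.nerveProj p) := by
  intro n φ hφ w
  have hφ' := (𝓖.toDiff.nerve_isPlot_iff φ).1 hφ
  obtain ⟨ψ, hψ, h⟩ := 𝓟.hasLocalLifts_proj n (fun y ↦ 𝓖.src ((φ y).1 0 0))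
    (𝓖.toDiff.dSmooth_src n _ (hφ' 0 0)) w
  obtain ⟨κ, hκ, hκs, he⟩ := exists_localization w h
  have hs : ∀ y i j, 𝓖.src ((φ y).1 i 0) = 𝓖.src ((φ y).1 j 0) := fun y i j ↦
    ((φ y).2.1 i 0 0).trans ((φ y).2.1 j 0 0).symm
  have hx : ∀ y j, 𝓖.src ((φ (κ y)).1 j 0) = 𝓟.proj (ψ (κ y)) := fun y j ↦
    (hs _ j 0).trans (hκs y).symm
  let x : Euc n → Fin (p + 1) → P := fun y j ↦ 𝓟.smul ((φ (κ y)).1 j 0) (ψ (κ y)) (hx y j)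
  have ha : ∀ y i j, 𝓖.src ((φ (κ y)).1 i j) = 𝓟.proj (x y j) := fun y i j ↦
    ((φ (κ y)).2.1 i j 0).trans (𝓟.proj_smul _ _ _).symm
  have hc : ∀ y i j, 𝓟.smul ((φ (κ y)).1 i j) (x y j) (ha y i j) = x y i := fun y i j ↦
    (𝓟.smul_smul _ _ _ ((φ (κ y)).2.1 i j 0) (hx y j)).trans
      (𝓟.smul_congr ((φ (κ y)).2.2 i j 0) _ _)
  refine ⟨fun y ↦ ⟨fun i j ↦ ⟨((φ (κ y)).1 i j, x y j), ha y i j⟩, fun i j k ↦ (hc y j k).symm,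
    fun i j k ↦ Subtype.ext (Prod.ext ((φ (κ y)).2.2 i j k) rfl)⟩, ?_, ?_⟩
  · have h1 : ∀ i j, ContMDiff 𝓘(ℝ, Euc n) 𝓘(ℝ, EA) ∞ fun y ↦ (φ (κ y)).1 i j := fun i j ↦
      ContMDiff.comp (hφ' i j) hκ.contMDiff
    refine (𝓟.transformation.nerve_isPlot_iff _).2 fun i j ↦
      DiffeologicalSpace.isPlot_inf_iff.2 ⟨h1 i j, ?_⟩
    exact 𝓟.contMDiff_smul n (fun y ↦ (φ (κ y)).1 j 0) (fun y ↦ ψ (κ y))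
      (h1 j 0) (ContMDiff.comp hψ hκ.contMDiff) fun y ↦ hx y j
  · filter_upwards [he] with y hy
    exact congrArg φ hy

/-- The pull-backs of a pseudo-connection along two smooth families in `P` that differ by a
smooth family in `G` are gauge equivalent. -/
theorem IsPseudoConnection.curry_act [LieGroup 𝓘(ℝ, EG) ∞ G] {𝓟 : PrincipalBundle EG G EP P 𝓖}
    {θ : 𝓟.OneForm} (hθ : 𝓟.IsPseudoConnection θ) {n : ℕ} {x y : Euc n → P} {g : Euc n → G}
    (hx : @IsPlot _ 𝓟.transformation.dO n x)
    (hy : @IsPlot _ 𝓟.transformation.dO n y) (hg : ContMDiff 𝓘(ℝ, Euc n) 𝓘(ℝ, EG) ∞ g)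
    (h : ∀ w, 𝓟.act (x w) (g w) = y w) : θ.curry y hy = gauge (θ.curry x hx) g := by
  let D := 𝓟.transformation.dO
  replace hx : ContMDiff 𝓘(ℝ, Euc n) 𝓘(ℝ, EP) ∞ x := hx
  -- Separate the two occurrences of the parameter: Φ(a, b) = x(a) · g(b), and y is Φ on the
  -- diagonal. The derivative along the diagonal is the sum of the two partial ones. Plots have
  -- Euclidean domains, hence the identification `e`.
  let e : (Euc n × Euc n) ≃L[ℝ] Euc (n + n) := ContinuousLinearEquiv.ofFinrankEq (by simp)
  let Φ : Euc (n + n) → P := fun u ↦ 𝓟.act (x (e.symm u).1) (g (e.symm u).2)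
  have h1 : ContDiff ℝ ∞ fun u ↦ (e.symm u).1 := contDiff_fst.comp e.symm.contDiff
  have h2 : ContDiff ℝ ∞ fun u ↦ (e.symm u).2 := contDiff_snd.comp e.symm.contDiff
  have hΦ : @IsPlot _ D _ Φ := by
    have := 𝓟.contMDiff_act.comp ((hx.comp h1.contMDiff).prodMk (hg.comp h2.contMDiff))
    exact this
  funext w
  ext v
  have hd : ContDiff ℝ ∞ fun z : Euc n ↦ e (z, z) := e.contDiff.comp (contDiff_id.prodMk contDiff_id)
  have hl : ContDiff ℝ ∞ fun z : Euc n ↦ e (z, w) :=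
    e.contDiff.comp (contDiff_id.prodMk contDiff_const)
  have hr : ContDiff ℝ ∞ fun z : Euc n ↦ e (w, z) :=
    e.contDiff.comp (contDiff_const.prodMk contDiff_id)
  have dd : fderiv ℝ (fun z : Euc n ↦ e (z, z)) w v = e (v, v) :=
    congrArg (fun L ↦ L v) (e.hasFDerivAt.comp w
      ((hasFDerivAt_id w).prodMk (hasFDerivAt_id w))).fderiv
  have dl : fderiv ℝ (fun z : Euc n ↦ e (z, w)) w v = e (v, 0) :=
    congrArg (fun L ↦ L v) (e.hasFDerivAt.comp w
      ((hasFDerivAt_id w).prodMk (hasFDerivAt_const w w))).fderiv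
  have dr : fderiv ℝ (fun z : Euc n ↦ e (w, z)) w v = e (0, v) :=
    congrArg (fun L ↦ L v) (e.hasFDerivAt.comp w
      ((hasFDerivAt_const w w).prodMk (hasFDerivAt_id w))).fderiv
  have ed := congrFun (θ.curry_comp hΦ hd) w
  have el := congrFun (θ.curry_comp hΦ hl) w
  have er := congrFun (θ.curry_comp hΦ hr) w
  have ed' : θ.curry y hy w v = θ.curry Φ hΦ (e (w, w)) (e (v, v)) := by
    rw [← dd]
    refine Eq.trans ?_ (congrArg (fun L ↦ L v) ed)
    have : Φ ∘ (fun z : Euc n ↦ e (z, z)) = y := funext fun z ↦ by simp [Φ, h]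
    simp only [Form.curry]
    rw [Form.on_congr θ _ this]
  have el' : Ad (g w)⁻¹ (θ.curry x hx w v) = θ.curry Φ hΦ (e (w, w)) (e (v, 0)) := by
    rw [← dl]
    refine Eq.trans ?_ (congrArg (fun L ↦ L v) el)
    have : Φ ∘ (fun z : Euc n ↦ e (z, w)) = (fun p ↦ 𝓟.act p (g w)) ∘ x :=
      funext fun z ↦ by simp [Φ]
    simp only [Form.curry]
    rw [Form.on_congr θ _ this, curry₁_apply, curry₁_apply]
    exact (hθ.equivariant (g w) n x hx w ![v]).symm
  -- With the first variable fixed at w, the curve is the orbit through y(w) of g(w)⁻¹g, which is 1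
  -- at w; so the vertical condition applies. With the second variable fixed, `el'` used
  -- equivariance.
  have er' : mcForm g w v = θ.curry Φ hΦ (e (w, w)) (e (0, v)) := by
    rw [← dr]
    refine Eq.trans ?_ (congrArg (fun L ↦ L v) er)
    have : Φ ∘ (fun z : Euc n ↦ e (w, z)) =
        fun z ↦ 𝓟.act (𝓟.act (x w) (g w)) ((g w)⁻¹ * g z) :=
      funext fun z ↦ by simp [Φ, 𝓟.act_act]
    simp only [Form.curry]
    rw [Form.on_congr θ _ this, curry₁_apply]
    exact (hθ.vertical (𝓟.act (x w) (g w)) n (fun z ↦ (g w)⁻¹ * g z)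
      ((contMDiff_mul_left (a := (g w)⁻¹)).comp hg) w (by simp) v).symm
  rw [ed', gauge, add_apply, ContinuousLinearMap.comp_apply, el', er', ← map_add, ← map_add]
  simp

/-- The `i`-th vertex of the pull-back of a form. -/
abbrev vertexForm (θ : 𝓟.OneForm) {p : ℕ} (i : Fin (p + 1)) :
    Form (𝓟.transformation.nerveDiffeology p) EG 1 :=
  pullback (𝓟.transformation.vertex i) (𝓟.transformation.dSmooth_vertex i) 1 θ

/-- Two smooth families in `Q_p` with the same image in `Γ_p` differ by a smooth family in `G`. -/
theorem exists_vertex_act_eq [LieGroup 𝓘(ℝ, EG) ∞ G] {n p : ℕ}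
    {ψ ψ' : Euc n → 𝓟.transformation.Nerve p}
    (hψ : @IsPlot _ (𝓟.transformation.nerveDiffeology p) n ψ)
    (hψ' : @IsPlot _ (𝓟.transformation.nerveDiffeology p) n ψ')
    (h : ∀ w, 𝓟.nerveProj p (ψ w) = 𝓟.nerveProj p (ψ' w)) :
    ∃ g : Euc n → G, ContMDiff 𝓘(ℝ, Euc n) 𝓘(ℝ, EG) ∞ g ∧ ∀ w i,
      𝓟.act (𝓟.transformation.vertex i (ψ w)) (g w) = 𝓟.transformation.vertex i (ψ' w) := by
  have hγ : ∀ w i j, ((ψ w).1 i j).1.1 = ((ψ' w).1 i j).1.1 := fun w i j ↦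
    congrArg (fun γ : 𝓖.toDiff.Nerve p ↦ γ.1 i j) (h w)
  have hs : ∀ w (i : Fin (p + 1)), 𝓟.proj (𝓟.transformation.vertex i (ψ' w)) =
      𝓟.proj (𝓟.transformation.vertex i (ψ w)) := fun w i ↦
    ((ψ' w).1 i i).2.symm.trans ((congrArg 𝓖.src (hγ w i i).symm).trans ((ψ w).1 i i).2)
  -- It suffices to compare the vertices 0: the i-th vertex is obtained from it by the arrow γ_{i0},
  -- which is common to both families and commutes with G.
  obtain ⟨g, hg, hact⟩ := 𝓟.exists_contMDiff_act_eq
    (𝓟.transformation.dSmooth_vertex 0 n ψ hψ) (𝓟.transformation.dSmooth_vertex 0 n ψ' hψ')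
    (fun w ↦ hs w 0)
  have hsrc : ∀ (η : 𝓟.transformation.Nerve p) i j,
      (η.1 i j).1.2 = 𝓟.transformation.vertex j η := fun η i j ↦
    (η.2.1 i j j).trans (η.2.1 j j j).symm
  have hv : ∀ (η : 𝓟.transformation.Nerve p) (i : Fin (p + 1)),
      ∃ e, 𝓟.transformation.vertex i η =
        𝓟.smul (η.1 i 0).1.1 (𝓟.transformation.vertex 0 η) e := by
    intro η i
    refine ⟨hsrc η i 0 ▸ (η.1 i 0).2, (η.2.1 i i 0).trans ?_⟩
    show 𝓟.smul (η.1 i 0).1.1 (η.1 i 0).1.2 (η.1 i 0).2 = _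
    congr 1
    exact hsrc η i 0
  refine ⟨g, hg, fun w i ↦ ?_⟩
  obtain ⟨e, he⟩ := hv (ψ w) i
  obtain ⟨e', he'⟩ := hv (ψ' w) i
  rw [he, he', 𝓟.smul_act]
  have : ∀ γ γ' (x x' : P) (e : 𝓖.src γ = 𝓟.proj x) (e' : 𝓖.src γ' = 𝓟.proj x'), γ = γ' → x = x' →
      𝓟.smul γ x e = 𝓟.smul γ' x' e' := by
    rintro γ _ x _ e e' rfl rfl; rfl
  exact this _ _ _ _ _ _ (hγ w i 0) (hact w)

end PrincipalBundle

/-! ### The transgression identities as identities of forms on smooth spaces. -/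

section FormIdentities

variable {X : Type*} {D : DiffeologicalSpace X} {q : ℕ}

/-- Evaluation of forms. -/
def Form.eval {n : ℕ} (φ : Euc n → X) (hφ : IsPlot φ) (x : Euc n) (v : Fin q → Euc n) :
    Form D ℝ q →ₗ[ℝ] ℝ where
  toFun η := η.on φ hφ x v
  map_add' _ _ := rfl
  map_smul' _ _ := rfl

theorem Form.ext_eval {η η' : Form D ℝ q}
    (h : ∀ n (φ : Euc n → X) (hφ : IsPlot φ) x v, Form.eval φ hφ x v η = Form.eval φ hφ x v η') :
    η = η' :=
  Form.ext_on fun n φ hφ x ↦ ContinuousAlternatingMap.ext fun v ↦ h n φ hφ x v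

variable {EG : Type*} [NormedAddCommGroup EG] [NormedSpace ℝ EG]
  {G : Type*} [TopologicalSpace G] [ChartedSpace EG G] [Group G] [LieGroup 𝓘(ℝ, EG) ∞ G]
  [CompleteSpace EG] {k p : ℕ} (f : InvPoly EG G k)

theorem extD_transForm_zero (θ : Fin 1 → Form D EG 1) (h : 0 + q = 2 * k) :
    extD q (transForm θ h f) = 0 :=
  Form.ext_eval fun _ _ hφ x v ↦
    extDeriv_transgress_zero f (fun j ↦ (θ j).contDiff_curry hφ) h x v

theorem extD_transForm_succ (θ : Fin (p + 2) → Form D EG 1) (h : p + 1 + q = 2 * k)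
    (h' : p + (q + 1) = 2 * k) :
    (-1 : ℝ) ^ (p + 1) • extD q (transForm θ h f) +
      ∑ i : Fin (p + 2), (-1 : ℝ) ^ (i : ℕ) • transForm (fun j ↦ θ (i.succAbove j)) h' f = 0 := by
  refine Form.ext_eval fun n φ hφ x v ↦ ?_
  simp only [map_add, map_sum, map_smul, map_zero]
  exact extDeriv_transgress_succ f (fun j ↦ (θ j).contDiff_curry hφ) h h' x v

theorem sum_transForm_eq_zero (θ : Fin (p + 2) → Form D EG 1) (h : p + 0 = 2 * k) :
    ∑ i : Fin (p + 2), (-1 : ℝ) ^ (i : ℕ) • transForm (fun j ↦ θ (i.succAbove j)) h f = 0 := by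
  refine Form.ext_eval fun n φ hφ x v ↦ ?_
  simp only [map_sum, map_smul, map_zero]
  exact sum_transgress_eq_zero f (fun j ↦ (θ j).contDiff_curry hφ) h x v

theorem extD_transForm₂_zero (θ : Fin 2 → Fin 1 → Form D EG 1) (h : 0 + (q + 1) = 2 * k) :
    extD q (transForm₂ θ h f) = transForm (θ 1) h f - transForm (θ 0) h f := by
  refine Form.ext_eval fun n φ hφ x v ↦ ?_
  rw [map_sub]
  exact extDeriv_transgress₂_zero f (fun i j ↦ (θ i j).contDiff_curry hφ) h x v

theorem extD_transForm₂_succ (θ : Fin 2 → Fin (p + 2) → Form D EG 1)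
    (h : p + 1 + (q + 1) = 2 * k) (h' : p + (q + 1 + 1) = 2 * k) :
    extD q (transForm₂ θ h f) + ∑ i : Fin (p + 2), (-1 : ℝ) ^ (i : ℕ) • (-1 : ℝ) ^ p •
        transForm₂ (fun a j ↦ θ a (i.succAbove j)) h' f =
      transForm (θ 1) h f - transForm (θ 0) h f := by
  refine Form.ext_eval fun n φ hφ x v ↦ ?_
  simp only [map_add, map_sum, map_smul, map_sub]
  exact extDeriv_transgress₂_succ f (fun i j ↦ (θ i j).contDiff_curry hφ) h h' x v

theorem sum_transForm₂ (θ : Fin 2 → Fin (p + 2) → Form D EG 1)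
    (h : p + 1 + 0 = 2 * k) (h' : p + (0 + 1) = 2 * k) :
    ∑ i : Fin (p + 2), (-1 : ℝ) ^ (i : ℕ) • (-1 : ℝ) ^ p •
        transForm₂ (fun a j ↦ θ a (i.succAbove j)) h' f =
      transForm (θ 1) h f - transForm (θ 0) h f := by
  refine Form.ext_eval fun n φ hφ x v ↦ ?_
  simp only [map_sum, map_smul, map_sub]
  exact sum_transgress₂ f (fun i j ↦ (θ i j).contDiff_curry hφ) h h' x v

/-- For k = 0 the map f has no arguments, so the connection does not enter. This is the total degree
0, where the homotopy cochain is zero. -/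
theorem transForm_degree_zero (f : InvPoly EG G 0) (θ θ' : Fin 1 → Form D EG 1)
    (h : 0 + 0 = 2 * 0) : transForm θ h f = transForm θ' h f := by
  refine Form.ext_eval fun n φ hφ x v ↦ ?_
  show transgress f _ h x v = transgress f _ h x v
  rw [transgress_apply f fun j ↦ (θ j).contDiff_curry hφ,
    transgress_apply f fun j ↦ (θ' j).contDiff_curry hφ]
  simp only [simpChern, chernForm_apply, evalPoly]
  simp only [Subsingleton.elim (α := Fin 0 → EG) _ Fin.elim0]

theorem pullback_transForm_congr {Y : Type*} {DY : DiffeologicalSpace Y} {F F' : Y → X}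
    (hF : DSmooth F) (hF' : DSmooth F') {θ : Fin (p + 1) → Form D EG 1} (h : p + q = 2 * k)
    (e : ∀ j, pullback F hF 1 (θ j) = pullback F' hF' 1 (θ j)) :
    pullback F hF q (transForm θ h f) = pullback F' hF' q (transForm θ h f) := by
  rw [pullback_transForm, pullback_transForm, funext e]

end FormIdentities

/-! ### The total differential on cochains. -/

namespace DiffGroupoid

variable {A O : Type*} (𝓖 : DiffGroupoid A O)

theorem horD_succ (p q : ℕ) (c : 𝓖.DoubleComplex) : 𝓖.horD (p + 1) q c =
    ∑ i : Fin (p + 2), (-1 : ℝ) ^ (i : ℕ) • pullback (𝓖.face i) (𝓖.dSmooth_face i) q (c p q) := by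
  simp [horD]

theorem totalD_mem_coboundaries {m n : ℕ} (h : n = m + 1) {c : 𝓖.DoubleComplex}
    (hc : c ∈ 𝓖.totalDeg m) : 𝓖.totalD c ∈ 𝓖.coboundaries n := by
  subst h; exact ⟨c, hc, rfl⟩

end DiffGroupoid

/-! ### The Chern-Weil cochains and classes. -/

namespace PrincipalBundle

variable {EA : Type*} [NormedAddCommGroup EA] [NormedSpace ℝ EA]
  {A : Type*} [TopologicalSpace A] [ChartedSpace EA A]
  {EO : Type*} [NormedAddCommGroup EO] [NormedSpace ℝ EO]
  {O : Type*} [TopologicalSpace O] [ChartedSpace EO O]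
  {EG : Type*} [NormedAddCommGroup EG] [NormedSpace ℝ EG] [CompleteSpace EG]
  {G : Type*} [TopologicalSpace G] [ChartedSpace EG G] [Group G] [LieGroup 𝓘(ℝ, EG) ∞ G]
  {EP : Type*} [NormedAddCommGroup EP] [NormedSpace ℝ EP]
  {P : Type*} [TopologicalSpace P] [ChartedSpace EP P] [IsManifold 𝓘(ℝ, EP) ∞ P]
  {𝓖 : LieGroupoid EA A EO O} {𝓟 : PrincipalBundle EG G EP P 𝓖} {k p q : ℕ}

theorem curry_vertexForm {θ : 𝓟.OneForm} (hθ : 𝓟.IsPseudoConnection θ) {n : ℕ}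
    {ψ ψ' : Euc n → 𝓟.transformation.Nerve p} {g : Euc n → G}
    (hψ : @IsPlot _ (𝓟.transformation.nerveDiffeology p) n ψ)
    (hψ' : @IsPlot _ (𝓟.transformation.nerveDiffeology p) n ψ')
    (hg : ContMDiff 𝓘(ℝ, Euc n) 𝓘(ℝ, EG) ∞ g) (h : ∀ w i,
      𝓟.act (𝓟.transformation.vertex i (ψ w)) (g w) = 𝓟.transformation.vertex i (ψ' w))
    (i : Fin (p + 1)) :
    (𝓟.vertexForm θ i).curry ψ' hψ' = gauge ((𝓟.vertexForm θ i).curry ψ hψ) g :=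
  hθ.curry_act (𝓟.transformation.dSmooth_vertex i n ψ hψ)
    (𝓟.transformation.dSmooth_vertex i n ψ' hψ') hg fun w ↦ h w i

theorem exists_descent_transForm {θ : 𝓟.OneForm} (hθ : 𝓟.IsPseudoConnection θ)
    (h : p + q = 2 * k) : ∃ T : InvPoly EG G k →ₗ[ℝ] 𝓖.toDiff.NerveForm p q, ∀ f,
      pullback (𝓟.nerveProj p) (𝓟.dSmooth_nerveProj p) q (T f) =
        transForm (fun i ↦ 𝓟.vertexForm θ i) h f := by
  let S : InvPoly EG G k →ₗ[ℝ] Form (𝓟.transformation.nerveDiffeology p) ℝ q :=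
    transForm (fun i ↦ 𝓟.vertexForm θ i) h
  refine exists_linear_descent (𝓟.dSmooth_nerveProj p) (𝓟.hasLocalLifts_nerveProj p) S fun f n ψ ψ' hψ hψ' e ↦ ?_
  obtain ⟨g, hg, hact⟩ := 𝓟.exists_vertex_act_eq hψ hψ' e
  exact transForm_on_eq _ h f hψ hψ' hg (curry_vertexForm hθ hψ hψ' hg hact)

theorem exists_descent_transForm₂ {θ : Fin 2 → 𝓟.OneForm} (hθ : ∀ a, 𝓟.IsPseudoConnection (θ a))
    (h : p + (q + 1) = 2 * k) : ∃ T : InvPoly EG G k →ₗ[ℝ] 𝓖.toDiff.NerveForm p q, ∀ f,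
      pullback (𝓟.nerveProj p) (𝓟.dSmooth_nerveProj p) q (T f) =
        transForm₂ (fun a i ↦ 𝓟.vertexForm (θ a) i) h f := by
  let S : InvPoly EG G k →ₗ[ℝ] Form (𝓟.transformation.nerveDiffeology p) ℝ q :=
    transForm₂ (fun a i ↦ 𝓟.vertexForm (θ a) i) h
  refine exists_linear_descent (𝓟.dSmooth_nerveProj p) (𝓟.hasLocalLifts_nerveProj p) S fun f n ψ ψ' hψ hψ' e ↦ ?_
  obtain ⟨g, hg, hact⟩ := 𝓟.exists_vertex_act_eq hψ hψ' e
  exact transForm₂_on_eq _ h f hψ hψ' hg fun a ↦ curry_vertexForm (hθ a) hψ hψ' hg hact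

/-- The cochain `z_θ(f)`. -/
def chernWeilCochain {θ : 𝓟.OneForm} (hθ : 𝓟.IsPseudoConnection θ) (k : ℕ) :
    InvPoly EG G k →ₗ[ℝ] 𝓖.toDiff.DoubleComplex :=
  LinearMap.pi fun p ↦ LinearMap.pi fun q ↦
    if h : p + q = 2 * k then (exists_descent_transForm hθ h).choose else 0

theorem pullback_chernWeilCochain {θ : 𝓟.OneForm} (hθ : 𝓟.IsPseudoConnection θ)
    (h : p + q = 2 * k) (f : InvPoly EG G k) :
    pullback (𝓟.nerveProj p) (𝓟.dSmooth_nerveProj p) q (chernWeilCochain hθ k f p q) =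
      transForm (fun i ↦ 𝓟.vertexForm θ i) h f := by
  simp only [chernWeilCochain, LinearMap.pi_apply, dif_pos h]
  exact (exists_descent_transForm hθ h).choose_spec f

theorem chernWeilCochain_eq_zero {θ : 𝓟.OneForm} (hθ : 𝓟.IsPseudoConnection θ)
    (h : p + q ≠ 2 * k) (f : InvPoly EG G k) : chernWeilCochain hθ k f p q = 0 := by
  simp only [chernWeilCochain, LinearMap.pi_apply, dif_neg h, LinearMap.zero_apply]

/-- The homotopy between the Chern-Weil cochains of two pseudo-connections. -/
def homotopyCochain {θ : Fin 2 → 𝓟.OneForm} (hθ : ∀ a, 𝓟.IsPseudoConnection (θ a)) (k : ℕ) :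
    InvPoly EG G k →ₗ[ℝ] 𝓖.toDiff.DoubleComplex :=
  LinearMap.pi fun p ↦ LinearMap.pi fun q ↦
    if h : p + (q + 1) = 2 * k then (-1 : ℝ) ^ p • (exists_descent_transForm₂ hθ h).choose else 0

theorem pullback_homotopyCochain {θ : Fin 2 → 𝓟.OneForm} (hθ : ∀ a, 𝓟.IsPseudoConnection (θ a))
    (h : p + (q + 1) = 2 * k) (f : InvPoly EG G k) :
    pullback (𝓟.nerveProj p) (𝓟.dSmooth_nerveProj p) q (homotopyCochain hθ k f p q) =
      (-1 : ℝ) ^ p • transForm₂ (fun a i ↦ 𝓟.vertexForm (θ a) i) h f := by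
  simp only [homotopyCochain, LinearMap.pi_apply, dif_pos h, LinearMap.smul_apply, map_smul]
  rw [(exists_descent_transForm₂ hθ h).choose_spec f]

theorem homotopyCochain_eq_zero {θ : Fin 2 → 𝓟.OneForm} (hθ : ∀ a, 𝓟.IsPseudoConnection (θ a))
    (h : p + (q + 1) ≠ 2 * k) (f : InvPoly EG G k) : homotopyCochain hθ k f p q = 0 := by
  simp only [homotopyCochain, LinearMap.pi_apply, dif_neg h, LinearMap.zero_apply]

/-- It lets equations between descended forms on Γ_p be verified on Q_p, where explicit formulas are
available. -/
theorem pullback_nerveProj_injective (𝓟 : PrincipalBundle EG G EP P 𝓖) (p q : ℕ) :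
    Function.Injective (pullback (V := ℝ) (𝓟.nerveProj p) (𝓟.dSmooth_nerveProj p) q) :=
  pullback_injective _ (𝓟.hasLocalLifts_nerveProj p)

theorem pullback_horD (p q : ℕ) (c : 𝓖.toDiff.DoubleComplex) :
    pullback (𝓟.nerveProj (p + 1)) (𝓟.dSmooth_nerveProj (p + 1)) q (𝓖.toDiff.horD (p + 1) q c) =
      ∑ i : Fin (p + 2), (-1 : ℝ) ^ (i : ℕ) • pullback (𝓟.transformation.face i)
        (𝓟.transformation.dSmooth_face i) q
          (pullback (𝓟.nerveProj p) (𝓟.dSmooth_nerveProj p) q (c p q)) := by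
  rw [DiffGroupoid.horD_succ, map_sum]
  simp only [map_smul]
  rfl

theorem pullback_vertD (p q : ℕ) (c : 𝓖.toDiff.DoubleComplex) :
    pullback (𝓟.nerveProj p) (𝓟.dSmooth_nerveProj p) (q + 1) (𝓖.toDiff.vertD p (q + 1) c) =
      (-1 : ℝ) ^ p • extD q (pullback (𝓟.nerveProj p) (𝓟.dSmooth_nerveProj p) q (c p q)) := rfl

theorem vertD_eq_zero {c : 𝓖.toDiff.DoubleComplex} {m : ℕ} (hc : c ∈ 𝓖.toDiff.totalDeg m)
    (h : p + q ≠ m + 1) : 𝓖.toDiff.vertD p q c = 0 := by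
  rcases q with _ | q
  · rfl
  · have : c p q = 0 := hc p q (by omega)
    simp [DiffGroupoid.vertD, this]

theorem horD_eq_zero {c : 𝓖.toDiff.DoubleComplex} {m : ℕ} (hc : c ∈ 𝓖.toDiff.totalDeg m)
    (h : p + q ≠ m + 1) : 𝓖.toDiff.horD p q c = 0 := by
  rcases p with _ | p
  · rfl
  · have : c p q = 0 := hc p q (by omega)
    simp [DiffGroupoid.horD, this]

theorem chernWeilCochain_mem_totalDeg {θ : 𝓟.OneForm} (hθ : 𝓟.IsPseudoConnection θ)
    (f : InvPoly EG G k) : chernWeilCochain hθ k f ∈ 𝓖.toDiff.totalDeg (2 * k) :=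
  fun _ _ h ↦ chernWeilCochain_eq_zero hθ h f

/-- On Q_p this is the cocycle identity for transgressions, since a face map omits a vertex and
hence one of the forms θ_j. At p = 0 the horizontal part is absent, at q = 0 the vertical part. -/
theorem totalD_chernWeilCochain {θ : 𝓟.OneForm} (hθ : 𝓟.IsPseudoConnection θ)
    (f : InvPoly EG G k) : 𝓖.toDiff.totalD (chernWeilCochain hθ k f) = 0 := by
  have hdeg := chernWeilCochain_mem_totalDeg hθ f
  funext p q
  show 𝓖.toDiff.vertD p q _ + 𝓖.toDiff.horD p q _ = 0
  by_cases h : p + q = 2 * k + 1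
  · refine 𝓟.pullback_nerveProj_injective p q ?_
    rw [map_zero, map_add]
    rcases p with _ | p
    · rcases q with _ | q
      · omega
      · rw [pullback_vertD, pullback_chernWeilCochain hθ (by omega), extD_transForm_zero, smul_zero,
          zero_add]
        exact map_zero _
    · rw [pullback_horD, pullback_chernWeilCochain hθ (by omega : p + q = 2 * k)]
      rcases q with _ | q
      · refine Eq.trans (zero_add _) ?_
        exact sum_transForm_eq_zero f (fun i ↦ 𝓟.vertexForm θ i) (by omega)
      · rw [pullback_vertD, pullback_chernWeilCochain hθ (by omega : p + 1 + q = 2 * k)]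
        exact extD_transForm_succ f (fun i ↦ 𝓟.vertexForm θ i) (by omega) (by omega)
  · rw [vertD_eq_zero hdeg h, horD_eq_zero hdeg h, add_zero]

/-- The factor (-1)^p in the homotopy cancels the one in the vertical differential and supplies the
sign of the horizontal terms. The corner p = q = 0 forces k = 0 and is treated apart. -/
theorem totalD_homotopyCochain {θ : Fin 2 → 𝓟.OneForm} (hθ : ∀ a, 𝓟.IsPseudoConnection (θ a))
    (f : InvPoly EG G k) : 𝓖.toDiff.totalD (homotopyCochain hθ k f) =
      chernWeilCochain (hθ 1) k f - chernWeilCochain (hθ 0) k f := by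
  funext p q
  show 𝓖.toDiff.vertD p q _ + 𝓖.toDiff.horD p q _ =
    chernWeilCochain (hθ 1) k f p q - chernWeilCochain (hθ 0) k f p q
  by_cases h : p + q = 2 * k
  · refine 𝓟.pullback_nerveProj_injective p q ?_
    rw [map_sub, map_add, pullback_chernWeilCochain _ h, pullback_chernWeilCochain _ h]
    have hs : ∀ p : ℕ, (-1 : ℝ) ^ p * (-1) ^ p = 1 := fun p ↦ by rw [← mul_pow]; simp
    rcases p with _ | p
    · rcases q with _ | q
      · obtain rfl : k = 0 := by omega
        rw [transForm_degree_zero f _ (fun i ↦ 𝓟.vertexForm (θ 0) i), sub_self]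
        exact (add_zero _ : _ + (0 : Form (𝓟.transformation.nerveDiffeology 0) ℝ 0) = _)
      · rw [pullback_vertD, pullback_homotopyCochain hθ h, map_smul, _root_.smul_smul, hs, _root_.one_smul,
          ← extD_transForm₂_zero f (fun a i ↦ 𝓟.vertexForm (θ a) i) h]
        exact add_zero _
    · rw [pullback_horD, pullback_homotopyCochain hθ (by omega : p + (q + 1) = 2 * k)]
      rcases q with _ | q
      · refine Eq.trans (zero_add _) ?_
        rw [← sum_transForm₂ f (fun a i ↦ 𝓟.vertexForm (θ a) i) h (by omega)]
        simp only [map_smul]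
        rfl
      · rw [pullback_vertD, pullback_homotopyCochain hθ h, map_smul, _root_.smul_smul, hs, _root_.one_smul,
          ← extD_transForm₂_succ f (fun a i ↦ 𝓟.vertexForm (θ a) i) h (by omega)]
        simp only [map_smul]
        rfl
  · have hdeg : ∀ p q, p + (q + 1) ≠ 2 * k → homotopyCochain hθ k f p q = 0 :=
      fun p q h ↦ homotopyCochain_eq_zero hθ h f
    rw [chernWeilCochain_eq_zero _ h, chernWeilCochain_eq_zero _ h, sub_zero]
    have h1 : 𝓖.toDiff.vertD p q (homotopyCochain hθ k f) = 0 := by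
      rcases q with _ | q
      · rfl
      · simp [DiffGroupoid.vertD, hdeg p q h]
    have h2 : 𝓖.toDiff.horD p q (homotopyCochain hθ k f) = 0 := by
      rcases p with _ | p
      · rfl
      · simp [DiffGroupoid.horD, hdeg p q (by omega)]
    rw [h1, h2, add_zero]

theorem sub_mem_coboundaries {θ θ' : 𝓟.OneForm} (hθ : 𝓟.IsPseudoConnection θ)
    (hθ' : 𝓟.IsPseudoConnection θ') (f : InvPoly EG G k) :
    chernWeilCochain hθ' k f - chernWeilCochain hθ k f ∈ 𝓖.toDiff.coboundaries (2 * k) := by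
  have hΘ : ∀ a, 𝓟.IsPseudoConnection ((![θ, θ'] : Fin 2 → 𝓟.OneForm) a) := fun a ↦ by
    fin_cases a
    · exact hθ
    · exact hθ'
  have e := totalD_homotopyCochain hΘ f
  have e' : 𝓖.toDiff.totalD (homotopyCochain hΘ k f) =
    chernWeilCochain hθ' k f - chernWeilCochain hθ k f := e
  rw [← e']
  rcases k with _ | k
  · have h0 : homotopyCochain hΘ 0 f = 0 :=
      funext fun p ↦ funext fun q ↦ homotopyCochain_eq_zero hΘ (by omega) f
    rw [h0, map_zero]
    exact zero_mem _
  · exact 𝓖.toDiff.totalD_mem_coboundaries (m := 2 * k + 1) (by omega)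
      fun p q h ↦ homotopyCochain_eq_zero hΘ (by omega) f

theorem isChernWeilMap_unique {θ : 𝓟.OneForm} {z z' : InvPoly EG G k →ₗ[ℝ] 𝓖.toDiff.cocycles (2 * k)}
    (hz : 𝓟.IsChernWeilMap θ k z) (hz' : 𝓟.IsChernWeilMap θ k z') : z = z' := by
  refine LinearMap.ext fun f ↦ Subtype.ext (funext fun p ↦ funext fun q ↦ ?_)
  by_cases h : p + q = 2 * k
  · refine 𝓟.pullback_nerveProj_injective p q (Form.ext_eval fun n φ hφ x v ↦ ?_)
    exact (hz f p q h n φ hφ x v).trans (hz' f p q h n φ hφ x v).symm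
  · exact ((z f).2.1 p q h).trans ((z' f).2.1 p q h).symm

/-- The Chern-Weil map on the cochain level. -/
def chernWeilMap {θ : 𝓟.OneForm} (hθ : 𝓟.IsPseudoConnection θ) (k : ℕ) :
    InvPoly EG G k →ₗ[ℝ] 𝓖.toDiff.cocycles (2 * k) :=
  (chernWeilCochain hθ k).codRestrict _ fun f ↦
    ⟨chernWeilCochain_mem_totalDeg hθ f, totalD_chernWeilCochain hθ f⟩

theorem isChernWeilMap_chernWeilMap {θ : 𝓟.OneForm} (hθ : 𝓟.IsPseudoConnection θ) (k : ℕ) :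
    𝓟.IsChernWeilMap θ k (chernWeilMap hθ k) := by
  intro f p q h n φ hφ x v
  rw [simplexIntegral_eq f fun i ↦ Form.contDiff_on _ hφ]
  exact congrArg (Form.eval φ hφ x v) (pullback_chernWeilCochain hθ h f)

theorem mkQ_chernWeilMap_eq {θ θ' : 𝓟.OneForm} (hθ : 𝓟.IsPseudoConnection θ)
    (hθ' : 𝓟.IsPseudoConnection θ') :
    Submodule.mkQ ((𝓖.toDiff.coboundaries (2 * k)).comap (𝓖.toDiff.cocycles (2 * k)).subtype) ∘ₗ
        chernWeilMap hθ k = Submodule.mkQ _ ∘ₗ chernWeilMap hθ' k :=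
  LinearMap.ext fun f ↦ (Submodule.Quotient.eq _).2 (sub_mem_coboundaries hθ' hθ f)

/-- The pseudo-connection hidden in the existential may be replaced by the given one, because
cohomologous cocycles have the same class; so w_P is unique and can be computed from the connection.
-/
theorem isChernWeilClassMap_iff {θ : 𝓟.OneForm} (hθ : 𝓟.IsPseudoConnection θ)
    {w : InvPoly EG G k →ₗ[ℝ] 𝓖.toDiff.deRham (2 * k)} :
    𝓟.IsChernWeilClassMap k w ↔ w = Submodule.mkQ _ ∘ₗ chernWeilMap hθ k := by
  constructor
  · rintro ⟨θ', hθ', z, hz, rfl⟩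
    rw [isChernWeilMap_unique hz (isChernWeilMap_chernWeilMap hθ' k)]
    exact mkQ_chernWeilMap_eq hθ' hθ
  · rintro rfl
    exact ⟨θ, hθ, _, isChernWeilMap_chernWeilMap hθ k, rfl⟩

/-- Viewing f(Ω) as a transgression over Δ_0 makes the results on smoothness, descent and closedness
of transgressions available for it. -/
theorem evalPoly_curvature {X : Type*} {D : DiffeologicalSpace X} (θ : Form D EG 1) {n : ℕ}
    {φ : Euc n → X} (hφ : IsPlot φ) (f : InvPoly EG G k) (x : Euc n) (v : Fin (2 * k) → Euc n) :
    evalPoly f.1 (curvature G (θ.on φ hφ) x) v =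
      transgress (p := 0) f (fun _ ↦ θ.curry φ hφ) (zero_add (2 * k)) x v := by
  rw [transgress_const_zero f (θ.contDiff_curry hφ), chernForm_apply]
  congr 1
  exact funext fun a ↦ funext fun b ↦
    curry₁_curvature ((θ.contDiff_on hφ).differentiable (by simp) x) a b

theorem isUsualChernWeilMap_unique {θ : 𝓟.OneForm}
    {z z' : InvPoly EG G k →ₗ[ℝ] 𝓖.toDiff.invCocycles (2 * k)}
    (hz : 𝓟.IsUsualChernWeilMap θ k z) (hz' : 𝓟.IsUsualChernWeilMap θ k z') : z = z' := by
  refine LinearMap.ext fun f ↦ Subtype.ext ?_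
  refine pullback_injective 𝓟.dSmooth_proj 𝓟.hasLocalLifts_proj
    (Form.ext_eval fun n φ hφ x v ↦ ?_)
  exact (hz f n φ hφ x v).trans (hz' f n φ hφ x v).symm

/-- Descent to Γ_0 needs only a pseudo-connection; the condition ∂θ = 0 is what makes the descended
form invariant. -/
theorem exists_isUsualChernWeilMap {θ : 𝓟.OneForm} (hθ : 𝓟.IsConnection θ) (k : ℕ) :
    ∃ z, 𝓟.IsUsualChernWeilMap θ k z := by
  let S : InvPoly EG G k →ₗ[ℝ] Form (manifoldDiffeology EP P) ℝ (2 * k) :=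
    transForm (fun _ : Fin 1 ↦ θ) (zero_add (2 * k))
  obtain ⟨T, hT⟩ : ∃ T : InvPoly EG G k →ₗ[ℝ] Form 𝓖.toDiff.dO ℝ (2 * k), ∀ f,
      pullback 𝓟.proj 𝓟.dSmooth_proj (2 * k) (T f) = S f := by
    refine exists_linear_descent 𝓟.dSmooth_proj 𝓟.hasLocalLifts_proj S
      fun f n ψ ψ' hψ hψ' e ↦ ?_
    obtain ⟨g, hg, hact⟩ := 𝓟.exists_contMDiff_act_eq hψ hψ' fun w ↦ (e w).symm
    exact transForm_on_eq _ _ f hψ hψ' hg fun _ ↦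
      hθ.toIsPseudoConnection.curry_act hψ hψ' hg hact
  have hinv : ∀ f, T f ∈ 𝓖.toDiff.invForms (2 * k) := by
    intro f
    have h1 : pullback _ 𝓟.dSmooth_arrow (2 * k)
        (pullback 𝓖.toDiff.src 𝓖.toDiff.dSmooth_src (2 * k) (T f)) =
        pullback 𝓟.transformation.src 𝓟.transformation.dSmooth_src (2 * k)
          (pullback 𝓟.proj 𝓟.dSmooth_proj (2 * k) (T f)) :=
      pullback_pullback_congr _ _ _ _ _ _ _ _ (fun a : 𝓟.Arrow ↦ a.2) _
    have h2 : pullback _ 𝓟.dSmooth_arrow (2 * k)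
        (pullback 𝓖.toDiff.tgt 𝓖.toDiff.dSmooth_tgt (2 * k) (T f)) =
        pullback 𝓟.transformation.tgt 𝓟.transformation.dSmooth_tgt (2 * k)
          (pullback 𝓟.proj 𝓟.dSmooth_proj (2 * k) (T f)) :=
      pullback_pullback_congr _ _ _ _ _ _ _ _ (fun a : 𝓟.Arrow ↦ (𝓟.proj_smul _ _ _).symm) _
    have h3 : pullback 𝓟.transformation.src 𝓟.transformation.dSmooth_src 1 θ =
        pullback 𝓟.transformation.tgt 𝓟.transformation.dSmooth_tgt 1 θ :=
      sub_eq_zero.1 hθ.boundary_eq_zero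
    have h4 : pullback 𝓟.transformation.src 𝓟.transformation.dSmooth_src (2 * k) (S f) =
        pullback 𝓟.transformation.tgt 𝓟.transformation.dSmooth_tgt (2 * k) (S f) :=
      pullback_transForm_congr f _ _ _ fun _ ↦ h3
    rw [← hT f] at h4
    -- The two pull-backs agree on Q because those of θ do, and Q → Γ has local lifts, so they agree
    -- on Γ.
    have h5 : pullback 𝓖.toDiff.src 𝓖.toDiff.dSmooth_src (2 * k) (T f) =
        pullback 𝓖.toDiff.tgt 𝓖.toDiff.dSmooth_tgt (2 * k) (T f) :=
      pullback_injective 𝓟.dSmooth_arrow 𝓟.hasLocalLifts_arrow (h1.trans (h4.trans h2.symm))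
    exact sub_eq_zero.2 h5
  have hclosed : ∀ f, extD (2 * k) (T f) = 0 := by
    intro f
    refine pullback_injective 𝓟.dSmooth_proj 𝓟.hasLocalLifts_proj ?_
    exact (extD_pullback 𝓟.proj 𝓟.dSmooth_proj (2 * k) (T f)).symm.trans
      ((congrArg (extD (2 * k)) (hT f)).trans ((extD_transForm_zero f _ _).trans (map_zero _).symm))
  refine ⟨T.codRestrict _ fun f ↦ ⟨hinv f, hclosed f⟩, fun f n φ hφ x v ↦ ?_⟩
  exact (congrArg (Form.eval (D := manifoldDiffeology EP P) φ hφ x v) (hT f)).trans (evalPoly_curvature θ hφ f x v).symm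

/-- The arrow `g i 0` has source the vertex 0 and target the vertex i; pull back ∂θ = 0 along it. -/
theorem IsConnection.vertexForm_eq {θ : 𝓟.OneForm} (hθ : 𝓟.IsConnection θ) (i : Fin (p + 1)) :
    𝓟.vertexForm θ i = 𝓟.vertexForm θ 0 := by
  have hs : @DSmooth _ _ (𝓟.transformation.nerveDiffeology p) 𝓟.transformation.dA
      (fun g : 𝓟.transformation.Nerve p ↦ g.1 i 0) :=
    fun n φ hφ ↦ (𝓟.transformation.nerve_isPlot_iff φ).1 hφ i 0
  have h3 : pullback 𝓟.transformation.src 𝓟.transformation.dSmooth_src 1 θ =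
      pullback 𝓟.transformation.tgt 𝓟.transformation.dSmooth_tgt 1 θ :=
    sub_eq_zero.1 hθ.boundary_eq_zero
  have h4 := congrArg (pullback _ hs 1) h3
  refine Form.ext_on fun n φ hφ x ↦ ?_
  have e1 : 𝓟.transformation.vertex i ∘ φ = fun y ↦ 𝓟.transformation.tgt ((φ y).1 i 0) :=
    funext fun y ↦ (φ y).2.1 i i 0
  have e2 : 𝓟.transformation.vertex 0 ∘ φ = fun y ↦ 𝓟.transformation.src ((φ y).1 i 0) :=
    funext fun y ↦ ((φ y).2.1 0 0 0).trans ((φ y).2.1 i 0 0).symm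
  have e3 := θ.on_congr (𝓟.transformation.dSmooth_vertex i n φ hφ) e1
  have e4 := θ.on_congr (𝓟.transformation.dSmooth_vertex 0 n φ hφ) e2
  exact (congrFun e3 x).trans
    ((congrArg (fun η ↦ Form.on η φ hφ x) h4).symm.trans (congrFun e4 x).symm)

/-- The heart of the matter: all vertex forms being equal, the transgression is that of a constant
family, which is f(Ω) for p = 0 and zero for p > 0, exactly the shape of the inclusion. Uniqueness
of z_θ then finishes. -/
theorem isChernWeilMap_inclZ {θ : 𝓟.OneForm} (hθ : 𝓟.IsConnection θ)
    {z : InvPoly EG G k →ₗ[ℝ] 𝓖.toDiff.invCocycles (2 * k)} (hz : 𝓟.IsUsualChernWeilMap θ k z) :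
    𝓟.IsChernWeilMap θ k (𝓖.toDiff.inclZ (2 * k) ∘ₗ z) := by
  intro f p q h n φ hφ x v
  rw [simplexIntegral_eq f fun i ↦ Form.contDiff_on _ hφ]
  have e : (fun i w ↦ curry₁ ((𝓟.vertexForm θ i).on φ hφ w)) =
      fun _ : Fin (p + 1) ↦ (𝓟.vertexForm θ 0).curry φ hφ :=
    funext fun i ↦ by rw [hθ.vertexForm_eq i]; rfl
  refine Eq.trans ?_ (congrArg (fun Θ ↦ transgress f Θ h x v) e).symm
  rcases p with _ | p
  · obtain rfl : q = 2 * k := by omega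
    have h0 : ((𝓖.toDiff.inclZ (2 * k) ∘ₗ z) f).1 0 (2 * k) =
        pullback (𝓖.toDiff.vertex 0) (𝓖.toDiff.dSmooth_vertex 0) (2 * k) (z f).1 := by
      simp [DiffGroupoid.inclZ, DiffGroupoid.incl]
    have h1 : pullback (𝓟.nerveProj 0) (𝓟.dSmooth_nerveProj 0) (2 * k)
        (pullback (𝓖.toDiff.vertex 0) (𝓖.toDiff.dSmooth_vertex 0) (2 * k) (z f).1) =
        pullback (𝓟.transformation.vertex 0) (𝓟.transformation.dSmooth_vertex 0) (2 * k)
          (pullback 𝓟.proj 𝓟.dSmooth_proj (2 * k) (z f).1) :=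
      pullback_pullback_congr _ _ _ _ _ _ _ _ (fun g ↦ (g.1 0 0).2) _
    rw [h0, h1]
    refine (hz f n _ (𝓟.transformation.dSmooth_vertex 0 n φ hφ) x v).trans ?_
    exact evalPoly_curvature θ _ f x v
  · have h0 : ((𝓖.toDiff.inclZ (2 * k) ∘ₗ z) f).1 (p + 1) q = 0 := by
      simp [DiffGroupoid.inclZ, DiffGroupoid.incl]
    rw [h0, map_zero]
    exact (transgress_const_succ f (Form.contDiff_curry _ hφ) h x v).symm

theorem IsFlat.eq_zero {θ : 𝓟.OneForm} (hθ : 𝓟.IsFlat θ) (hk : 0 < k)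
    {z : InvPoly EG G k →ₗ[ℝ] 𝓖.toDiff.invCocycles (2 * k)} (hz : 𝓟.IsUsualChernWeilMap θ k z) :
    z = 0 := by
  refine LinearMap.ext fun f ↦ Subtype.ext ?_
  refine pullback_injective 𝓟.dSmooth_proj 𝓟.hasLocalLifts_proj
    (Form.ext_eval fun n φ hφ x v ↦ (hz f n φ hφ x v).trans ?_)
  refine Eq.trans ?_ (show (0 : ℝ) = _ from rfl)
  rw [evalPoly, Finset.sum_eq_zero fun s _ ↦ ?_, mul_zero]
  rw [f.1.map_coord_zero ⟨0, hk⟩ (hθ n φ hφ x _ _), mul_zero]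

end PrincipalBundle

end GroupoidCW

/-! ### Conclusion. -/

open GroupoidCW in
theorem theoremF
    {EA : Type*} [NormedAddCommGroup EA] [NormedSpace ℝ EA] [FiniteDimensional ℝ EA]
    {A : Type*} [TopologicalSpace A] [ChartedSpace EA A] [IsManifold 𝓘(ℝ, EA) ∞ A]
    {EO : Type*} [NormedAddCommGroup EO] [NormedSpace ℝ EO] [FiniteDimensional ℝ EO]
    {O : Type*} [TopologicalSpace O] [ChartedSpace EO O] [IsManifold 𝓘(ℝ, EO) ∞ O]
    {EG : Type*} [NormedAddCommGroup EG] [NormedSpace ℝ EG] [FiniteDimensional ℝ EG]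
    {G : Type*} [TopologicalSpace G] [ChartedSpace EG G] [Group G] [LieGroup 𝓘(ℝ, EG) ∞ G]
    {EP : Type*} [NormedAddCommGroup EP] [NormedSpace ℝ EP] [FiniteDimensional ℝ EP]
    {P : Type*} [TopologicalSpace P] [ChartedSpace EP P] [IsManifold 𝓘(ℝ, EP) ∞ P]
    (𝓖 : LieGroupoid EA A EO O) (𝓟 : PrincipalBundle EG G EP P 𝓖)
    (θ : 𝓟.OneForm) (hθ : 𝓟.IsConnection θ) (k : ℕ) :
    (∃! z, 𝓟.IsUsualChernWeilMap θ k z) ∧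
    (∀ θ' : 𝓟.OneForm, 𝓟.IsPseudoConnection θ' → ∃! z', 𝓟.IsChernWeilMap θ' k z') ∧
    (∃! w, 𝓟.IsChernWeilClassMap k w) ∧
    ∀ z zθ wP, 𝓟.IsUsualChernWeilMap θ k z → 𝓟.IsChernWeilMap θ k zθ → 𝓟.IsChernWeilClassMap k wP →
      zθ = 𝓖.toDiff.inclZ (2 * k) ∘ₗ z ∧
      wP = 𝓖.toDiff.inclH (2 * k) ∘ₗ Submodule.mkQ _ ∘ₗ z ∧
      (𝓟.IsFlat θ → 0 < k → zθ = 0 ∧ wP = 0) := by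
  have : CompleteSpace EG := FiniteDimensional.complete ℝ EG
  have hps := hθ.toIsPseudoConnection
  refine ⟨?_, fun θ' hθ' ↦ ?_, ?_, fun z zθ wP hz hzθ hwP ↦ ?_⟩
  · obtain ⟨z, hz⟩ := PrincipalBundle.exists_isUsualChernWeilMap hθ k
    exact ⟨z, hz, fun z' hz' ↦ PrincipalBundle.isUsualChernWeilMap_unique hz' hz⟩
  · exact ⟨_, PrincipalBundle.isChernWeilMap_chernWeilMap hθ' k, fun z' hz' ↦
      PrincipalBundle.isChernWeilMap_unique hz' (PrincipalBundle.isChernWeilMap_chernWeilMap hθ' k)⟩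
  · exact ⟨_, (PrincipalBundle.isChernWeilClassMap_iff hps).2 rfl, fun w hw ↦
      (PrincipalBundle.isChernWeilClassMap_iff hps).1 hw⟩
  · have e1 : zθ = 𝓖.toDiff.inclZ (2 * k) ∘ₗ z :=
      PrincipalBundle.isChernWeilMap_unique hzθ (PrincipalBundle.isChernWeilMap_inclZ hθ hz)
    have e2 : wP = 𝓖.toDiff.inclH (2 * k) ∘ₗ Submodule.mkQ _ ∘ₗ z := by
      -- Compute w_P with the connection itself: its cochain map is the inclusion after z, and the
      -- map induced on cohomology is the inclusion on representatives.
      rw [(PrincipalBundle.isChernWeilClassMap_iff hps).1 hwP, PrincipalBundle.isChernWeilMap_unique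
        (PrincipalBundle.isChernWeilMap_chernWeilMap hps k) (e1 ▸ hzθ)]
      rfl
    refine ⟨e1, e2, fun hflat hk ↦ ?_⟩
    rw [e1, e2, hflat.eq_zero hk hz]
    simp
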